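/- Let $N\ge 2$ and $0<s<1<p<N$, let $\Omega\subset\mathbb{R}^N$ be a bounded open set with Lipschitz boundary, and let $V,g\in L^q(\Omega)$ for some $q\in\left(\frac{N}{sp},\infty\right)$, with $V\ge 0$ and $g>0$ a.e. in $\Omega$. Let $$X_0^{s,p}(\Omega)=\{u\in W^{1,p}(\mathbb{R}^N): u|_\Omega\in W^{1,p}_0(\Omega),\ u=0 \text{ a.e. in } \mathbb{R}^N\setminus\Omega\}.$$ A real number $\lambda$ is an eigenvalue, with eigenfunction $u$, of the problem $$-\Delta_p u+(-\Delta_p)^s u+V|u|^{p-2}u=\lambda g|u|^{p-2}u \ \text{ in } \Omega,\qquad u=0\ \text{ in }\mathbb{R}^N\setminus\Omega,$$ if $u\in X_0^{s,p}(\Omega)$, $u\neq 0$, and for all $v\in X_0^{s,p}(\Omega)$ $$\int_\Omega|\nabla u|^{p-2}\nabla u\cdot\nabla v\,dx+\int_{\mathbb{R}^N}\int_{\mathbb{R}^N}\frac{|u(x)-u(y)|^{p-2}(u(x)-u(y))(v(x)-v(y))}{|x-y|^{N+ps}}\,dx\,dy+\int_\Omega V|u|^{p-2}uv\,dx-\lambda\int_\Omega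 g|u|^{p-2}uv\,dx=0 .$$ Let $\lambda_1$ be the first eigenvalue, i.e. the least positive eigenvalue. If $u$ is an eigenfunction associated with $\lambda_1$, then either $u>0$ a.e. in $\Omega$ or $u<0$ a.e. in $\Omega$. -/

import Mathlib

open MeasureTheory Filter Topology
open scoped ContDiff

namespace MixedEigenvalue

noncomputable section

/-- The Euclidean space `ℝ^N`. -/
abbrev Rn (N : ℕ) : Type := EuclideanSpace ℝ (Fin N)

variable {N : ℕ}

/-- The open set `Ω` has Lipschitz boundary: near each boundary point, in suitable orthonormal
coordinates with last axis in the direction of the unit vector `e`, it is the region strictly above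
the graph of a Lipschitz function `γ` of the remaining coordinates `x - ⟪e, x⟫ e`. -/
def HasLipschitzBoundary (Ω : Set (Rn N)) : Prop :=
  ∀ x₀ ∈ frontier Ω, ∃ r : ℝ, 0 < r ∧ ∃ e : Rn N, ‖e‖ = 1 ∧
    ∃ (K : NNReal) (γ : Rn N → ℝ), LipschitzWith K γ ∧
      ∀ x ∈ Metric.ball x₀ r, x ∈ Ω ↔ γ (x - inner ℝ e x • e) < inner ℝ e x

/-- `G` is a weak (distributional) gradient of `u` on the open set `U`: for every
`φ ∈ C_c^∞(U)`, `∫_U u ∇φ = - ∫_U φ G`. -/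
structure IsWeakGradient (U : Set (Rn N)) (u : Rn N → ℝ) (G : Rn N → Rn N) : Prop where
  locallyIntegrableOn_fun : LocallyIntegrableOn u U volume
  locallyIntegrableOn_grad : LocallyIntegrableOn G U volume
  integral_eq : ∀ φ : Rn N → ℝ, ContDiff ℝ ∞ φ → HasCompactSupport φ → tsupport φ ⊆ U →
    ∫ x in U, u x • gradient φ x = - ∫ x in U, φ x • G x

/-- Weak gradients on open sets are unique up to null sets. -/
theorem IsWeakGradient.ae_eq {U : Set (Rn N)} (hU : IsOpen U) {u : Rn N → ℝ}
    {G H : Rn N → Rn N} (hG : IsWeakGradient U u G) (hH : IsWeakGradient U u H) :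
    ∀ᵐ x ∂(volume.restrict U), G x = H x := by
  rw [ae_restrict_iff' hU.measurableSet]
  have key := hU.ae_eq_zero_of_integral_contDiff_smul_eq_zero (μ := volume)
    (f := fun x => G x - H x)
    (hG.locallyIntegrableOn_grad.sub hH.locallyIntegrableOn_grad) ?_
  · filter_upwards [key] with x hx hxU
    exact sub_eq_zero.mp (hx hxU)
  · intro φ hφ hc hs
    have e : ∫ x in U, φ x • G x = ∫ x in U, φ x • H x :=
      neg_injective ((hG.integral_eq φ hφ hc hs).symm.trans (hH.integral_eq φ hφ hc hs))
    have aux : ∀ F : Rn N → Rn N, LocallyIntegrableOn F U volume →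
        IntegrableOn (fun x => φ x • F x) U volume := by
      intro F hF
      have h1 : IntegrableOn (fun x => φ x • F x) (tsupport φ) volume :=
        (hF.integrableOn_compact_subset hs hc).continuousOn_smul
          hφ.continuous.continuousOn hc
      have h2 : Integrable (fun x => φ x • F x) volume := by
        rw [← integrableOn_iff_integrable_of_support_subset (s := tsupport φ)]
        · exact h1
        · intro x hx
          apply subset_tsupport φ
          intro h0
          exact hx (by simp [h0])
      exact h2.integrableOn
    have h3 : ∫ x, φ x • (G x - H x) = ∫ x in U, φ x • (G x - H x) := by
      symm
      apply setIntegral_eq_integral_of_forall_compl_eq_zero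
      intro x hx
      have : φ x = 0 := image_eq_zero_of_notMem_tsupport (fun h => hx (hs h))
      simp [this]
    rw [h3]
    simp only [smul_sub]
    rw [integral_sub (aux G hG.locallyIntegrableOn_grad) (aux H hH.locallyIntegrableOn_grad), e,
      sub_self]

open Classical in
/-- The weak gradient `∇u` of `u` on `U` (a representative of it; `0` if `u` has none). -/
def weakGradient (U : Set (Rn N)) (u : Rn N → ℝ) : Rn N → Rn N :=
  if h : ∃ G, IsWeakGradient U u G then h.choose else 0

theorem isWeakGradient_weakGradient {U : Set (Rn N)} {u : Rn N → ℝ}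
    (h : ∃ G, IsWeakGradient U u G) : IsWeakGradient U u (weakGradient U u) := by
  rw [weakGradient, dif_pos h]
  exact h.choose_spec

/-- `u ∈ W^{1,p}(U)`. -/
def MemW1p (p : ℝ) (U : Set (Rn N)) (u : Rn N → ℝ) : Prop :=
  MemLp u (ENNReal.ofReal p) (volume.restrict U) ∧
    ∃ G, IsWeakGradient U u G ∧ MemLp G (ENNReal.ofReal p) (volume.restrict U)

/-- `u ∈ W_0^{1,p}(U)`: the closure of `C_c^∞(U)` in `W^{1,p}(U)`. -/
def MemW1pZero (p : ℝ) (U : Set (Rn N)) (u : Rn N → ℝ) : Prop :=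
  MemW1p p U u ∧ ∃ φ : ℕ → Rn N → ℝ,
    (∀ n, ContDiff ℝ ∞ (φ n) ∧ HasCompactSupport (φ n) ∧ tsupport (φ n) ⊆ U) ∧
    Tendsto (fun n => eLpNorm (fun x => u x - φ n x) (ENNReal.ofReal p) (volume.restrict U))
      atTop (𝓝 0) ∧
    Tendsto (fun n => eLpNorm (fun x => weakGradient U u x - gradient (φ n) x)
      (ENNReal.ofReal p) (volume.restrict U)) atTop (𝓝 0)

/-- The solution space: `u ∈ W^{1,p}(ℝ^N)`, `u|_Ω ∈ W_0^{1,p}(Ω)` and `u = 0` a.e. in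
`ℝ^N \ Ω`. (The order `s` enters only through the norm.) -/
def MemX0 (p : ℝ) (Ω : Set (Rn N)) (u : Rn N → ℝ) : Prop :=
  MemW1p p Set.univ u ∧ MemW1pZero p Ω u ∧ ∀ᵐ x ∂(volume.restrict Ωᶜ), u x = 0

/-- The form `H_{s,p}(u,v)` of the mixed operator `-Δ_p + (-Δ_p)^s`. -/
def mixedForm (s p : ℝ) (Ω : Set (Rn N)) (u v : Rn N → ℝ) : ℝ :=
  (∫ x in Ω, ‖weakGradient Ω u x‖ ^ (p - 2) *
      inner ℝ (weakGradient Ω u x) (weakGradient Ω v x)) +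
  ∫ z : Rn N × Rn N,
    |u z.1 - u z.2| ^ (p - 2) * (u z.1 - u z.2) * (v z.1 - v z.2) / ‖z.1 - z.2‖ ^ ((N : ℝ) + p * s)

/-- `u` is a weak solution of `-Δ_p u + (-Δ_p)^s u + V |u|^{p-2} u = μ g |u|^{p-2} u` in `Ω`,
`u = 0` in `ℝ^N \ Ω`. -/
def IsWeakSolution (s p : ℝ) (Ω : Set (Rn N)) (V g : Rn N → ℝ) (μ : ℝ) (u : Rn N → ℝ) : Prop :=
  MemX0 p Ω u ∧ ∀ v : Rn N → ℝ, MemX0 p Ω v →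
    mixedForm s p Ω u v + (∫ x in Ω, V x * |u x| ^ (p - 2) * u x * v x)
      - μ * (∫ x in Ω, g x * |u x| ^ (p - 2) * u x * v x) = 0

/-- `u` is an eigenfunction associated with `μ`: a weak solution that is not the zero element. -/
def IsEigenfunction (s p : ℝ) (Ω : Set (Rn N)) (V g : Rn N → ℝ) (μ : ℝ) (u : Rn N → ℝ) : Prop :=
  IsWeakSolution s p Ω V g μ u ∧ ¬ (∀ᵐ x, u x = 0)

/-- `μ` is an eigenvalue. -/
def IsEigenvalue (s p : ℝ) (Ω : Set (Rn N)) (V g : Rn N → ℝ) (μ : ℝ) : Prop :=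
  ∃ u : Rn N → ℝ, IsEigenfunction s p Ω V g μ u

/-- `μ` is the first eigenvalue `λ₁`: the least positive eigenvalue. -/
def IsFirstEigenvalue (s p : ℝ) (Ω : Set (Rn N)) (V g : Rn N → ℝ) (μ : ℝ) : Prop :=
  IsLeast {ν : ℝ | 0 < ν ∧ IsEigenvalue s p Ω V g ν} μ

end

end MixedEigenvalue

/-! The eigenvalue problem is the Euler–Lagrange equation of the Rayleigh quotient `E(u) / ∫
g|u|^p`, where `E(u) = ∫|∇u|^p + [u]_{s,p}^p + ∫ V|u|^p`. Each term of `E`, and the denominator, is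
an `L^p` energy `∫‖a‖^p dμ` for a suitable measure: Lebesgue measure, the kernel measure
`gagliardo`, or a `weighted` measure. Convexity, differentiability and convergence are thus proved
once, for `energy` and its first variation `pairing`. The solution space is replaced by the closure
of `C_c^∞(Ω)` in `W^{1,p}(ℝ^N)`, recorded by `HasGradZero`.

Variational characterization. The infimum of the quotient is attained (`Setting.exists_minimizer`).
The Sobolev inequality controls the weights, and averages over small cubes give compactness in
`L^p`. Uniform convexity of the energy then makes a minimizing sequence Cauchy, so no weak
convergence is needed. The minimum is a positive eigenvalue, hence at least `λ₁`, and therefore `λ₁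
∫ g|v|^p ≤ E(v)` for every admissible `v` (`Setting.mul_energy_le_totalEnergy`). Testing the
equation with the eigenfunction `u` itself gives equality at `v = u`.

Constant sign. Passing from `u` to `|u|` keeps `∫ g|u|^p` and increases none of the three terms of
`E`, so by minimality the Gagliardo seminorms agree. Equality in `||a| - |b|| ≤ |a - b|` means `ab ≥
0`, so `u(x)u(y) ≥ 0` for almost every pair (`Setting.ae_mul_nonneg`), and one of `{u < 0}`, `{u >
0}` is null.

Strict positivity (`Setting.test_measure_zero`). Let `u ≥ 0` be nonzero, and test the equation with
`φ b_n(u)`, where `φ ≥ 0` is a test function and `b_n` decreases on `[0, ∞)` to the indicator of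
`0`. The potential term tends to zero, and the gradient term is bounded above by a quantity tending
to zero because `∇u = 0` a.e. on `{u = 0}`. The nonlocal integrand tends to `-u(y)^{p-1} φ(x)` on
`{u = 0} × {u > 0}`, symmetrically on the transposed set, and to zero elsewhere. Since the weak
equation bounds the nonlocal term from below, this nonpositive limit vanishes a.e.; as `{u > 0}` is
not null, `{u = 0}` is null in `Ω`. Thus the nonlocal operator takes the place of a Harnack
inequality. -/

namespace MixedEigenvalue

/-! ### Powers of norms and `L^p` energies -/

section Energy

set_option linter.unusedSectionVars false

variable {α E : Type*} [MeasurableSpace α] [NormedAddCommGroup E] [InnerProductSpace ℝ E]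
  {p : ℝ} {μ : Measure α}

/-- The energy `∫ ‖a‖^p dμ`. -/
noncomputable def energy (p : ℝ) (μ : Measure α) (a : α → E) : ℝ := ∫ x, ‖a x‖ ^ p ∂μ

/-- The duality pairing `∫ ‖a‖^{p-2} ⟪a, b⟫ dμ`. -/
noncomputable def pairing (p : ℝ) (μ : Measure α) (a b : α → E) : ℝ :=
  ∫ x, ‖a x‖ ^ (p - 2) * inner ℝ (a x) (b x) ∂μ

theorem energy_nonneg (a : α → E) : 0 ≤ energy p μ a :=
  integral_nonneg fun _ => by positivity

theorem fact_one_le (hp : 1 < p) : Fact ((1 : ENNReal) ≤ ENNReal.ofReal p) :=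
  ⟨by rw [← ENNReal.ofReal_one]; exact ENNReal.ofReal_le_ofReal hp.le⟩

theorem norm_rpow_sub_two_mul_sq (hp : 1 < p) (a : E) : ‖a‖ ^ (p - 2) * ‖a‖ ^ 2 = ‖a‖ ^ p := by
  rcases eq_or_ne a 0 with rfl | h
  · simp [Real.zero_rpow (by linarith : p ≠ 0)]
  · have h' : 0 < ‖a‖ := norm_pos_iff.mpr h
    rw [← Real.rpow_natCast, ← Real.rpow_add h']
    norm_num

theorem pairing_self (hp : 1 < p) (a : α → E) : pairing p μ a a = energy p μ a := by
  unfold pairing energy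
  congr 1
  ext x
  rw [real_inner_self_eq_norm_sq, norm_rpow_sub_two_mul_sq hp]

/-- For `p < 2` the factor `‖a‖ ^ (p - 2)` is singular at `a = 0`. Its conventional value there is
immaterial because the inner product vanishes, and the product has growth `p - 1`. -/
theorem abs_pairing_integrand_le (hp : 1 < p) (a b : E) :
    |‖a‖ ^ (p - 2) * inner ℝ a b| ≤ ‖a‖ ^ (p - 1) * ‖b‖ := by
  rcases eq_or_ne a 0 with rfl | h
  · simp [Real.zero_rpow (by linarith : p - 1 ≠ 0)]
  · have h' : 0 < ‖a‖ := norm_pos_iff.mpr h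
    rw [abs_mul, abs_of_nonneg (by positivity)]
    calc ‖a‖ ^ (p - 2) * |inner ℝ a b| ≤ ‖a‖ ^ (p - 2) * (‖a‖ * ‖b‖) := by
          gcongr; exact abs_real_inner_le_norm a b
      _ = ‖a‖ ^ (p - 1) * ‖b‖ := by
          rw [← mul_assoc, ← Real.rpow_add_one h'.ne']; ring_nf

/-- A crude Young inequality: replace both factors by the larger of `s` and `t`. It suffices for
integrability and domination. -/
theorem rpow_sub_one_mul_le (hp : 1 < p) {s t : ℝ} (hs : 0 ≤ s) (ht : 0 ≤ t) :
    s ^ (p - 1) * t ≤ s ^ p + t ^ p := by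
  have key : ∀ r : ℝ, 0 ≤ r → r ^ (p - 1) * r = r ^ p := by
    intro r hr
    rcases hr.eq_or_lt with rfl | h
    · simp [Real.zero_rpow (by linarith : p ≠ 0)]
    · rw [← Real.rpow_add_one h.ne']; ring_nf
  rcases le_total s t with h | h
  · have : s ^ (p - 1) * t ≤ t ^ (p - 1) * t := by
      gcongr
    rw [key t ht] at this
    have := Real.rpow_nonneg hs p
    linarith
  · have : s ^ (p - 1) * t ≤ s ^ (p - 1) * s := by gcongr
    rw [key s hs] at this
    have := Real.rpow_nonneg ht p
    linarith

theorem add_rpow_le (hp : 1 < p) {s t : ℝ} (hs : 0 ≤ s) (ht : 0 ≤ t) :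
    (s + t) ^ p ≤ 2 ^ p * (s ^ p + t ^ p) := by
  have hs' := Real.rpow_nonneg hs p
  have ht' := Real.rpow_nonneg ht p
  have h2 : (0 : ℝ) ≤ 2 ^ p := by positivity
  rcases le_total s t with h | h
  · calc (s + t) ^ p ≤ (2 * t) ^ p := by gcongr; linarith
      _ = 2 ^ p * t ^ p := Real.mul_rpow (by norm_num) ht
      _ ≤ _ := by gcongr; linarith
  · calc (s + t) ^ p ≤ (2 * s) ^ p := by gcongr; linarith
      _ = 2 ^ p * s ^ p := Real.mul_rpow (by norm_num) hs
      _ ≤ _ := by gcongr; linarith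

theorem integrable_norm_rpow_ofReal (hp : 1 < p) {a : α → E}
    (ha : MemLp a (ENNReal.ofReal p) μ) : Integrable (fun x => ‖a x‖ ^ p) μ := by
  have := ha.integrable_norm_rpow (by simp; linarith) ENNReal.ofReal_ne_top
  rwa [ENNReal.toReal_ofReal (by linarith)] at this

theorem aestronglyMeasurable_pairing {a b : α → E} (ha : AEStronglyMeasurable a μ)
    (hb : AEStronglyMeasurable b μ) :
    AEStronglyMeasurable (fun x => ‖a x‖ ^ (p - 2) * inner ℝ (a x) (b x)) μ :=
  (ha.norm.aemeasurable.pow_const _).aestronglyMeasurable.mul (ha.inner hb)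

theorem integrable_pairing (hp : 1 < p) {a b : α → E} (ha : MemLp a (ENNReal.ofReal p) μ)
    (hb : MemLp b (ENNReal.ofReal p) μ) :
    Integrable (fun x => ‖a x‖ ^ (p - 2) * inner ℝ (a x) (b x)) μ := by
  refine ((integrable_norm_rpow_ofReal hp ha).add (integrable_norm_rpow_ofReal hp hb)).mono'
    (aestronglyMeasurable_pairing ha.1 hb.1) (Eventually.of_forall fun x => ?_)
  exact (abs_pairing_integrand_le hp _ _).trans
    (rpow_sub_one_mul_le hp (norm_nonneg _) (norm_nonneg _))

theorem energy_add_le (hp : 1 < p) {a b : α → E} (ha : MemLp a (ENNReal.ofReal p) μ)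
    (hb : MemLp b (ENNReal.ofReal p) μ) :
    energy p μ (fun x => a x + b x) ≤ 2 ^ p * (energy p μ a + energy p μ b) := by
  unfold energy
  rw [← integral_add (integrable_norm_rpow_ofReal hp ha) (integrable_norm_rpow_ofReal hp hb),
    ← integral_const_mul]
  refine integral_mono (integrable_norm_rpow_ofReal hp (ha.add hb))
    (((integrable_norm_rpow_ofReal hp ha).add (integrable_norm_rpow_ofReal hp hb)).const_mul _) ?_
  intro x
  exact (Real.rpow_le_rpow (norm_nonneg _) (norm_add_le _ _) (by linarith)).trans
    (add_rpow_le hp (norm_nonneg _) (norm_nonneg _))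

theorem energy_neg (a : α → E) : energy p μ (fun x => - a x) = energy p μ a := by
  simp [energy]

theorem energy_smul (c : ℝ) (a : α → E) :
    energy p μ (fun x => c • a x) = |c| ^ p * energy p μ a := by
  simp only [energy, norm_smul, Real.norm_eq_abs]
  rw [← integral_const_mul]
  congr 1
  ext x
  rw [Real.mul_rpow (abs_nonneg _) (norm_nonneg _)]

theorem energy_sub_le (hp : 1 < p) {a b : α → E} (ha : MemLp a (ENNReal.ofReal p) μ)
    (hb : MemLp b (ENNReal.ofReal p) μ) :
    energy p μ (fun x => a x - b x) ≤ 2 ^ p * (energy p μ a + energy p μ b) := by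
  have := energy_add_le hp ha hb.neg
  simp only [Pi.neg_apply, ← sub_eq_add_neg] at this
  rwa [show energy p μ (-b) = energy p μ b from energy_neg b] at this

theorem energy_congr {a b : α → E} (h : a =ᵐ[μ] b) : energy p μ a = energy p μ b :=
  integral_congr_ae (h.mono fun x hx => by simp only [hx])

theorem energy_eq_zero_iff (hp : 1 < p) {a : α → E} (ha : MemLp a (ENNReal.ofReal p) μ) :
    energy p μ a = 0 ↔ a =ᵐ[μ] 0 := by
  unfold energy
  rw [integral_eq_zero_iff_of_nonneg (fun _ => by positivity) (integrable_norm_rpow_ofReal hp ha)]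
  refine eventually_congr (Eventually.of_forall fun x => ?_)
  simp only [Pi.zero_apply]
  rw [Real.rpow_eq_zero (norm_nonneg _) (by linarith), norm_eq_zero]

theorem eLpNorm_eq_energy (hp : 1 < p) {a : α → E} (ha : MemLp a (ENNReal.ofReal p) μ) :
    eLpNorm a (ENNReal.ofReal p) μ = ENNReal.ofReal (energy p μ a ^ p⁻¹) := by
  rw [ha.eLpNorm_eq_integral_rpow_norm (by simp; linarith) ENNReal.ofReal_ne_top,
    ENNReal.toReal_ofReal (by linarith)]
  rfl

theorem ofReal_energy (hp : 1 < p) {a : α → E} (ha : MemLp a (ENNReal.ofReal p) μ) :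
    ENNReal.ofReal (energy p μ a) = ∫⁻ x, ‖a x‖ₑ ^ p ∂μ := by
  unfold energy
  rw [ofReal_integral_eq_lintegral_ofReal (integrable_norm_rpow_ofReal hp ha)
    (Eventually.of_forall fun _ => by positivity)]
  congr 1
  ext x
  rw [← ENNReal.ofReal_rpow_of_nonneg (norm_nonneg _) (by linarith), ofReal_norm]

theorem memLp_of_lintegral_lt_top (hp : 1 < p) {a : α → E} (hm : AEStronglyMeasurable a μ)
    (ha : ∫⁻ x, ‖a x‖ₑ ^ p ∂μ < ⊤) : MemLp a (ENNReal.ofReal p) μ := by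
  refine ⟨hm, ?_⟩
  rw [eLpNorm_lt_top_iff_lintegral_rpow_enorm_lt_top (by simp; linarith) ENNReal.ofReal_ne_top,
    ENNReal.toReal_ofReal (by linarith)]
  exact ha

/-! ### Convergence in energy as convergence in `L^p` -/

theorem norm_toLp_rpow (hp : 1 < p) {a : α → E} (ha : MemLp a (ENNReal.ofReal p) μ) :
    ‖ha.toLp a‖ ^ p = energy p μ a := by
  rw [Lp.norm_toLp, eLpNorm_eq_energy hp ha, ENNReal.toReal_ofReal (by
    have := energy_nonneg (p := p) (μ := μ) a; positivity)]
  exact Real.rpow_inv_rpow (energy_nonneg a) (by linarith)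

theorem energy_eq_dist (hp : 1 < p) {a b : α → E} (ha : MemLp a (ENNReal.ofReal p) μ)
    (hb : MemLp b (ENNReal.ofReal p) μ) :
    haveI := fact_one_le hp
    dist (ha.toLp a) (hb.toLp b) = energy p μ (fun x => a x - b x) ^ p⁻¹ := by
  have := fact_one_le hp
  have := norm_toLp_rpow hp (ha.sub hb)
  rw [MemLp.toLp_sub] at this
  rw [dist_eq_norm, show (fun x => a x - b x) = a - b from rfl, ← this,
    Real.rpow_rpow_inv (norm_nonneg _) (by linarith)]

theorem tendsto_rpow_inv_iff {ι : Type*} {l : Filter ι} (hp : 1 < p) {f : ι → ℝ}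
    (hf : ∀ i, 0 ≤ f i) :
    Tendsto (fun i => f i ^ p⁻¹) l (𝓝 0) ↔ Tendsto f l (𝓝 0) := by
  have hp0 : 0 < p := by linarith
  constructor
  · intro h
    have := h.rpow_const (p := p) (Or.inr hp0.le)
    rw [Real.zero_rpow hp0.ne'] at this
    refine this.congr fun i => Real.rpow_inv_rpow (hf i) hp0.ne'
  · intro h
    have := h.rpow_const (p := p⁻¹) (Or.inr (by positivity))
    rwa [Real.zero_rpow (by positivity)] at this

theorem tendsto_eLpNorm_iff_energy {ι : Type*} {l : Filter ι} (hp : 1 < p) {a : ι → α → E}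
    (ha : ∀ i, MemLp (a i) (ENNReal.ofReal p) μ) :
    Tendsto (fun i => eLpNorm (a i) (ENNReal.ofReal p) μ) l (𝓝 0) ↔
      Tendsto (fun i => energy p μ (a i)) l (𝓝 0) := by
  rw [← tendsto_rpow_inv_iff hp (fun i => energy_nonneg (a i))]
  simp_rw [fun i => eLpNorm_eq_energy hp (ha i)]
  constructor
  · intro h
    have := (ENNReal.tendsto_toReal ENNReal.zero_ne_top).comp h
    refine this.congr fun i => ?_
    exact ENNReal.toReal_ofReal (Real.rpow_nonneg (energy_nonneg _) _)
  · intro h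
    simpa using ENNReal.tendsto_ofReal h

theorem tendsto_energy {ι : Type*} {l : Filter ι} (hp : 1 < p) {a : ι → α → E} {b : α → E}
    (ha : ∀ i, MemLp (a i) (ENNReal.ofReal p) μ) (hb : MemLp b (ENNReal.ofReal p) μ)
    (h : Tendsto (fun i => energy p μ (fun x => a i x - b x)) l (𝓝 0)) :
    Tendsto (fun i => energy p μ (a i)) l (𝓝 (energy p μ b)) := by
  have := fact_one_le hp
  have h1 : Tendsto (fun i => (ha i).toLp (a i)) l (𝓝 (hb.toLp b)) := by
    rw [tendsto_iff_dist_tendsto_zero]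
    simp_rw [fun i => energy_eq_dist hp (ha i) hb]
    rwa [tendsto_rpow_inv_iff hp (fun i => energy_nonneg _)]
  have h2 := h1.norm.rpow_const (p := p) (Or.inr (by linarith))
  rw [norm_toLp_rpow hp] at h2
  exact h2.congr fun i => norm_toLp_rpow hp (ha i)

theorem exists_limit_of_energy_cauchy [CompleteSpace E] (hp : 1 < p) {a : ℕ → α → E}
    (ha : ∀ i, MemLp (a i) (ENNReal.ofReal p) μ)
    (h : Tendsto (fun n : ℕ × ℕ => energy p μ (fun x => a n.1 x - a n.2 x)) atTop (𝓝 0)) :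
    ∃ b, MemLp b (ENNReal.ofReal p) μ ∧
      Tendsto (fun i => energy p μ (fun x => a i x - b x)) atTop (𝓝 0) := by
  have := fact_one_le hp
  have h1 : CauchySeq (fun i => (ha i).toLp (a i)) := by
    rw [cauchySeq_iff_tendsto_dist_atTop_0]
    simp_rw [fun i j => energy_eq_dist hp (ha i) (ha j)]
    rwa [tendsto_rpow_inv_iff hp (fun i => energy_nonneg _)]
  obtain ⟨b, hb⟩ := cauchySeq_tendsto_of_complete h1
  refine ⟨b, Lp.memLp b, ?_⟩
  rw [← tendsto_rpow_inv_iff hp (fun i => energy_nonneg _)]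
  rw [tendsto_iff_dist_tendsto_zero] at hb
  refine hb.congr fun i => ?_
  rw [← energy_eq_dist hp (ha i) (Lp.memLp b), Lp.toLp_coeFn]

/-- Differentiation under the integral sign. For `|t| < 1` the derivative of the integrand is
dominated by a multiple of `(‖a‖ + ‖b‖) ^ p + ‖b‖ ^ p`, independently of `t`. -/
theorem hasDerivAt_energy (hp : 1 < p) {a b : α → E} (ha : MemLp a (ENNReal.ofReal p) μ)
    (hb : MemLp b (ENNReal.ofReal p) μ) :
    HasDerivAt (fun t : ℝ => energy p μ (fun x => a x + t • b x)) (p * pairing p μ a b) 0 := by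
  have hd : ∀ x, ∀ t : ℝ, HasDerivAt (fun t : ℝ => ‖a x + t • b x‖ ^ p)
      (p * (‖a x + t • b x‖ ^ (p - 2) * inner ℝ (a x + t • b x) (b x))) t := by
    intro x t
    have h1 : HasDerivAt (fun t : ℝ => a x + t • b x) (b x) t := by
      simpa using ((hasDerivAt_id t).smul_const (b x)).const_add (a x)
    have h2 := (hasFDerivAt_norm_rpow (a x + t • b x) hp).comp_hasDerivAt t h1
    refine h2.congr_deriv ?_
    rw [FunLike.coe_smul, Pi.smul_apply, innerSL_apply_apply, smul_eq_mul, mul_assoc]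
  have hmem : ∀ t : ℝ, MemLp (fun x => a x + t • b x) (ENNReal.ofReal p) μ :=
    fun t => ha.add (hb.const_smul t)
  have hbound : Integrable (fun x => p * ((‖a x‖ + ‖b x‖) ^ p + ‖b x‖ ^ p)) μ := by
    refine Integrable.const_mul (Integrable.add ?_ (integrable_norm_rpow_ofReal hp hb)) _
    have := integrable_norm_rpow_ofReal hp (ha.norm.add hb.norm)
    refine this.congr (Eventually.of_forall fun x => ?_)
    simp only [Pi.add_apply, Real.norm_eq_abs]
    rw [abs_of_nonneg (by positivity)]
  have key := hasDerivAt_integral_of_dominated_loc_of_deriv_le (μ := μ)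
    (F := fun (t : ℝ) x => ‖a x + t • b x‖ ^ p)
    (F' := fun (t : ℝ) x => p * (‖a x + t • b x‖ ^ (p - 2) * inner ℝ (a x + t • b x) (b x)))
    (x₀ := (0 : ℝ)) (s := Metric.ball 0 1) (bound := fun x => p * ((‖a x‖ + ‖b x‖) ^ p + ‖b x‖ ^ p))
    (Metric.ball_mem_nhds _ one_pos)
    (Eventually.of_forall fun t => (integrable_norm_rpow_ofReal hp (hmem t)).1)
    (by simpa using integrable_norm_rpow_ofReal hp ha)
    (by
      simpa using (aestronglyMeasurable_pairing (p := p) ha.1 hb.1).const_mul p)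
    (Eventually.of_forall fun x t ht => ?_) hbound
    (Eventually.of_forall fun x t _ => hd x t)
  · refine key.2.congr_deriv ?_
    simp only [zero_smul, add_zero, pairing, integral_const_mul]
  · rw [norm_mul, Real.norm_eq_abs, Real.norm_eq_abs, abs_of_pos (by linarith : 0 < p)]
    gcongr
    refine (abs_pairing_integrand_le hp _ _).trans
      ((rpow_sub_one_mul_le hp (norm_nonneg _) (norm_nonneg _)).trans ?_)
    gcongr
    refine (norm_add_le _ _).trans ?_
    gcongr
    rw [norm_smul]
    have : ‖t‖ < 1 := by simpa using ht
    nlinarith [norm_nonneg (b x)]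

/-! ### Uniform convexity of the energy -/

theorem norm_midpoint_rpow_le (hp : 1 < p) (a b : E) :
    ‖(1 / 2 : ℝ) • (a + b)‖ ^ p ≤ (‖a‖ ^ p + ‖b‖ ^ p) / 2 := by
  have h := (convexOn_rpow hp.le).2 (norm_nonneg a) (norm_nonneg b)
    (by norm_num : (0 : ℝ) ≤ 1 / 2) (by norm_num : (0 : ℝ) ≤ 1 / 2) (by norm_num)
  simp only [smul_eq_mul] at h
  calc ‖(1 / 2 : ℝ) • (a + b)‖ ^ p ≤ (1 / 2 * ‖a‖ + 1 / 2 * ‖b‖) ^ p := by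
        gcongr
        rw [norm_smul]
        have := norm_add_le a b
        norm_num
        linarith
    _ ≤ _ := h
    _ = _ := by ring

/-- Strict convexity of `r ↦ r ^ p` first forces `‖a‖ = ‖b‖`; then `‖a + b‖ = 2‖b‖`, and the
parallelogram law leaves no room for `a - b`. -/
theorem eq_of_norm_midpoint_rpow_eq (hp : 1 < p) {a b : E}
    (h : ‖(1 / 2 : ℝ) • (a + b)‖ ^ p = (‖a‖ ^ p + ‖b‖ ^ p) / 2) : a = b := by
  have hab : ‖a‖ = ‖b‖ := by
    by_contra hne
    have h1 := (strictConvexOn_rpow hp).2 (norm_nonneg a) (norm_nonneg b) hne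
      (by norm_num : (0 : ℝ) < 1 / 2) (by norm_num : (0 : ℝ) < 1 / 2) (by norm_num)
    simp only [smul_eq_mul] at h1
    have h2 : ‖(1 / 2 : ℝ) • (a + b)‖ ^ p ≤ (1 / 2 * ‖a‖ + 1 / 2 * ‖b‖) ^ p := by
      gcongr
      rw [norm_smul]
      have := norm_add_le a b
      norm_num
      linarith
    linarith
  rw [hab] at h
  have h3 : ‖(1 / 2 : ℝ) • (a + b)‖ = ‖b‖ := by
    have : ‖(1 / 2 : ℝ) • (a + b)‖ ^ p = ‖b‖ ^ p := by linarith
    exact (Real.rpow_left_inj (norm_nonneg _) (norm_nonneg _) (by linarith)).mp this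
  have h4 : ‖a + b‖ = 2 * ‖b‖ := by
    rw [norm_smul] at h3
    norm_num at h3
    linarith
  have h5 := parallelogram_law_with_norm ℝ a b
  rw [h4, hab] at h5
  have h6 : ‖a - b‖ = 0 := by nlinarith [norm_nonneg (a - b)]
  exact sub_eq_zero.mp (norm_eq_zero.mp h6)

/-- A quantitative form of the strict convexity of `‖·‖^p`. -/
theorem exists_norm_sub_rpow_le [FiniteDimensional ℝ E] (hp : 1 < p) {ε : ℝ} (hε : 0 < ε) :
    ∃ C : ℝ, 0 ≤ C ∧ ∀ a b : E, ‖a - b‖ ^ p ≤ ε * (‖a‖ ^ p + ‖b‖ ^ p) +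
      C * ((‖a‖ ^ p + ‖b‖ ^ p) / 2 - ‖(1 / 2 : ℝ) • (a + b)‖ ^ p) := by
  have hp0 : 0 < p := by linarith
  -- `D` is the convexity defect. Both sides of the claim are homogeneous of degree `p`, so pairs
  -- with `‖a‖ ^ p + ‖b‖ ^ p = 1` suffice. Those with `‖a - b‖ ^ p ≥ ε` form a compact set `K`, on
  -- which the defect has a positive lower bound `δ`.
  let D : E × E → ℝ := fun z => (‖z.1‖ ^ p + ‖z.2‖ ^ p) / 2 - ‖(1 / 2 : ℝ) • (z.1 + z.2)‖ ^ p
  have hc : ∀ f : E × E → E, Continuous f → Continuous fun z => ‖f z‖ ^ p := fun f hf =>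
    hf.norm.rpow_const fun _ => Or.inr hp0.le
  have hDc : Continuous D :=
    (((hc _ continuous_fst).add (hc _ continuous_snd)).div_const 2).sub
      (hc _ (by fun_prop))
  let K : Set (E × E) := {z | ‖z.1‖ ^ p + ‖z.2‖ ^ p = 1 ∧ ε ≤ ‖z.1 - z.2‖ ^ p}
  have hKc : IsCompact K := by
    refine Metric.isCompact_of_isClosed_isBounded ?_ ?_
    · exact (isClosed_eq ((hc _ continuous_fst).add (hc _ continuous_snd)) continuous_const).inter
        (isClosed_le continuous_const (hc _ (continuous_fst.sub continuous_snd)))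
    · refine (Metric.isBounded_closedBall (x := (0 : E × E)) (r := 1)).subset ?_
      rintro ⟨a, b⟩ ⟨h, -⟩
      simp only at h
      have aux : ∀ r : ℝ, 0 ≤ r → r ^ p ≤ 1 → r ≤ 1 := by
        intro r hr h1
        by_contra! h2
        have := Real.one_lt_rpow h2 hp0
        linarith
      have ha := Real.rpow_nonneg (norm_nonneg a) p
      have hb := Real.rpow_nonneg (norm_nonneg b) p
      simp only [mem_closedBall_zero_iff, Prod.norm_def, sup_le_iff]
      exact ⟨aux _ (norm_nonneg _) (by linarith), aux _ (norm_nonneg _) (by linarith)⟩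
  obtain ⟨δ, hδ, hδK⟩ : ∃ δ : ℝ, 0 < δ ∧ ∀ z ∈ K, δ ≤ D z := by
    rcases K.eq_empty_or_nonempty with h | h
    · exact ⟨1, one_pos, by simp [h]⟩
    · obtain ⟨z, hz, hmin⟩ := hKc.exists_isMinOn h hDc.continuousOn
      refine ⟨D z, ?_, fun w hw => hmin hw⟩
      refine lt_of_le_of_ne (sub_nonneg.mpr (norm_midpoint_rpow_le hp z.1 z.2)) fun h0 => ?_
      have : z.1 = z.2 := eq_of_norm_midpoint_rpow_eq hp (by simp only [D] at h0; linarith)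
      have h2 := hz.2
      rw [this, sub_self, norm_zero, Real.zero_rpow hp0.ne'] at h2
      linarith
  have hle : ∀ a b : E, ‖a - b‖ ^ p ≤ 2 ^ p * (‖a‖ ^ p + ‖b‖ ^ p) := fun a b =>
    (Real.rpow_le_rpow (norm_nonneg _) (norm_sub_le _ _) hp0.le).trans
      (add_rpow_le hp (norm_nonneg _) (norm_nonneg _))
  -- Off `K` the term `ε` alone is enough. On `K` the trivial bound `2 ^ p` is absorbed by `2 ^ p *
  -- D / δ`, since `D ≥ δ` there.
  have hnorm : ∀ a b : E, ‖a‖ ^ p + ‖b‖ ^ p = 1 → ‖a - b‖ ^ p ≤ ε + 2 ^ p / δ * D (a, b) := by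
    intro a b h
    have hD0 : 0 ≤ D (a, b) := sub_nonneg.mpr (norm_midpoint_rpow_le hp a b)
    by_cases hk : ε ≤ ‖a - b‖ ^ p
    · have h1 := hδK (a, b) ⟨h, hk⟩
      have h2 := hle a b
      rw [h, mul_one] at h2
      have h3 : 1 ≤ D (a, b) / δ := by rwa [le_div_iff₀ hδ, one_mul]
      calc ‖a - b‖ ^ p ≤ 2 ^ p := h2
        _ ≤ 2 ^ p * (D (a, b) / δ) := by
            have : (0 : ℝ) < 2 ^ p := by positivity
            nlinarith
        _ ≤ ε + 2 ^ p / δ * D (a, b) := by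
            rw [div_mul_eq_mul_div, mul_div_assoc]; linarith
    · have : 0 ≤ 2 ^ p / δ * D (a, b) := by positivity
      linarith [not_le.mp hk]
  refine ⟨2 ^ p / δ, by positivity, fun a b => ?_⟩
  set r : ℝ := ‖a‖ ^ p + ‖b‖ ^ p with hr
  have ha := Real.rpow_nonneg (norm_nonneg a) p
  have hb := Real.rpow_nonneg (norm_nonneg b) p
  rcases (add_nonneg ha hb).eq_or_lt with h0 | h0
  · have ha0 : ‖a‖ ^ p = 0 := by linarith
    have hb0 : ‖b‖ ^ p = 0 := by linarith
    rw [Real.rpow_eq_zero (norm_nonneg _) hp0.ne', norm_eq_zero] at ha0 hb0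
    subst ha0 hb0
    simp [hr, Real.zero_rpow hp0.ne']
  · rw [← hr] at h0
    have hs0 : 0 < r ^ (-p⁻¹) := by positivity
    -- Scaling by `r ^ (-1/p)` normalizes the pair.
    set s : ℝ := r ^ (-p⁻¹) with hs
    have hsp : s ^ p = r⁻¹ := by
      rw [hs, ← Real.rpow_mul h0.le, neg_mul, inv_mul_cancel₀ hp0.ne', Real.rpow_neg_one]
    have hscale : ∀ c : E, ‖s • c‖ ^ p = r⁻¹ * ‖c‖ ^ p := by
      intro c
      rw [norm_smul, Real.mul_rpow (norm_nonneg _) (norm_nonneg _), Real.norm_of_nonneg hs0.le, hsp]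
    have h1 := hnorm (s • a) (s • b) (by
      rw [hscale, hscale, ← mul_add, ← hr, inv_mul_cancel₀ h0.ne'])
    have hD : D (s • a, s • b) = r⁻¹ * D (a, b) := by
      simp only [D]
      rw [← smul_add, smul_comm, hscale, hscale, hscale]
      ring
    rw [← smul_sub, hscale, hD] at h1
    have h2 := mul_le_mul_of_nonneg_left h1 h0.le
    rw [mul_inv_cancel_left₀ h0.ne'] at h2
    calc ‖a - b‖ ^ p ≤ r * (ε + 2 ^ p / δ * (r⁻¹ * D (a, b))) := h2
      _ = ε * r + 2 ^ p / δ * D (a, b) := by field_simp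

theorem energy_midpoint_le (hp : 1 < p) {a b : α → E} (ha : MemLp a (ENNReal.ofReal p) μ)
    (hb : MemLp b (ENNReal.ofReal p) μ) :
    energy p μ (fun x => (1 / 2 : ℝ) • (a x + b x)) ≤ (energy p μ a + energy p μ b) / 2 := by
  unfold energy
  rw [← integral_add (integrable_norm_rpow_ofReal hp ha) (integrable_norm_rpow_ofReal hp hb),
    ← integral_div]
  exact integral_mono (integrable_norm_rpow_ofReal hp ((ha.add hb).const_smul (1 / 2 : ℝ)))
    (((integrable_norm_rpow_ofReal hp ha).add (integrable_norm_rpow_ofReal hp hb)).div_const _)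
    fun x => norm_midpoint_rpow_le hp _ _

/-- Uniform convexity of the `p`-energy. -/
theorem exists_energy_sub_le [FiniteDimensional ℝ E] (hp : 1 < p) {ε : ℝ} (hε : 0 < ε) :
    ∃ C : ℝ, 0 ≤ C ∧ ∀ a b : α → E, MemLp a (ENNReal.ofReal p) μ → MemLp b (ENNReal.ofReal p) μ →
      energy p μ (fun x => a x - b x) ≤ ε * (energy p μ a + energy p μ b) +
        C * ((energy p μ a + energy p μ b) / 2 -
          energy p μ (fun x => (1 / 2 : ℝ) • (a x + b x))) := by
  obtain ⟨C, hC, h⟩ := exists_norm_sub_rpow_le (E := E) hp hε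
  refine ⟨C, hC, fun a b ha hb => ?_⟩
  have ia := integrable_norm_rpow_ofReal hp ha
  have ib := integrable_norm_rpow_ofReal hp hb
  have im : Integrable (fun x => ‖(1 / 2 : ℝ) • (a x + b x)‖ ^ p) μ :=
    integrable_norm_rpow_ofReal hp ((ha.add hb).const_smul (1 / 2 : ℝ))
  have ic : Integrable (fun x => (‖a x‖ ^ p + ‖b x‖ ^ p) / 2) μ := (ia.add ib).div_const 2
  have id : Integrable (fun x => (‖a x‖ ^ p + ‖b x‖ ^ p) / 2 -
      ‖(1 / 2 : ℝ) • (a x + b x)‖ ^ p) μ := ic.sub im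
  have ie : Integrable (fun x => ε * (‖a x‖ ^ p + ‖b x‖ ^ p)) μ := (ia.add ib).const_mul ε
  unfold energy
  rw [← integral_add ia ib, ← integral_const_mul, ← integral_div,
    ← integral_sub ic im, ← integral_const_mul,
    ← integral_add ie (id.const_mul C)]
  exact integral_mono (integrable_norm_rpow_ofReal hp (ha.sub hb))
    (ie.add (id.const_mul C))
    fun x => h (a x) (b x)

end Energy

/-! ### Test functions -/

section Sobolev

variable {N : ℕ} {p : ℝ} {Ω : Set (Rn N)}

/-- `φ ∈ C_c^∞(Ω)`. -/
structure IsTest (Ω : Set (Rn N)) (φ : Rn N → ℝ) : Prop where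
  contDiff : ContDiff ℝ ∞ φ
  compact : HasCompactSupport φ
  subset : tsupport φ ⊆ Ω

theorem IsTest.differentiable {φ : Rn N → ℝ} (h : IsTest Ω φ) : Differentiable ℝ φ :=
  h.contDiff.differentiable (by simp)

theorem IsTest.continuous_gradient {φ : Rn N → ℝ} (h : IsTest Ω φ) : Continuous (gradient φ) :=
  (InnerProductSpace.toDual ℝ (Rn N)).symm.continuous.comp (h.contDiff.continuous_fderiv (by simp))

theorem gradient_eq_zero_of_notMem_tsupport {φ : Rn N → ℝ} {x : Rn N} (hx : x ∉ tsupport φ) :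
    gradient φ x = 0 := by
  have : fderiv ℝ φ x = 0 := by
    by_contra h
    exact hx (support_fderiv_subset ℝ h)
  rw [gradient, this, map_zero]

theorem norm_gradient (φ : Rn N → ℝ) (x : Rn N) : ‖gradient φ x‖ = ‖fderiv ℝ φ x‖ := by
  rw [gradient, LinearIsometryEquiv.norm_map]

theorem inner_gradient (φ : Rn N → ℝ) (x v : Rn N) :
    inner ℝ (gradient φ x) v = fderiv ℝ φ x v := by
  rw [gradient, InnerProductSpace.toDual_symm_apply]

theorem IsTest.hasCompactSupport_gradient {φ : Rn N → ℝ} (h : IsTest Ω φ) :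
    HasCompactSupport (gradient φ) :=
  HasCompactSupport.intro h.compact fun _ hx => gradient_eq_zero_of_notMem_tsupport hx

theorem IsTest.memLp {φ : Rn N → ℝ} (h : IsTest Ω φ) (r : ENNReal) : MemLp φ r volume :=
  h.contDiff.continuous.memLp_of_hasCompactSupport h.compact

theorem IsTest.memLp_gradient {φ : Rn N → ℝ} (h : IsTest Ω φ) (r : ENNReal) :
    MemLp (gradient φ) r volume :=
  h.continuous_gradient.memLp_of_hasCompactSupport h.hasCompactSupport_gradient

theorem IsTest.add {φ ψ : Rn N → ℝ} (h : IsTest Ω φ) (h' : IsTest Ω ψ) :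
    IsTest Ω (fun x => φ x + ψ x) :=
  ⟨h.1.add h'.1, h.2.add h'.2, (tsupport_add φ ψ).trans (Set.union_subset h.3 h'.3)⟩

theorem IsTest.const_mul {φ : Rn N → ℝ} (h : IsTest Ω φ) (c : ℝ) :
    IsTest Ω (fun x => c * φ x) :=
  ⟨contDiff_const.mul h.1, h.2.mul_left, (tsupport_mul_subset_right (f := fun _ => c)).trans h.3⟩

theorem IsTest.mul {φ ψ : Rn N → ℝ} (h : IsTest Ω φ) (h' : IsTest Ω ψ) :
    IsTest Ω (fun x => φ x * ψ x) :=
  ⟨h.1.mul h'.1, h.2.mul_right, tsupport_mul_subset_left.trans h.3⟩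

theorem IsTest.comp {φ : Rn N → ℝ} (h : IsTest Ω φ) {F : ℝ → ℝ} (hF : ContDiff ℝ ∞ F)
    (h0 : F 0 = 0) : IsTest Ω (fun x => F (φ x)) := by
  refine ⟨hF.comp h.1, h.2.comp_left h0, (closure_mono ?_).trans h.3⟩
  intro x hx h2
  exact hx (by simp [h2, h0])

theorem gradient_add_fun {φ ψ : Rn N → ℝ} (h : IsTest Ω φ) (h' : IsTest Ω ψ) (x : Rn N) :
    gradient (fun x => φ x + ψ x) x = gradient φ x + gradient ψ x := by
  simp only [gradient]
  rw [fderiv_fun_add (h.differentiable x) (h'.differentiable x), map_add]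

theorem gradient_const_mul {φ : Rn N → ℝ} (h : IsTest Ω φ) (c : ℝ) (x : Rn N) :
    gradient (fun x => c * φ x) x = c • gradient φ x := by
  simp only [gradient]
  rw [fderiv_const_mul (h.differentiable x), map_smul]

theorem gradient_mul {φ ψ : Rn N → ℝ} (h : IsTest Ω φ) (h' : IsTest Ω ψ) (x : Rn N) :
    gradient (fun x => φ x * ψ x) x = φ x • gradient ψ x + ψ x • gradient φ x := by
  simp only [gradient]
  rw [fderiv_fun_mul (h.differentiable x) (h'.differentiable x), map_add, map_smul, map_smul]

theorem gradient_comp {φ : Rn N → ℝ} (h : IsTest Ω φ) {F : ℝ → ℝ} (hF : ContDiff ℝ ∞ F)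
    (x : Rn N) : gradient (fun x => F (φ x)) x = deriv F (φ x) • gradient φ x := by
  simp only [gradient]
  have h1 : HasDerivAt F (deriv F (φ x)) (φ x) :=
    ((hF.differentiable (by simp)) (φ x)).hasDerivAt
  have h2 := h1.comp_hasFDerivAt x (h.differentiable x).hasFDerivAt
  rw [show (fun x => F (φ x)) = F ∘ φ from rfl, h2.fderiv, map_smul]

theorem IsTest.integral_smul_gradient {φ ψ : Rn N → ℝ} (h : IsTest Ω φ) (h' : IsTest Set.univ ψ) :
    ∫ x, φ x • gradient ψ x = - ∫ x, ψ x • gradient φ x := by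
  have i1 : Integrable (fun x => φ x • gradient ψ x) :=
    (h.contDiff.continuous.smul h'.continuous_gradient).integrable_of_hasCompactSupport
      h.compact.smul_right
  have i2 : Integrable (fun x => ψ x • gradient φ x) :=
    (h'.contDiff.continuous.smul h.continuous_gradient).integrable_of_hasCompactSupport
      h'.compact.smul_right
  refine ext_inner_left ℝ fun v => ?_
  rw [inner_neg_right, ← integral_inner i1, ← integral_inner i2]
  have e1 : ∀ x, inner ℝ v (φ x • gradient ψ x) = φ x * fderiv ℝ ψ x v := fun x => by
    rw [inner_smul_right, real_inner_comm, inner_gradient]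
  have e2 : ∀ x, inner ℝ v (ψ x • gradient φ x) = fderiv ℝ φ x v * ψ x := fun x => by
    rw [inner_smul_right, real_inner_comm, inner_gradient, mul_comm]
  have j1 := i1.const_inner (𝕜 := ℝ) v
  have j2 := i2.const_inner (𝕜 := ℝ) v
  simp only [e1, e2] at j1 j2 ⊢
  refine integral_mul_fderiv_eq_neg_fderiv_mul_of_integrable j2 j1 ?_
    (fun x _ => h.differentiable x) (fun x _ => h'.differentiable x)
  exact (h.contDiff.continuous.mul h'.contDiff.continuous).integrable_of_hasCompactSupport
    h.compact.mul_right

/-! ### The closure of the test functions in `W^{1,p}` -/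

/-- `u` belongs to the closure of `C_c^∞(Ω)` in `W^{1,p}(ℝ^N)`, with gradient `G`. -/
structure HasGradZero (p : ℝ) (Ω : Set (Rn N)) (u : Rn N → ℝ) (G : Rn N → Rn N) : Prop where
  memLp : MemLp u (ENNReal.ofReal p) volume
  memLp_grad : MemLp G (ENNReal.ofReal p) volume
  approx : ∃ φ : ℕ → Rn N → ℝ, (∀ n, IsTest Ω (φ n)) ∧
    Tendsto (fun n => energy p volume (fun x => φ n x - u x)) atTop (𝓝 0) ∧
    Tendsto (fun n => energy p volume (fun x => gradient (φ n) x - G x)) atTop (𝓝 0)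

theorem IsTest.hasGradZero (hp : 1 < p) {φ : Rn N → ℝ} (h : IsTest Ω φ) :
    HasGradZero p Ω φ (gradient φ) :=
  ⟨h.memLp _, h.memLp_gradient _, fun _ => φ, fun _ => h, by
    simp [energy, Real.zero_rpow (by linarith : p ≠ 0)], by
    simp [energy, Real.zero_rpow (by linarith : p ≠ 0)]⟩

theorem tendsto_energy_add {α E : Type*} [MeasurableSpace α] [NormedAddCommGroup E]
    [InnerProductSpace ℝ E] {μ : Measure α} {ι : Type*} {l : Filter ι} (hp : 1 < p)
    {a b : ι → α → E} (ha : ∀ i, MemLp (a i) (ENNReal.ofReal p) μ)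
    (hb : ∀ i, MemLp (b i) (ENNReal.ofReal p) μ)
    (h : Tendsto (fun i => energy p μ (a i)) l (𝓝 0))
    (h' : Tendsto (fun i => energy p μ (b i)) l (𝓝 0)) :
    Tendsto (fun i => energy p μ (fun x => a i x + b i x)) l (𝓝 0) := by
  refine squeeze_zero (fun i => energy_nonneg _) (fun i => energy_add_le hp (ha i) (hb i)) ?_
  simpa using (h.add h').const_mul (2 ^ p)

theorem energy_mono {α E E' : Type*} [MeasurableSpace α] [NormedAddCommGroup E]
    [InnerProductSpace ℝ E] [NormedAddCommGroup E'] [InnerProductSpace ℝ E']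
    {μ : Measure α} (hp : 1 < p) {a : α → E} {b : α → E'} (ha : AEStronglyMeasurable a μ)
    (hb : MemLp b (ENNReal.ofReal p) μ) (h : ∀ᵐ x ∂μ, ‖a x‖ ≤ ‖b x‖) :
    energy p μ a ≤ energy p μ b :=
  integral_mono_ae (integrable_norm_rpow_ofReal hp (hb.mono ha h))
    (integrable_norm_rpow_ofReal hp hb)
    (h.mono fun x hx => Real.rpow_le_rpow (norm_nonneg _) hx (by linarith))

/-- A closure is closed: choose for each `n` a test function within `1 / (n + 1)` of the `n`-th
term. -/
theorem HasGradZero.of_tendsto (hp : 1 < p) {u : ℕ → Rn N → ℝ} {G : ℕ → Rn N → Rn N}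
    (h : ∀ n, HasGradZero p Ω (u n) (G n)) {v : Rn N → ℝ} {H : Rn N → Rn N}
    (hv : MemLp v (ENNReal.ofReal p) volume) (hH : MemLp H (ENNReal.ofReal p) volume)
    (h1 : Tendsto (fun n => energy p volume (fun x => u n x - v x)) atTop (𝓝 0))
    (h2 : Tendsto (fun n => energy p volume (fun x => G n x - H x)) atTop (𝓝 0)) :
    HasGradZero p Ω v H := by
  refine ⟨hv, hH, ?_⟩
  have hex : ∀ n : ℕ, ∃ φ, IsTest Ω φ ∧ energy p volume (fun x => φ x - u n x) ≤ 1 / (n + 1) ∧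
      energy p volume (fun x => gradient φ x - G n x) ≤ 1 / (n + 1) := by
    intro n
    obtain ⟨φ, hφ, a1, a2⟩ := (h n).approx
    have hpos : (0 : ℝ) < 1 / (n + 1) := by positivity
    obtain ⟨k, hk1, hk2⟩ := ((a1.eventually (ge_mem_nhds hpos)).and
      (a2.eventually (ge_mem_nhds hpos))).exists
    exact ⟨φ k, hφ k, hk1, hk2⟩
  choose φ hφ b1 b2 using hex
  have ht : Tendsto (fun n : ℕ => (1 : ℝ) / (n + 1)) atTop (𝓝 0) :=
    tendsto_one_div_add_atTop_nhds_zero_nat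
  refine ⟨φ, hφ, ?_, ?_⟩
  · have := tendsto_energy_add hp (fun n => ((hφ n).memLp _).sub (h n).memLp)
      (fun n => (h n).memLp.sub hv) (squeeze_zero (fun n => energy_nonneg _) b1 ht) h1
    simpa using this
  · have := tendsto_energy_add hp (fun n => ((hφ n).memLp_gradient _).sub (h n).memLp_grad)
      (fun n => (h n).memLp_grad.sub hH) (squeeze_zero (fun n => energy_nonneg _) b2 ht) h2
    simpa using this

theorem HasGradZero.add (hp : 1 < p) {u v : Rn N → ℝ} {G H : Rn N → Rn N}
    (h : HasGradZero p Ω u G) (h' : HasGradZero p Ω v H) :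
    HasGradZero p Ω (fun x => u x + v x) (fun x => G x + H x) := by
  obtain ⟨φ, hφ, a1, a2⟩ := h.approx
  obtain ⟨ψ, hψ, b1, b2⟩ := h'.approx
  refine ⟨h.memLp.add h'.memLp, h.memLp_grad.add h'.memLp_grad,
    fun n x => φ n x + ψ n x, fun n => (hφ n).add (hψ n), ?_, ?_⟩
  · have := tendsto_energy_add hp (fun n => ((hφ n).memLp _).sub h.memLp)
      (fun n => ((hψ n).memLp _).sub h'.memLp) a1 b1
    refine this.congr fun n => ?_
    congr 1; ext x; simp only [Pi.sub_apply]; ring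
  · have := tendsto_energy_add hp (fun n => ((hφ n).memLp_gradient _).sub h.memLp_grad)
      (fun n => ((hψ n).memLp_gradient _).sub h'.memLp_grad) a2 b2
    refine this.congr fun n => ?_
    congr 1; funext x
    rw [gradient_add_fun (hφ n) (hψ n)]; simp only [Pi.sub_apply]; abel

theorem HasGradZero.smul {u : Rn N → ℝ} {G : Rn N → Rn N}
    (h : HasGradZero p Ω u G) (c : ℝ) :
    HasGradZero p Ω (fun x => c • u x) (fun x => c • G x) := by
  obtain ⟨φ, hφ, a1, a2⟩ := h.approx
  refine ⟨h.memLp.const_smul c, h.memLp_grad.const_smul c,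
    fun n x => c * φ n x, fun n => (hφ n).const_mul c, ?_, ?_⟩
  · have := a1.const_mul (|c| ^ p)
    rw [mul_zero] at this
    refine this.congr fun n => ?_
    rw [← energy_smul]
    congr 1; ext x; simp only [smul_eq_mul]; ring
  · have := a2.const_mul (|c| ^ p)
    rw [mul_zero] at this
    refine this.congr fun n => ?_
    rw [← energy_smul]
    congr 1; funext x
    rw [gradient_const_mul (hφ n), smul_sub]

theorem HasGradZero.sub (hp : 1 < p) {u v : Rn N → ℝ} {G H : Rn N → Rn N}
    (h : HasGradZero p Ω u G) (h' : HasGradZero p Ω v H) :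
    HasGradZero p Ω (fun x => u x - v x) (fun x => G x - H x) := by
  have := h.add hp (h'.smul (-1))
  simpa [← sub_eq_add_neg] using this

theorem HasGradZero.congr {u v : Rn N → ℝ} {G H : Rn N → Rn N}
    (h : HasGradZero p Ω u G) (h1 : u =ᵐ[volume] v) (h2 : G =ᵐ[volume] H) :
    HasGradZero p Ω v H := by
  obtain ⟨φ, hφ, a1, a2⟩ := h.approx
  refine ⟨h.memLp.ae_eq h1, h.memLp_grad.ae_eq h2, φ, hφ, a1.congr fun n => energy_congr ?_,
    a2.congr fun n => energy_congr ?_⟩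
  · filter_upwards [h1] with x hx; rw [hx]
  · filter_upwards [h2] with x hx; rw [hx]

/-! ### Weak gradients -/

theorem lintegral_enorm_mul_le {α E E' : Type*} [MeasurableSpace α] [NormedAddCommGroup E]
    [InnerProductSpace ℝ E] [NormedAddCommGroup E'] [InnerProductSpace ℝ E'] {μ : Measure α}
    (hp : 1 < p) {c : α → E} {b : α → E'}
    (hc : MemLp c (ENNReal.ofReal p) μ) (hb : MemLp b (ENNReal.ofReal p.conjExponent) μ) :
    ∫⁻ x, ‖c x‖ₑ * ‖b x‖ₑ ∂μ ≤ ENNReal.ofReal (energy p μ c) ^ (1 / p) *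
      ENNReal.ofReal (energy p.conjExponent μ b) ^ (1 / p.conjExponent) := by
  have hpq := Real.HolderConjugate.conjExponent hp
  rw [ofReal_energy hp hc, ofReal_energy hpq.symm.lt hb]
  exact ENNReal.lintegral_mul_le_Lp_mul_Lq μ hpq hc.1.enorm hb.1.enorm

/-- Hölder's inequality with the conjugate exponent. The bilinear map `B` covers both sides of the
integration by parts formula: scalar times vector, and its flip. -/
theorem tendsto_integral_smul_of_energy {α E : Type*} [MeasurableSpace α] [NormedAddCommGroup E]
    [InnerProductSpace ℝ E] [CompleteSpace E] {E₁ E₂ : Type*} [NormedAddCommGroup E₁]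
    [InnerProductSpace ℝ E₁] [NormedAddCommGroup E₂] [InnerProductSpace ℝ E₂] {μ : Measure α}
    (B : E₁ →L[ℝ] E₂ →L[ℝ] E) (hB : ∀ x y, ‖B x y‖ₑ ≤ ‖x‖ₑ * ‖y‖ₑ) (hp : 1 < p)
    {c : ℕ → α → E₁} {c' : α → E₁} {b : α → E₂}
    (hc : ∀ n, MemLp (c n) (ENNReal.ofReal p) μ) (hc' : MemLp c' (ENNReal.ofReal p) μ)
    (hb : MemLp b (ENNReal.ofReal p.conjExponent) μ)
    (h : Tendsto (fun n => energy p μ (fun x => c n x - c' x)) atTop (𝓝 0)) :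
    Tendsto (fun n => ∫ x, B (c n x) (b x) ∂μ) atTop (𝓝 (∫ x, B (c' x) (b x) ∂μ)) := by
  have hint : ∀ d : α → E₁, MemLp d (ENNReal.ofReal p) μ →
      Integrable (fun x => B (d x) (b x)) μ := by
    intro d hd
    refine ⟨B.aestronglyMeasurable_comp₂ hd.1 hb.1, ?_⟩
    refine (lintegral_mono fun x => hB (d x) (b x)).trans_lt
      ((lintegral_enorm_mul_le hp hd hb).trans_lt ?_)
    exact ENNReal.mul_lt_top (ENNReal.rpow_lt_top_of_nonneg (by positivity) ENNReal.ofReal_ne_top)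
      (ENNReal.rpow_lt_top_of_nonneg (by
        have := (Real.HolderConjugate.conjExponent hp).symm.pos
        positivity) ENNReal.ofReal_ne_top)
  refine tendsto_integral_of_L1 _ (hint c' hc').1 (Eventually.of_forall fun n => hint _ (hc n)) ?_
  have h0 : Tendsto (fun n => ENNReal.ofReal (energy p μ (fun x => c n x - c' x)) ^ (1 / p) *
      ENNReal.ofReal (energy p.conjExponent μ b) ^ (1 / p.conjExponent)) atTop (𝓝 0) := by
    have h1 := (ENNReal.tendsto_ofReal h).ennrpow_const (1 / p)
    rw [ENNReal.ofReal_zero, ENNReal.zero_rpow_of_pos (by positivity)] at h1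
    have h2 := ENNReal.Tendsto.mul_const (b := ENNReal.ofReal (energy p.conjExponent μ b) ^
      (1 / p.conjExponent)) h1 (Or.inr (ENNReal.rpow_lt_top_of_nonneg (by
        have := (Real.HolderConjugate.conjExponent hp).symm.pos
        positivity) ENNReal.ofReal_ne_top).ne)
    rwa [zero_mul] at h2
  refine tendsto_of_tendsto_of_tendsto_of_le_of_le tendsto_const_nhds h0
    (fun _ => zero_le) fun n => ?_
  refine (lintegral_mono fun x => ?_).trans (lintegral_enorm_mul_le hp ((hc n).sub hc') hb)
  rw [← B.map_sub₂]
  exact hB _ _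

theorem HasGradZero.integral_smul_gradient (hp : 1 < p) {u : Rn N → ℝ} {G : Rn N → Rn N}
    (h : HasGradZero p Ω u G) {ψ : Rn N → ℝ} (hψ : IsTest Set.univ ψ) :
    ∫ x, u x • gradient ψ x = - ∫ x, ψ x • G x := by
  obtain ⟨φ, hφ, a1, a2⟩ := h.approx
  have t1 := tendsto_integral_smul_of_energy (ContinuousLinearMap.lsmul ℝ ℝ)
    (fun x y => by simp [enorm_smul]) hp (fun n => (hφ n).memLp _) h.memLp
    (hψ.memLp_gradient _) a1
  have t2 := tendsto_integral_smul_of_energy (ContinuousLinearMap.lsmul ℝ ℝ).flip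
    (fun x y => by simp [enorm_smul, mul_comm]) hp (fun n => (hφ n).memLp_gradient _) h.memLp_grad
    (hψ.memLp _) a2
  simp only [ContinuousLinearMap.flip_apply, ContinuousLinearMap.lsmul_apply] at t1 t2
  simp_rw [fun n => (hφ n).integral_smul_gradient hψ] at t1
  exact tendsto_nhds_unique t1 t2.neg

theorem HasGradZero.isWeakGradient (hp : 1 < p) {u : Rn N → ℝ} {G : Rn N → Rn N}
    (h : HasGradZero p Ω u G) (U : Set (Rn N)) : IsWeakGradient U u G := by
  have hp' : (1 : ENNReal) ≤ ENNReal.ofReal p := (fact_one_le hp).out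
  refine ⟨(h.memLp.locallyIntegrable hp').locallyIntegrableOn U,
    (h.memLp_grad.locallyIntegrable hp').locallyIntegrableOn U, fun φ h1 h2 h3 => ?_⟩
  rw [setIntegral_eq_integral_of_forall_compl_eq_zero, setIntegral_eq_integral_of_forall_compl_eq_zero]
  · exact h.integral_smul_gradient hp ⟨h1, h2, Set.subset_univ _⟩
  · intro x hx
    rw [image_eq_zero_of_notMem_tsupport (fun h => hx (h3 h)), zero_smul]
  · intro x hx
    rw [gradient_eq_zero_of_notMem_tsupport (fun h => hx (h3 h)), smul_zero]

theorem HasGradZero.grad_unique (hp : 1 < p) {u : Rn N → ℝ} {G H : Rn N → Rn N}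
    (h : HasGradZero p Ω u G) (h' : HasGradZero p Ω u H) : G =ᵐ[volume] H := by
  have := (h.isWeakGradient hp Set.univ).ae_eq isOpen_univ (h'.isWeakGradient hp Set.univ)
  rwa [Measure.restrict_univ] at this

theorem exists_subseq_tendsto_ae {α E : Type*} [MeasurableSpace α] [NormedAddCommGroup E]
    [InnerProductSpace ℝ E] {μ : Measure α} (hp : 1 < p) {a : ℕ → α → E} {b : α → E}
    (ha : ∀ i, MemLp (a i) (ENNReal.ofReal p) μ) (hb : MemLp b (ENNReal.ofReal p) μ)
    (h : Tendsto (fun n => energy p μ (fun x => a n x - b x)) atTop (𝓝 0)) :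
    ∃ k : ℕ → ℕ, StrictMono k ∧ ∀ᵐ x ∂μ, Tendsto (fun n => a (k n) x) atTop (𝓝 (b x)) := by
  have h1 := (tendsto_eLpNorm_iff_energy hp (fun n => (ha n).sub hb)).mpr h
  exact (tendstoInMeasure_of_tendsto_eLpNorm (by simp; linarith) (fun n => (ha n).1) hb.1
    h1).exists_seq_tendsto_ae

/-- Along subsequences the approximating test functions and their gradients converge almost
everywhere, and all of them vanish off `Ω`. -/
theorem HasGradZero.ae_eq_zero (hp : 1 < p) {u : Rn N → ℝ} {G : Rn N → Rn N}
    (h : HasGradZero p Ω u G) : ∀ᵐ x, x ∉ Ω → u x = 0 ∧ G x = 0 := by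
  obtain ⟨φ, hφ, a1, a2⟩ := h.approx
  obtain ⟨k, -, hk⟩ := exists_subseq_tendsto_ae hp (fun n => (hφ n).memLp _) h.memLp a1
  obtain ⟨l, -, hl⟩ := exists_subseq_tendsto_ae hp (fun n => (hφ n).memLp_gradient _) h.memLp_grad a2
  filter_upwards [hk, hl] with x h1 h2 hx
  have e1 : ∀ n, φ (k n) x = 0 := fun n =>
    image_eq_zero_of_notMem_tsupport fun h => hx ((hφ _).subset h)
  have e2 : ∀ n, gradient (φ (l n)) x = 0 := fun n =>
    gradient_eq_zero_of_notMem_tsupport fun h => hx ((hφ _).subset h)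
  simp only [e1, e2] at h1 h2
  exact ⟨tendsto_nhds_unique h1 tendsto_const_nhds, tendsto_nhds_unique h2 tendsto_const_nhds⟩

theorem HasGradZero.weakGradient_ae_eq (hp : 1 < p) (hΩ : IsOpen Ω) {u : Rn N → ℝ}
    {G : Rn N → Rn N} (h : HasGradZero p Ω u G) :
    ∀ᵐ x ∂(volume.restrict Ω), weakGradient Ω u x = G x :=
  (isWeakGradient_weakGradient ⟨G, h.isWeakGradient hp Ω⟩).ae_eq hΩ (h.isWeakGradient hp Ω)

theorem eLpNorm_eq_restrict {E : Type*} [NormedAddCommGroup E] {r : ENNReal} (hΩ : MeasurableSet Ω)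
    {f : Rn N → E} (h : ∀ᵐ x, x ∉ Ω → f x = 0) :
    eLpNorm f r volume = eLpNorm f r (volume.restrict Ω) := by
  rw [← eLpNorm_indicator_eq_eLpNorm_restrict hΩ]
  refine eLpNorm_congr_ae ?_
  filter_upwards [h] with x hx
  by_cases hxΩ : x ∈ Ω
  · rw [Set.indicator_of_mem hxΩ]
  · rw [Set.indicator_of_notMem hxΩ, hx hxΩ]

theorem HasGradZero.memX0 (hp : 1 < p) (hΩ : IsOpen Ω) {u : Rn N → ℝ} {G : Rn N → Rn N}
    (h : HasGradZero p Ω u G) : MemX0 p Ω u := by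
  have hz := h.ae_eq_zero hp
  refine ⟨⟨by simpa using h.memLp, G, h.isWeakGradient hp _, by simpa using h.memLp_grad⟩,
    ⟨⟨h.memLp.restrict Ω, G, h.isWeakGradient hp _, h.memLp_grad.restrict Ω⟩, ?_⟩, ?_⟩
  · obtain ⟨φ, hφ, a1, a2⟩ := h.approx
    refine ⟨φ, fun n => ⟨(hφ n).1, (hφ n).2, (hφ n).3⟩, ?_, ?_⟩
    · have := (tendsto_eLpNorm_iff_energy hp (fun n => ((hφ n).memLp _).sub h.memLp)).mpr a1
      refine this.congr fun n => ?_
      rw [eLpNorm_sub_comm]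
      refine eLpNorm_eq_restrict hΩ.measurableSet ?_
      filter_upwards [hz] with x hx hxΩ
      rw [Pi.sub_apply, (hx hxΩ).1,
        image_eq_zero_of_notMem_tsupport fun h => hxΩ ((hφ n).subset h), sub_zero]
    · have := (tendsto_eLpNorm_iff_energy hp
        (fun n => ((hφ n).memLp_gradient _).sub h.memLp_grad)).mpr a2
      refine this.congr fun n => ?_
      rw [eLpNorm_sub_comm, eLpNorm_eq_restrict hΩ.measurableSet]
      · refine eLpNorm_congr_ae ?_
        filter_upwards [h.weakGradient_ae_eq hp hΩ] with x hx
        rw [Pi.sub_apply, hx]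
      · filter_upwards [hz] with x hx hxΩ
        rw [Pi.sub_apply, (hx hxΩ).2,
          gradient_eq_zero_of_notMem_tsupport fun h => hxΩ ((hφ n).subset h), sub_zero]
  · rw [ae_restrict_iff' hΩ.measurableSet.compl]
    exact hz.mono fun x hx hxΩ => (hx hxΩ).1

/-- The gradient on `ℝ^N` is the weak gradient on `Ω` extended by zero. Everything involved vanishes
off `Ω` almost everywhere, so convergence on `Ω` is already convergence on `ℝ^N`. With
`HasGradZero.memX0` this identifies the solution space with the closure of the test functions. -/
theorem MemX0.exists_hasGradZero (hp : 1 < p) (hΩ : IsOpen Ω) {u : Rn N → ℝ}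
    (h : MemX0 p Ω u) : ∃ G, HasGradZero p Ω u G ∧
      ∀ᵐ x ∂(volume.restrict Ω), weakGradient Ω u x = G x := by
  obtain ⟨⟨hu, -⟩, ⟨⟨huΩ, G₀, hG₀, hG₀p⟩, φ, hφ, a1, a2⟩, hz⟩ := h
  rw [Measure.restrict_univ] at hu
  rw [ae_restrict_iff' hΩ.measurableSet.compl] at hz
  have hw : MemLp (weakGradient Ω u) (ENNReal.ofReal p) (volume.restrict Ω) :=
    hG₀p.ae_eq (hG₀.ae_eq hΩ (isWeakGradient_weakGradient ⟨G₀, hG₀⟩))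
  have hφ' : ∀ n, IsTest Ω (φ n) := fun n => ⟨(hφ n).1, (hφ n).2.1, (hφ n).2.2⟩
  have hG : MemLp (Ω.indicator (weakGradient Ω u)) (ENNReal.ofReal p) volume :=
    (memLp_indicator_iff_restrict hΩ.measurableSet).mpr hw
  refine ⟨Ω.indicator (weakGradient Ω u), ⟨hu, hG, φ, hφ', ?_, ?_⟩, ?_⟩
  · refine (tendsto_eLpNorm_iff_energy hp (fun n => ((hφ' n).memLp _).sub hu)).mp ?_
    refine a1.congr fun n => ?_
    rw [show (fun x => u x - φ n x) = u - φ n from rfl, eLpNorm_sub_comm]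
    refine (eLpNorm_eq_restrict hΩ.measurableSet ?_).symm
    filter_upwards [hz] with x hx hxΩ
    rw [Pi.sub_apply, hx hxΩ,
      image_eq_zero_of_notMem_tsupport fun h => hxΩ ((hφ' n).subset h), sub_zero]
  · refine (tendsto_eLpNorm_iff_energy hp (fun n => ((hφ' n).memLp_gradient _).sub hG)).mp ?_
    refine a2.congr fun n => ?_
    rw [show (fun x => weakGradient Ω u x - gradient (φ n) x) =
      weakGradient Ω u - gradient (φ n) from rfl, eLpNorm_sub_comm]
    symm
    rw [eLpNorm_eq_restrict hΩ.measurableSet]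
    · refine eLpNorm_congr_ae ?_
      filter_upwards [ae_restrict_mem hΩ.measurableSet] with x hx
      rw [Pi.sub_apply, Pi.sub_apply, Set.indicator_of_mem hx]
    · refine Eventually.of_forall fun x hxΩ => ?_
      rw [Pi.sub_apply, Set.indicator_of_notMem hxΩ,
          gradient_eq_zero_of_notMem_tsupport fun h => hxΩ ((hφ' n).subset h), sub_zero]
  · filter_upwards [ae_restrict_mem hΩ.measurableSet] with x hx
    rw [Set.indicator_of_mem hx]

end Sobolev

/-! ### Chain and product rules -/

section ChainRule

variable {N : ℕ} {p : ℝ} {Ω : Set (Rn N)}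

theorem tendsto_energy_zero_of_dominated {α E E' : Type*} [MeasurableSpace α]
    [NormedAddCommGroup E] [InnerProductSpace ℝ E] [NormedAddCommGroup E'] [InnerProductSpace ℝ E']
    {μ : Measure α} (hp : 1 < p) {a : ℕ → α → E} {b : α → E'}
    (ha : ∀ n, AEStronglyMeasurable (a n) μ) (hb : MemLp b (ENNReal.ofReal p) μ)
    (h : ∀ n, ∀ᵐ x ∂μ, ‖a n x‖ ≤ ‖b x‖)
    (hlim : ∀ᵐ x ∂μ, Tendsto (fun n => a n x) atTop (𝓝 0)) :
    Tendsto (fun n => energy p μ (a n)) atTop (𝓝 0) := by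
  have h0 : (0 : ℝ) = ∫ _, 0 ∂μ := by simp
  rw [h0]
  refine tendsto_integral_of_dominated_convergence (fun x => ‖b x‖ ^ p)
    (fun n => ((ha n).norm.aemeasurable.pow_const _).aestronglyMeasurable)
    (integrable_norm_rpow_ofReal hp hb) (fun n => ?_) ?_
  · filter_upwards [h n] with x hx
    rw [Real.norm_of_nonneg (by positivity)]
    exact Real.rpow_le_rpow (norm_nonneg _) hx (by linarith)
  · filter_upwards [hlim] with x hx
    have := hx.norm.rpow_const (p := p) (Or.inr (by linarith))
    rwa [norm_zero, Real.zero_rpow (by linarith)] at this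

theorem memLp_smul_of_bdd {α E : Type*} [MeasurableSpace α] [NormedAddCommGroup E]
    [InnerProductSpace ℝ E] {μ : Measure α} {r : ENNReal} {c : α → ℝ} {a : α → E} {M : ℝ}
    (hc : AEStronglyMeasurable c μ) (hM : ∀ x, |c x| ≤ M) (ha : MemLp a r μ) :
    MemLp (fun x => c x • a x) r μ := by
  refine (ha.const_smul M).mono (hc.smul ha.1) (Eventually.of_forall fun x => ?_)
  rw [Pi.smul_apply, norm_smul, norm_smul, Real.norm_eq_abs, Real.norm_eq_abs]
  exact mul_le_mul_of_nonneg_right ((hM x).trans (le_abs_self M)) (norm_nonneg _)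

theorem tendsto_energy_smul_of_bdd {α E : Type*} [MeasurableSpace α] [NormedAddCommGroup E]
    [InnerProductSpace ℝ E] {μ : Measure α} {ι : Type*} {l : Filter ι} (hp : 1 < p)
    {c : ι → α → ℝ} {a : ι → α → E} {M : ℝ} (hc : ∀ n, AEStronglyMeasurable (c n) μ)
    (hM : ∀ n x, |c n x| ≤ M) (ha : ∀ n, MemLp (a n) (ENNReal.ofReal p) μ)
    (h : Tendsto (fun n => energy p μ (a n)) l (𝓝 0)) :
    Tendsto (fun n => energy p μ (fun x => c n x • a n x)) l (𝓝 0) := by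
  have h1 := h.const_mul (|M| ^ p)
  rw [mul_zero] at h1
  refine squeeze_zero (fun n => energy_nonneg _) (fun n => ?_) h1
  rw [← energy_smul]
  refine energy_mono hp ((hc n).smul (ha n).1) ((ha n).const_smul M)
    (Eventually.of_forall fun x => ?_)
  rw [norm_smul, norm_smul, Real.norm_eq_abs, Real.norm_eq_abs]
  exact mul_le_mul_of_nonneg_right ((hM n x).trans (le_abs_self M)) (norm_nonneg _)

theorem abs_sub_le_of_abs_deriv_le {F : ℝ → ℝ} (hF : ContDiff ℝ ∞ F) {L : ℝ}
    (hL : ∀ t, |deriv F t| ≤ L) (a b : ℝ) : |F a - F b| ≤ L * |a - b| := by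
  have := Convex.norm_image_sub_le_of_norm_deriv_le (f := F) (s := Set.univ) (C := L) (x := b)
    (y := a) (fun x _ => hF.differentiable (by simp) x) (fun x _ => hL x) convex_univ
    (Set.mem_univ _) (Set.mem_univ _)
  simpa using this

/-- The error in the gradient splits as `F'(φₙ)(∇φₙ - G) + (F'(φₙ) - F'(u)) G`. The first part is a
bounded factor times a null sequence; the second tends to zero by dominated convergence along an
a.e. convergent subsequence. -/
theorem HasGradZero.comp (hp : 1 < p) {u : Rn N → ℝ} {G : Rn N → Rn N}
    (h : HasGradZero p Ω u G) {F : ℝ → ℝ} (hF : ContDiff ℝ ∞ F) (h0 : F 0 = 0) {L : ℝ}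
    (hL : ∀ t, |deriv F t| ≤ L) :
    HasGradZero p Ω (fun x => F (u x)) (fun x => deriv F (u x) • G x) := by
  obtain ⟨φ', hφ', a1', a2'⟩ := h.approx
  obtain ⟨k, hk, hae⟩ := exists_subseq_tendsto_ae hp (fun n => (hφ' n).memLp _) h.memLp a1'
  have hL0 : 0 ≤ L := (abs_nonneg _).trans (hL 0)
  set φ := fun n => φ' (k n)
  have hφ : ∀ n, IsTest Ω (φ n) := fun n => hφ' (k n)
  have a1 := a1'.comp hk.tendsto_atTop
  have a2 := a2'.comp hk.tendsto_atTop
  have hlip := abs_sub_le_of_abs_deriv_le hF hL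
  have hd : Continuous (deriv F) := hF.continuous_deriv (by simp)
  have hdm : ∀ v : Rn N → ℝ, AEStronglyMeasurable v volume →
      AEStronglyMeasurable (fun x => deriv F (v x)) volume :=
    fun v hv => hd.comp_aestronglyMeasurable hv
  refine ⟨?_, memLp_smul_of_bdd (hdm u h.memLp.1) (fun x => hL _) h.memLp_grad,
    fun n x => F (φ n x), fun n => (hφ n).comp hF h0, ?_, ?_⟩
  · refine (h.memLp.const_smul L).mono (hF.continuous.comp_aestronglyMeasurable h.memLp.1)
      (Eventually.of_forall fun x => ?_)
    have := hlip (u x) 0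
    rw [h0, sub_zero, sub_zero] at this
    rw [Pi.smul_apply, norm_smul, Real.norm_of_nonneg hL0]
    exact this
  · have h1 := a1.const_mul (|L| ^ p)
    rw [mul_zero] at h1
    refine squeeze_zero (fun n => energy_nonneg _) (fun n => ?_) h1
    simp only [Function.comp]
    rw [← energy_smul]
    refine energy_mono hp ((hF.continuous.comp_aestronglyMeasurable ((hφ n).memLp 1).1).sub
      (hF.continuous.comp_aestronglyMeasurable h.memLp.1))
      ((((hφ n).memLp _).sub h.memLp).const_smul L) (Eventually.of_forall fun x => ?_)
    rw [norm_smul, Real.norm_of_nonneg hL0]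
    exact hlip _ _
  · have b1 := tendsto_energy_smul_of_bdd hp (c := fun n x => deriv F (φ n x))
      (fun n => hdm _ ((hφ n).memLp 1).1) (fun n x => hL _)
      (fun n => ((hφ n).memLp_gradient _).sub h.memLp_grad) a2
    have c2 : ∀ n x, |deriv F (φ n x) - deriv F (u x)| ≤ 2 * L := fun n x => by
      have := abs_sub (deriv F (φ n x)) (deriv F (u x))
      linarith [hL (φ n x), hL (u x)]
    have c1 : ∀ n, AEStronglyMeasurable (fun x => deriv F (φ n x) - deriv F (u x)) volume :=
      fun n => (hdm _ ((hφ n).memLp 1).1).sub (hdm u h.memLp.1)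
    have b2 : Tendsto (fun n => energy p volume
        (fun x => (deriv F (φ n x) - deriv F (u x)) • G x)) atTop (𝓝 0) := by
      refine tendsto_energy_zero_of_dominated hp (b := fun x => (2 * L) • G x)
        (fun n => (c1 n).smul h.memLp_grad.1)
        (h.memLp_grad.const_smul (2 * L)) (fun n => Eventually.of_forall fun x => ?_) ?_
      · rw [norm_smul, norm_smul, Real.norm_eq_abs, Real.norm_of_nonneg (by positivity)]
        gcongr
        exact c2 n x
      · filter_upwards [hae] with x hx
        have h1 := ((hd.tendsto (u x)).comp hx).sub_const (deriv F (u x))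
        rw [sub_self] at h1
        simpa using h1.smul_const (G x)
    have b3 := tendsto_energy_add hp
      (fun n => memLp_smul_of_bdd (hdm _ ((hφ n).memLp 1).1) (fun x => hL _)
        (((hφ n).memLp_gradient _).sub h.memLp_grad))
      (fun n => memLp_smul_of_bdd (c1 n) (c2 n) h.memLp_grad) b1 b2
    refine b3.congr fun n => ?_
    congr 1; funext x
    rw [gradient_comp (hφ n) hF, Pi.sub_apply, smul_sub, sub_smul]
    abel

theorem HasGradZero.test_mul (hp : 1 < p) {u : Rn N → ℝ} {G : Rn N → Rn N}
    (h : HasGradZero p Ω u G) {ψ : Rn N → ℝ} (hψ : IsTest Ω ψ) :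
    HasGradZero p Ω (fun x => ψ x * u x) (fun x => ψ x • G x + u x • gradient ψ x) := by
  obtain ⟨φ, hφ, a1, a2⟩ := h.approx
  obtain ⟨M, hM⟩ := hψ.compact.exists_bound_of_continuous hψ.contDiff.continuous
  obtain ⟨M', hM'⟩ := hψ.hasCompactSupport_gradient.exists_bound_of_continuous hψ.continuous_gradient
  have hψm : AEStronglyMeasurable ψ volume := hψ.contDiff.continuous.aestronglyMeasurable
  have hsm : ∀ v : Rn N → ℝ, MemLp v (ENNReal.ofReal p) volume →
      MemLp (fun x => v x • gradient ψ x) (ENNReal.ofReal p) volume := by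
    intro v hv
    refine (hv.const_smul M').mono (hv.1.smul hψ.continuous_gradient.aestronglyMeasurable)
      (Eventually.of_forall fun x => ?_)
    rw [Pi.smul_apply, norm_smul, norm_smul, mul_comm]
    gcongr
    exact (hM' x).trans (le_abs_self M')
  refine ⟨memLp_smul_of_bdd hψm hM h.memLp,
    (memLp_smul_of_bdd hψm hM h.memLp_grad).add (hsm u h.memLp),
    fun n x => ψ x * φ n x, fun n => hψ.mul (hφ n), ?_, ?_⟩
  · have := tendsto_energy_smul_of_bdd hp (c := fun _ => ψ) (fun n => hψm) (fun n => hM)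
      (fun n => ((hφ n).memLp _).sub h.memLp) a1
    refine this.congr fun n => ?_
    congr 1; ext x
    simp only [Pi.sub_apply, smul_eq_mul]; ring
  · have b1 := tendsto_energy_smul_of_bdd hp (c := fun _ => ψ) (fun n => hψm) (fun n => hM)
      (fun n => ((hφ n).memLp_gradient _).sub h.memLp_grad) a2
    have b2 : Tendsto (fun n => energy p volume (fun x => (φ n x - u x) • gradient ψ x)) atTop
        (𝓝 0) := by
      have h1 := a1.const_mul (|M'| ^ p)
      rw [mul_zero] at h1
      refine squeeze_zero (fun n => energy_nonneg _) (fun n => ?_) h1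
      rw [← energy_smul]
      refine energy_mono hp (hsm _ (((hφ n).memLp _).sub h.memLp)).1
        ((((hφ n).memLp _).sub h.memLp).const_smul M') (Eventually.of_forall fun x => ?_)
      rw [norm_smul, norm_smul, mul_comm]
      gcongr
      exact (hM' x).trans (le_abs_self M')
    have b3 := tendsto_energy_add hp
      (fun n => memLp_smul_of_bdd hψm hM (((hφ n).memLp_gradient _).sub h.memLp_grad))
      (fun n => hsm _ (((hφ n).memLp _).sub h.memLp)) b1 b2
    refine b3.congr fun n => ?_
    congr 1; funext x
    rw [gradient_mul hψ (hφ n), Pi.sub_apply, Pi.sub_apply, smul_sub, sub_smul]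
    abel

/-- The cutoff `ψ` removes the condition `F 0 = 0`: apply the chain rule to `F - F 0` and add back
`F 0 * ψ`. This is needed for `bell`, which equals `1` at `0`. -/
theorem HasGradZero.test_mul_comp (hp : 1 < p) {u : Rn N → ℝ} {G : Rn N → Rn N}
    (h : HasGradZero p Ω u G) {ψ : Rn N → ℝ} (hψ : IsTest Ω ψ) {F : ℝ → ℝ} (hF : ContDiff ℝ ∞ F)
    {L : ℝ} (hL : ∀ t, |deriv F t| ≤ L) :
    HasGradZero p Ω (fun x => ψ x * F (u x))
      (fun x => (ψ x * deriv F (u x)) • G x + F (u x) • gradient ψ x) := by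
  have hd : ∀ t, deriv (fun t => F t - F 0) t = deriv F t := fun t => deriv_sub_const _
  have h1 := (h.comp hp (F := fun t => F t - F 0) (hF.sub contDiff_const) (sub_self _)
    (L := L) (fun t => by rw [hd]; exact hL t)).test_mul hp hψ
  have h2 := h1.add hp ((hψ.hasGradZero hp).smul (F 0))
  refine h2.congr (Eventually.of_forall fun x => ?_) (Eventually.of_forall fun x => ?_)
  · simp only [smul_eq_mul]; ring
  · simp only [hd, smul_smul, sub_smul]
    abel

/-- The functions `Fₙ(t) = arctan((n + 1)t) / (n + 1)` tend to `0`, while their derivatives stay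
bounded by `1` and tend to the indicator of `0`. So `Fₙ(u)` tends to `0` with gradients tending to
`G` on `{u = 0}` and `0` elsewhere, and uniqueness of the gradient makes that limit vanish. -/
theorem HasGradZero.grad_eq_zero_of_eq_zero (hp : 1 < p) {u : Rn N → ℝ} {G : Rn N → Rn N}
    (h : HasGradZero p Ω u G) : ∀ᵐ x, u x = 0 → G x = 0 := by
  have hF : ∀ n : ℕ, ContDiff ℝ ∞ (fun t : ℝ => Real.arctan ((n + 1) * t) / (n + 1)) := fun n =>
    (Real.contDiff_arctan.comp (contDiff_const.mul contDiff_id)).div_const _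
  have hd : ∀ (n : ℕ) (t : ℝ), deriv (fun t : ℝ => Real.arctan ((n + 1) * t) / (n + 1)) t =
      1 / (1 + ((n + 1) * t) ^ 2) := by
    intro n t
    have h1 : HasDerivAt (fun t : ℝ => ((n : ℝ) + 1) * t) (n + 1) t := by
      simpa using (hasDerivAt_id t).const_mul ((n : ℝ) + 1)
    have h2 := (h1.arctan.div_const ((n : ℝ) + 1)).deriv
    rw [h2]
    have : (n : ℝ) + 1 ≠ 0 := by positivity
    field_simp
  have hb : ∀ (n : ℕ) (t : ℝ), |deriv (fun t : ℝ => Real.arctan ((n + 1) * t) / (n + 1)) t| ≤ 1 := by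
    intro n t
    rw [hd, abs_of_nonneg (by positivity), div_le_one (by positivity)]
    nlinarith [sq_nonneg (((n : ℝ) + 1) * t)]
  have hc := fun n => h.comp hp (hF n) (by simp) (hb n)
  have hum := h.memLp.1
  have hgm := h.memLp_grad
  have hset : NullMeasurableSet {x | u x = 0} volume :=
    nullMeasurableSet_eq_fun hum.aemeasurable aemeasurable_const
  have hHm : AEStronglyMeasurable ({x | u x = 0}.indicator G) volume := hgm.1.indicator₀ hset
  have hH : MemLp ({x | u x = 0}.indicator G) (ENNReal.ofReal p) volume :=
    hgm.mono hHm (Eventually.of_forall fun x => norm_indicator_le_norm_self _ _)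
  have hT : Tendsto (fun n : ℕ => (n : ℝ) + 1) atTop atTop :=
    tendsto_atTop_add_const_right _ _ tendsto_natCast_atTop_atTop
  have key : HasGradZero p Ω (fun _ => 0) ({x | u x = 0}.indicator G) := by
    refine HasGradZero.of_tendsto hp hc MemLp.zero' hH ?_ ?_
    · simp only [sub_zero]
      refine tendsto_energy_zero_of_dominated hp (fun n => (hc n).memLp.1) h.memLp
        (fun n => Eventually.of_forall fun x => ?_) (Eventually.of_forall fun x => ?_)
      · have := abs_sub_le_of_abs_deriv_le (hF n) (hb n) (u x) 0
        simpa only [mul_zero, Real.arctan_zero, zero_div, sub_zero, one_mul, Real.norm_eq_abs] using this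
      · have h1 : Tendsto (fun n : ℕ => Real.pi / ((n : ℝ) + 1)) atTop (𝓝 0) :=
          tendsto_const_nhds.div_atTop hT
        refine squeeze_zero_norm (fun n => ?_) h1
        rw [norm_div, Real.norm_of_nonneg (by positivity : (0 : ℝ) ≤ (n : ℝ) + 1)]
        gcongr
        rw [Real.norm_eq_abs, abs_le]
        have := Real.pi_pos
        exact ⟨by linarith [Real.neg_pi_div_two_lt_arctan (((n : ℝ) + 1) * u x)],
          by linarith [Real.arctan_lt_pi_div_two (((n : ℝ) + 1) * u x)]⟩
    · refine tendsto_energy_zero_of_dominated hp (fun n => ((hc n).memLp_grad.sub hH).1) hgm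
        (fun n => Eventually.of_forall fun x => ?_) (Eventually.of_forall fun x => ?_)
      · by_cases hx : u x = 0
        · rw [Set.indicator_of_mem (show x ∈ {x | u x = 0} from hx), hd, hx]
          simp
        · rw [Set.indicator_of_notMem (show x ∉ {x | u x = 0} from hx), sub_zero, norm_smul]
          have := hb n (u x)
          rw [← Real.norm_eq_abs] at this
          nlinarith [norm_nonneg (G x)]
      · by_cases hx : u x = 0
        · rw [Set.indicator_of_mem (show x ∈ {x | u x = 0} from hx), hx]
          simp only [hd]
          simp
        · rw [Set.indicator_of_notMem (show x ∉ {x | u x = 0} from hx)]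
          simp only [hd, sub_zero]
          have h1 : Tendsto (fun n : ℕ => (1 : ℝ) / (1 + (((n : ℝ) + 1) * u x) ^ 2)) atTop (𝓝 0) := by
            refine tendsto_const_nhds.div_atTop (tendsto_atTop_add_const_left _ _ ?_)
            simp_rw [mul_pow]
            exact ((tendsto_pow_atTop two_ne_zero).comp hT).atTop_mul_const (by positivity)
          simpa using h1.smul_const (G x)
  have zero : HasGradZero p Ω (fun _ => 0) (fun _ => (0 : Rn N)) := by
    simpa using h.smul 0
  filter_upwards [key.grad_unique hp zero] with x hx hux
  rwa [Set.indicator_of_mem (show x ∈ {x | u x = 0} from hux)] at hx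

end ChainRule

/-! ### The Sobolev inequality and weights -/

section Weights

variable {N : ℕ} {p q : ℝ} {Ω : Set (Rn N)}

/-- The inequality for test functions passes to the closure: the left side is lower semicontinuous
under a.e. convergence, and the right side converges. The constant does not depend on `Ω`. -/
theorem exists_sobolev_const (hp : 1 < p) (hpN : p < N) :
    ∃ C : NNReal, ∀ (Ω : Set (Rn N)) (u : Rn N → ℝ) (G : Rn N → Rn N), HasGradZero p Ω u G →
      eLpNorm u (ENNReal.ofReal (N * p / (N - p))) volume ≤
        C * eLpNorm G (ENNReal.ofReal p) volume := by
  have hp0 : 0 < p := by linarith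
  have hN : 0 < (N : ℝ) := by linarith
  have hpN' : 0 < (N : ℝ) - p := by linarith
  refine ⟨eLpNormLESNormFDerivOfEqInnerConst (volume : Measure (Rn N)) p.toNNReal,
    fun Ω u G h => ?_⟩
  obtain ⟨φ', hφ', a1', a2'⟩ := h.approx
  obtain ⟨k, hk, hae⟩ := exists_subseq_tendsto_ae hp (fun n => (hφ' n).memLp _) h.memLp a1'
  have a2 := tendsto_energy hp (fun n => (hφ' (k n)).memLp_gradient _) h.memLp_grad
    (a2'.comp hk.tendsto_atTop)
  refine (Lp.eLpNorm_lim_le_liminf_eLpNorm (f := fun n => φ' (k n))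
    (fun n => ((hφ' (k n)).memLp 1).1) _ hae).trans ?_
  have hlim : Tendsto (fun n => (eLpNormLESNormFDerivOfEqInnerConst (volume : Measure (Rn N))
      p.toNNReal : ENNReal) * eLpNorm (gradient (φ' (k n))) (ENNReal.ofReal p) volume) atTop
      (𝓝 (eLpNormLESNormFDerivOfEqInnerConst (volume : Measure (Rn N)) p.toNNReal *
        eLpNorm G (ENNReal.ofReal p) volume)) := by
    refine ENNReal.Tendsto.const_mul ?_ (Or.inr ENNReal.coe_ne_top)
    rw [eLpNorm_eq_energy hp h.memLp_grad]
    simp_rw [fun n => eLpNorm_eq_energy hp ((hφ' (k n)).memLp_gradient (ENNReal.ofReal p))]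
    exact ENNReal.tendsto_ofReal (a2.rpow_const (Or.inr (by positivity)))
  rw [← hlim.liminf_eq]
  refine liminf_le_liminf (Eventually.of_forall fun n => ?_)
  have hs := eLpNorm_le_eLpNorm_fderiv_of_eq_inner (volume : Measure (Rn N))
    (u := φ' (k n)) (p := p.toNNReal) (p' := (N * p / (N - p)).toNNReal)
    ((hφ' (k n)).contDiff.of_le (by simp)) (hφ' (k n)).compact
    (by rw [← NNReal.coe_le_coe, Real.coe_toNNReal _ hp0.le]; exact hp.le)
    (by rw [finrank_euclideanSpace_fin]; exact_mod_cast hN)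
    (by
      rw [Real.coe_toNNReal _ (by positivity), NNReal.coe_inv, Real.coe_toNNReal _ hp0.le,
        finrank_euclideanSpace_fin]
      field_simp)
  refine hs.trans (le_of_eq ?_)
  congr 1
  exact eLpNorm_congr_norm_ae (Eventually.of_forall fun x => (norm_gradient _ x).symm)

/-- The measure `V dx` on `Ω`. -/
noncomputable def weighted (Ω : Set (Rn N)) (V : Rn N → ℝ) : Measure (Rn N) :=
  (volume.restrict Ω).withDensity fun x => ENNReal.ofReal (V x)

theorem weighted_absolutelyContinuous (V : Rn N → ℝ) : weighted Ω V ≪ volume :=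
  (withDensity_absolutelyContinuous _ _).trans Measure.absolutelyContinuous_restrict

theorem lintegral_weighted {V : Rn N → ℝ} (hV : AEMeasurable V (volume.restrict Ω))
    {f : Rn N → ENNReal} (hf : AEMeasurable f volume) :
    ∫⁻ x, f x ∂(weighted Ω V) = ∫⁻ x in Ω, ENNReal.ofReal (V x) * f x :=
  lintegral_withDensity_eq_lintegral_mul₀ hV.ennreal_ofReal hf.restrict

/-- Hölder with the conjugate exponents `N / p` and `N / (N - p)`, then Sobolev raised to the power
`p`. The weight `κ` is kept arbitrary so that truncated weights can be inserted later. -/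
theorem exists_lintegral_weight_le (hp : 1 < p) (hpN : p < N) :
    ∃ C : NNReal, ∀ (Ω : Set (Rn N)) (u : Rn N → ℝ) (G : Rn N → Rn N), HasGradZero p Ω u G →
      ∀ κ : Rn N → ENNReal, AEMeasurable κ (volume.restrict Ω) →
      ∫⁻ x in Ω, κ x * ‖u x‖ₑ ^ p ≤ C * (∫⁻ x in Ω, κ x ^ (N / p)) ^ (p / N) *
        ENNReal.ofReal (energy p volume G) := by
  have hp0 : 0 < p := by linarith
  have hN : 0 < (N : ℝ) := by linarith
  have hpN' : 0 < (N : ℝ) - p := by linarith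
  obtain ⟨C, hC⟩ := exists_sobolev_const hp hpN
  refine ⟨C ^ p, fun Ω u G h κ hκ => ?_⟩
  have hconj : Real.HolderConjugate (N / p) (N / (N - p)) := by
    rw [Real.holderConjugate_iff]
    refine ⟨by rw [lt_div_iff₀ hp0]; linarith, by field_simp; ring⟩
  have h1 := ENNReal.lintegral_mul_le_Lp_mul_Lq (volume.restrict Ω) hconj hκ
    (h.memLp.1.enorm.pow_const p).restrict
  have h2 : (∫⁻ x in Ω, (‖u x‖ₑ ^ p) ^ ((N : ℝ) / (N - p))) ^ (1 / ((N : ℝ) / (N - p))) ≤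
      C ^ p * ENNReal.ofReal (energy p volume G) := by
    have h3 := hC Ω u G h
    rw [eLpNorm_eq_lintegral_rpow_enorm_toReal (by simp; positivity) ENNReal.ofReal_ne_top,
      ENNReal.toReal_ofReal (by positivity), eLpNorm_eq_energy hp h.memLp_grad] at h3
    have h4 := ENNReal.rpow_le_rpow h3 hp0.le
    rw [ENNReal.mul_rpow_of_nonneg _ _ hp0.le,
      ENNReal.ofReal_rpow_of_nonneg (Real.rpow_nonneg (energy_nonneg _) _) hp0.le,
      Real.rpow_inv_rpow (energy_nonneg _) hp0.ne', ← ENNReal.rpow_mul] at h4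
    refine le_trans (le_of_eq ?_) ((ENNReal.rpow_le_rpow
      (lintegral_mono' (Measure.restrict_le_self (s := Ω)) le_rfl) (by positivity)).trans h4)
    simp_rw [← ENNReal.rpow_mul]
    congr 1
    · congr 1; ext x; congr 1; field_simp
    · field_simp
  refine h1.trans ?_
  rw [show 1 / ((N : ℝ) / p) = p / N by field_simp]
  calc _ ≤ (∫⁻ x in Ω, κ x ^ (N / p)) ^ (p / N) *
        (C ^ p * ENNReal.ofReal (energy p volume G)) := by gcongr
    _ = _ := by
      rw [ENNReal.coe_rpow_of_nonneg _ hp0.le]; ring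

theorem lintegral_rpow_lt_top_of_memLp (hp : 1 < p) (hpN : p < N) (hΩb : volume Ω ≠ ⊤)
    (hq : N / p ≤ q) {V : Rn N → ℝ} (hV : MemLp V (ENNReal.ofReal q) (volume.restrict Ω)) :
    ∫⁻ x in Ω, ENNReal.ofReal (V x) ^ (N / p) < ⊤ := by
  have hp0 : 0 < p := by linarith
  have hN : 0 < (N : ℝ) := by linarith
  have : IsFiniteMeasure (volume.restrict Ω) := ⟨by simpa using hΩb.lt_top⟩
  have h1 := hV.mono_exponent (ENNReal.ofReal_le_ofReal hq)
  have h2 := h1.2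
  rw [eLpNorm_lt_top_iff_lintegral_rpow_enorm_lt_top (by simp; positivity) ENNReal.ofReal_ne_top,
    ENNReal.toReal_ofReal (by positivity)] at h2
  refine (lintegral_mono fun x => ?_).trans_lt h2
  gcongr
  rw [← ofReal_norm]
  exact ENNReal.ofReal_le_ofReal (le_abs_self _)

theorem HasGradZero.memLp_weighted (hp : 1 < p) (hpN : p < N) (hΩb : volume Ω ≠ ⊤)
    (hq : N / p ≤ q) {V : Rn N → ℝ} (hV : MemLp V (ENNReal.ofReal q) (volume.restrict Ω))
    {u : Rn N → ℝ} {G : Rn N → Rn N} (h : HasGradZero p Ω u G) :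
    MemLp u (ENNReal.ofReal p) (weighted Ω V) := by
  obtain ⟨C, hC⟩ := exists_lintegral_weight_le hp hpN
  refine memLp_of_lintegral_lt_top hp (h.memLp.1.mono_ac (weighted_absolutelyContinuous V)) ?_
  rw [lintegral_weighted hV.1.aemeasurable (h.memLp.1.enorm.pow_const p)]
  refine (hC Ω u G h _ hV.1.aemeasurable.ennreal_ofReal).trans_lt ?_
  have := lintegral_rpow_lt_top_of_memLp hp hpN hΩb hq hV
  exact ENNReal.mul_lt_top (ENNReal.mul_lt_top ENNReal.coe_lt_top
    (ENNReal.rpow_lt_top_of_nonneg (by positivity) this.ne)) ENNReal.ofReal_lt_top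

theorem exists_energy_weighted_le (hp : 1 < p) (hpN : p < N) (hΩb : volume Ω ≠ ⊤)
    (hq : N / p ≤ q) {V : Rn N → ℝ} (hV : MemLp V (ENNReal.ofReal q) (volume.restrict Ω)) :
    ∃ C : ℝ, 0 ≤ C ∧ ∀ (u : Rn N → ℝ) (G : Rn N → Rn N), HasGradZero p Ω u G →
      energy p (weighted Ω V) u ≤ C * energy p volume G := by
  obtain ⟨C, hC⟩ := exists_lintegral_weight_le hp hpN
  have hfin := lintegral_rpow_lt_top_of_memLp hp hpN hΩb hq hV
  have hp0 : 0 < p := by linarith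
  have hfin' : (C : ENNReal) * (∫⁻ x in Ω, ENNReal.ofReal (V x) ^ (N / p)) ^ (p / N) ≠ ⊤ :=
    (ENNReal.mul_lt_top ENNReal.coe_lt_top
      (ENNReal.rpow_lt_top_of_nonneg (by positivity) hfin.ne)).ne
  refine ⟨(C * (∫⁻ x in Ω, ENNReal.ofReal (V x) ^ (N / p)) ^ (p / N) : ENNReal).toReal,
    ENNReal.toReal_nonneg, fun u G h => ?_⟩
  · have h1 := hC Ω u G h _ hV.1.aemeasurable.ennreal_ofReal
    rw [← lintegral_weighted hV.1.aemeasurable (h.memLp.1.enorm.pow_const p),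
      ← ofReal_energy hp (h.memLp_weighted hp hpN hΩb hq hV), ← ENNReal.ofReal_toReal hfin',
      ← ENNReal.ofReal_mul ENNReal.toReal_nonneg] at h1
    exact (ENNReal.ofReal_le_ofReal_iff (mul_nonneg ENNReal.toReal_nonneg (energy_nonneg G))).mp h1

/-- The Poincaré inequality. -/
theorem exists_energy_le_energy_grad (hp : 1 < p) (hpN : p < N)
    (hΩb : volume Ω ≠ ⊤) :
    ∃ C : ℝ, 0 ≤ C ∧ ∀ (u : Rn N → ℝ) (G : Rn N → Rn N), HasGradZero p Ω u G →
      energy p volume u ≤ C * energy p volume G := by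
  have : IsFiniteMeasure (volume.restrict Ω) := ⟨by simpa using hΩb.lt_top⟩
  -- The constant weight `1`, taken with exponent `q = N / p`.
  obtain ⟨C, hC, h⟩ := exists_energy_weighted_le (Ω := Ω) hp hpN hΩb le_rfl
    (V := fun _ => 1) (memLp_const 1)
  refine ⟨C, hC, fun u G hu => (le_of_eq ?_).trans (h u G hu)⟩
  simp only [weighted, energy, ENNReal.ofReal_one]
  rw [withDensity_const, one_smul]
  symm
  refine setIntegral_eq_integral_of_ae_compl_eq_zero ?_
  filter_upwards [hu.ae_eq_zero hp] with x hx hxΩ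
  rw [(hx hxΩ).1, norm_zero, Real.zero_rpow (by linarith)]

/-- Truncating the weight bounds the weighted energy by a small multiple of the energy of the
gradient and a multiple of the energy of the function. -/
theorem exists_energy_weighted_le_add (hp : 1 < p) (hpN : p < N) (hΩb : volume Ω ≠ ⊤)
    (hq : N / p ≤ q) {V : Rn N → ℝ} (hV : MemLp V (ENNReal.ofReal q) (volume.restrict Ω))
    {ε : ℝ} (hε : 0 < ε) :
    ∃ M : ℝ, 0 ≤ M ∧ ∀ (u : Rn N → ℝ) (G : Rn N → Rn N), HasGradZero p Ω u G →
      energy p (weighted Ω V) u ≤ ε * energy p volume G + M * energy p volume u := by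
  obtain ⟨C, hC⟩ := exists_lintegral_weight_le hp hpN
  have hp0 : 0 < p := by linarith
  have hN : 0 < (N : ℝ) := by linarith
  have hfin := lintegral_rpow_lt_top_of_memLp hp hpN hΩb hq hV
  have hVm : AEMeasurable (fun x => ENNReal.ofReal (V x)) (volume.restrict Ω) :=
    hV.1.aemeasurable.ennreal_ofReal
  -- `κ n` is the part of the weight above the level `n`. The weight is at most `κ n + n`, and the
  -- `L^{N/p}` norm of `κ n` tends to zero, so its contribution is a small multiple of the gradient
  -- energy.
  let κ : ℕ → Rn N → ENNReal := fun n x =>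
    {t : ENNReal | (n : ENNReal) < t}.indicator id (ENNReal.ofReal (V x))
  have hmeas : ∀ n : ℕ, Measurable ({t : ENNReal | (n : ENNReal) < t}.indicator id) := fun n =>
    measurable_id.indicator measurableSet_Ioi
  have hκm : ∀ n, AEMeasurable (κ n) (volume.restrict Ω) := fun n =>
    (hmeas n).comp_aemeasurable hVm
  have hlim : Tendsto (fun n => ∫⁻ x in Ω, κ n x ^ (N / p)) atTop (𝓝 0) := by
    have h0 : (0 : ENNReal) = ∫⁻ x in Ω, 0 := by simp
    rw [h0]
    refine tendsto_lintegral_of_dominated_convergence' (fun x => ENNReal.ofReal (V x) ^ (N / p))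
      (fun n => (hκm n).pow_const _) (fun n => Eventually.of_forall fun x => ?_) hfin.ne
      (Eventually.of_forall fun x => ?_)
    · exact ENNReal.rpow_le_rpow (Set.indicator_le_self' (fun _ _ => zero_le) _) (by positivity)
    · refine tendsto_const_nhds.congr' ?_
      obtain ⟨n, hn⟩ := ENNReal.exists_nat_gt (ENNReal.ofReal_ne_top (r := V x))
      filter_upwards [eventually_ge_atTop n] with m hm
      have : ENNReal.ofReal (V x) ∉ {t : ENNReal | (m : ENNReal) < t} := by
        simp only [Set.mem_ofPred_eq, not_lt]
        exact hn.le.trans (by exact_mod_cast hm)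
      simp only [κ]
      rw [Set.indicator_of_notMem this, ENNReal.zero_rpow_of_pos (by positivity)]
  have hlim' : Tendsto (fun n => (C : ENNReal) * (∫⁻ x in Ω, κ n x ^ (N / p)) ^ (p / N)) atTop
      (𝓝 0) := by
    have h1 := hlim.ennrpow_const (p / N)
    rw [ENNReal.zero_rpow_of_pos (by positivity)] at h1
    simpa using ENNReal.Tendsto.const_mul h1 (Or.inr (ENNReal.coe_ne_top (r := C)))
  obtain ⟨n, hn⟩ := (hlim'.eventually (ge_mem_nhds (ENNReal.ofReal_pos.mpr hε))).exists
  refine ⟨n, Nat.cast_nonneg n, fun u G h => ?_⟩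
  have hum : AEMeasurable (fun x => ‖u x‖ₑ ^ p) volume := h.memLp.1.enorm.pow_const p
  have h1 : ENNReal.ofReal (energy p (weighted Ω V) u) ≤
      ENNReal.ofReal ε * ENNReal.ofReal (energy p volume G) +
      ENNReal.ofReal n * ENNReal.ofReal (energy p volume u) := by
    rw [ofReal_energy hp (h.memLp_weighted hp hpN hΩb hq hV),
      lintegral_weighted hV.1.aemeasurable hum, ofReal_energy hp h.memLp]
    calc ∫⁻ x in Ω, ENNReal.ofReal (V x) * ‖u x‖ₑ ^ p
        ≤ ∫⁻ x in Ω, (κ n x * ‖u x‖ₑ ^ p + (n : ENNReal) * ‖u x‖ₑ ^ p) := by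
          refine lintegral_mono fun x => ?_
          rw [← add_mul]
          gcongr
          simp only [κ]
          by_cases hx : ENNReal.ofReal (V x) ∈ {t : ENNReal | (n : ENNReal) < t}
          · rw [Set.indicator_of_mem hx]; exact le_self_add
          · simp only [Set.mem_ofPred_eq, not_lt] at hx
            exact hx.trans le_add_self
      _ = (∫⁻ x in Ω, κ n x * ‖u x‖ₑ ^ p) + ∫⁻ x in Ω, (n : ENNReal) * ‖u x‖ₑ ^ p :=
          lintegral_add_left' ((hκm n).mul hum.restrict) _
      _ ≤ _ := by
          gcongr
          · exact (hC Ω u G h _ (hκm n)).trans (by gcongr)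
          · rw [ENNReal.ofReal_natCast, lintegral_const_mul'' _ hum.restrict]
            gcongr
            exact Measure.restrict_le_self
  rw [← ENNReal.ofReal_mul hε.le, ← ENNReal.ofReal_mul (Nat.cast_nonneg n),
    ← ENNReal.ofReal_add (mul_nonneg hε.le (energy_nonneg _))
      (mul_nonneg (Nat.cast_nonneg n) (energy_nonneg _))] at h1
  exact (ENNReal.ofReal_le_ofReal_iff (add_nonneg (mul_nonneg hε.le (energy_nonneg _))
      (mul_nonneg (Nat.cast_nonneg n) (energy_nonneg _)))).mp h1

end Weights

/-! ### The Gagliardo seminorm -/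

section Gagliardo

variable {N : ℕ} {s p : ℝ} {Ω : Set (Rn N)}

/-- The measure `|x - y|^{-(N + ps)} dx dy`. -/
noncomputable def gagliardo (N : ℕ) (s p : ℝ) : Measure (Rn N × Rn N) :=
  (volume : Measure (Rn N × Rn N)).withDensity
    fun z => ENNReal.ofReal ((‖z.1 - z.2‖ ^ ((N : ℝ) + p * s))⁻¹)

theorem gagliardo_absolutelyContinuous :
    gagliardo N s p ≪ (volume : Measure (Rn N)).prod volume :=
  withDensity_absolutelyContinuous _ _

/-- The difference `(x, y) ↦ u x - u y`. -/
def diff (u : Rn N → ℝ) (z : Rn N × Rn N) : ℝ := u z.1 - u z.2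

theorem aestronglyMeasurable_diff {u : Rn N → ℝ} (hu : AEStronglyMeasurable u volume) :
    AEStronglyMeasurable (diff u) ((volume : Measure (Rn N)).prod volume) :=
  hu.comp_fst.sub hu.comp_snd

theorem measurable_kernel : Measurable fun z : Rn N × Rn N =>
    ENNReal.ofReal ((‖z.1 - z.2‖ ^ ((N : ℝ) + p * s))⁻¹) := by fun_prop

theorem lintegral_gagliardo {f : Rn N × Rn N → ENNReal}
    (hf : AEMeasurable f ((volume : Measure (Rn N)).prod volume)) :
    ∫⁻ z, f z ∂(gagliardo N s p) =
      ∫⁻ z, ENNReal.ofReal ((‖z.1 - z.2‖ ^ ((N : ℝ) + p * s))⁻¹) * f z ∂(volume.prod volume) :=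
  lintegral_withDensity_eq_lintegral_mul₀ measurable_kernel.aemeasurable hf

/-- Hölder's inequality against the constant function `1`. -/
theorem lintegral_rpow_le {α : Type*} [MeasurableSpace α] {μ : Measure α} (hp : 1 < p)
    {f : α → ENNReal} (hf : AEMeasurable f μ) :
    (∫⁻ x, f x ∂μ) ^ p ≤ μ Set.univ ^ (p - 1) * ∫⁻ x, f x ^ p ∂μ := by
  have hpq := Real.HolderConjugate.conjExponent hp
  have hp0 : 0 < p := by linarith
  have h := ENNReal.lintegral_mul_le_Lp_mul_Lq μ hpq hf (aemeasurable_const (b := (1 : ENNReal)))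
  simp only [Pi.mul_apply, mul_one, ENNReal.one_rpow, lintegral_const, one_mul] at h
  have h2 := ENNReal.rpow_le_rpow h hp0.le
  rw [ENNReal.mul_rpow_of_nonneg _ _ hp0.le, ← ENNReal.rpow_mul, ← ENNReal.rpow_mul,
    one_div_mul_cancel hp0.ne', ENNReal.rpow_one] at h2
  have e : 1 / p.conjExponent * p = p - 1 := by
    rw [Real.conjExponent]
    have : p - 1 ≠ 0 := by linarith
    field_simp
  rw [e] at h2
  exact h2.trans (mul_comm _ _).le

/-- Write the increment as an integral of the gradient along the segment from `x` to `x + h`, apply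
Jensen in the segment parameter, exchange the integrals and use translation invariance. -/
theorem IsTest.lintegral_translate_sub_le (hp : 1 < p) {φ : Rn N → ℝ} (hφ : IsTest Ω φ)
    (h : Rn N) : ∫⁻ x, ‖φ (x + h) - φ x‖ₑ ^ p ≤ ‖h‖ₑ ^ p * ∫⁻ x, ‖gradient φ x‖ₑ ^ p := by
  have hp0 : 0 < p := by linarith
  have hcont : Continuous (fun z : Rn N × ℝ => gradient φ (z.1 + z.2 • h)) :=
    hφ.continuous_gradient.comp (by fun_prop)
  have hpt : ∀ x, ‖φ (x + h) - φ x‖ₑ ^ p ≤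
      ‖h‖ₑ ^ p * ∫⁻ t in Set.Ioc (0 : ℝ) 1, ‖gradient φ (x + t • h)‖ₑ ^ p := by
    intro x
    have hc : Continuous (fun t : ℝ => gradient φ (x + t • h)) :=
      hφ.continuous_gradient.comp (by fun_prop)
    have hd : ∀ t : ℝ, HasDerivAt (fun t : ℝ => φ (x + t • h))
        (inner ℝ (gradient φ (x + t • h)) h) t := by
      intro t
      rw [inner_gradient]
      have h1 : HasDerivAt (fun t : ℝ => x + t • h) h t := by
        simpa using ((hasDerivAt_id t).smul_const h).const_add x
      exact (hφ.differentiable _).hasFDerivAt.comp_hasDerivAt t h1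
    have hftc := intervalIntegral.integral_eq_sub_of_hasDerivAt (a := 0) (b := 1)
      (fun t _ => hd t) ((hc.inner continuous_const).intervalIntegrable _ _)
    simp only [one_smul, zero_smul, add_zero] at hftc
    rw [intervalIntegral.integral_of_le zero_le_one] at hftc
    rw [← hftc]
    have h1 : ‖∫ t in Set.Ioc (0 : ℝ) 1, inner ℝ (gradient φ (x + t • h)) h‖ₑ ≤
        ‖h‖ₑ * ∫⁻ t in Set.Ioc (0 : ℝ) 1, ‖gradient φ (x + t • h)‖ₑ := by
      refine (enorm_integral_le_lintegral_enorm _).trans ?_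
      rw [← lintegral_const_mul'' _ hc.enorm.aemeasurable]
      refine lintegral_mono fun t => ?_
      rw [mul_comm, ← ofReal_norm, ← ofReal_norm, ← ofReal_norm,
        ← ENNReal.ofReal_mul (norm_nonneg _)]
      exact ENNReal.ofReal_le_ofReal (norm_inner_le_norm _ _)
    refine (ENNReal.rpow_le_rpow h1 hp0.le).trans ?_
    rw [ENNReal.mul_rpow_of_nonneg _ _ hp0.le]
    gcongr
    refine (lintegral_rpow_le hp hc.enorm.aemeasurable).trans ?_
    simp
  calc ∫⁻ x, ‖φ (x + h) - φ x‖ₑ ^ p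
      ≤ ∫⁻ x, ‖h‖ₑ ^ p * ∫⁻ t in Set.Ioc (0 : ℝ) 1, ‖gradient φ (x + t • h)‖ₑ ^ p :=
        lintegral_mono hpt
    _ = ‖h‖ₑ ^ p * ∫⁻ x, ∫⁻ t in Set.Ioc (0 : ℝ) 1, ‖gradient φ (x + t • h)‖ₑ ^ p := by
        refine lintegral_const_mul' _ _ (ENNReal.rpow_ne_top_of_nonneg hp0.le enorm_ne_top)
    _ = ‖h‖ₑ ^ p * ∫⁻ t in Set.Ioc (0 : ℝ) 1, ∫⁻ x, ‖gradient φ (x + t • h)‖ₑ ^ p := by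
        rw [lintegral_lintegral_swap]
        exact (hcont.enorm.measurable.pow_const p).aemeasurable
    _ = ‖h‖ₑ ^ p * ∫⁻ t in Set.Ioc (0 : ℝ) 1, ∫⁻ x, ‖gradient φ x‖ₑ ^ p := by
        congr 1
        refine lintegral_congr fun t => ?_
        exact lintegral_add_right_eq_self (fun x => ‖gradient φ x‖ₑ ^ p) (t • h)
    _ = _ := by simp

theorem enorm_sub_rpow_le (hp : 1 < p) {E : Type*} [NormedAddCommGroup E] (a b : E) :
    ‖a - b‖ₑ ^ p ≤ 2 ^ (p - 1) * (‖a‖ₑ ^ p + ‖b‖ₑ ^ p) :=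
  (ENNReal.rpow_le_rpow enorm_sub_le (by linarith)).trans
    (ENNReal.rpow_add_le_mul_rpow_add_rpow _ _ hp.le)

theorem IsTest.lintegral_translate_sub_le' (hp : 1 < p) {φ : Rn N → ℝ} (hφ : IsTest Ω φ)
    (h : Rn N) : ∫⁻ x, ‖φ (x + h) - φ x‖ₑ ^ p ≤ 2 ^ p * ∫⁻ x, ‖φ x‖ₑ ^ p := by
  have hm : Measurable (fun x => ‖φ x‖ₑ ^ p) := hφ.contDiff.continuous.enorm.measurable.pow_const p
  calc ∫⁻ x, ‖φ (x + h) - φ x‖ₑ ^ p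
      ≤ ∫⁻ x, 2 ^ (p - 1) * (‖φ (x + h)‖ₑ ^ p + ‖φ x‖ₑ ^ p) :=
        lintegral_mono fun x => enorm_sub_rpow_le hp _ _
    _ = 2 ^ (p - 1) * ((∫⁻ x, ‖φ (x + h)‖ₑ ^ p) + ∫⁻ x, ‖φ x‖ₑ ^ p) := by
        rw [lintegral_const_mul' _ _ (by simp), lintegral_add_right _ hm]
    _ = 2 ^ (p - 1) * (2 * ∫⁻ x, ‖φ x‖ₑ ^ p) := by
        rw [lintegral_add_right_eq_self (fun x => ‖φ x‖ₑ ^ p) h, two_mul]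
    _ = _ := by
        rw [← mul_assoc]
        congr 1
        nth_rewrite 2 [← ENNReal.rpow_one 2]
        rw [← ENNReal.rpow_add _ _ (by simp) (by simp)]
        ring_nf

/-- In polar coordinates the integrand behaves like `r ^ (p - 1 - ps)` near `0`, integrable because
`s < 1`, and like `r ^ (-1 - ps)` at infinity, integrable because `s > 0`. -/
theorem lintegral_kernel_lt_top (hN : 0 < N) (hp : 1 < p) (hs0 : 0 < s) (hs1 : s < 1) :
    ∫⁻ h : Rn N, ENNReal.ofReal ((‖h‖ ^ ((N : ℝ) + p * s))⁻¹ * min (‖h‖ ^ p) (2 ^ p)) < ⊤ := by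
  have hp0 : 0 < p := by linarith
  have : Nonempty (Fin N) := ⟨⟨0, hN⟩⟩
  have hint : Integrable (fun h : Rn N =>
      (fun r : ℝ => (r ^ ((N : ℝ) + p * s))⁻¹ * min (r ^ p) (2 ^ p)) ‖h‖) volume := by
    refine (integrable_fun_norm_addHaar volume
      (f := fun r : ℝ => (r ^ ((N : ℝ) + p * s))⁻¹ * min (r ^ p) (2 ^ p))).mpr ?_
    have hm : Measurable (fun y : ℝ => y ^ (Module.finrank ℝ (Rn N) - 1) •
        ((y ^ ((N : ℝ) + p * s))⁻¹ * min (y ^ p) (2 ^ p))) := by fun_prop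
    have hpow : ∀ y : ℝ, 0 < y → ∀ a : ℝ, y ^ (Module.finrank ℝ (Rn N) - 1) *
        ((y ^ ((N : ℝ) + p * s))⁻¹ * y ^ a) = y ^ (a - 1 - p * s) := by
      intro y hy a
      rw [← Real.rpow_natCast, ← Real.rpow_neg hy.le, ← Real.rpow_add hy, ← Real.rpow_add hy,
        finrank_euclideanSpace_fin, Nat.cast_sub hN]
      congr 1
      push_cast
      ring
    have hnn : ∀ y : ℝ, 0 < y → 0 ≤ y ^ (Module.finrank ℝ (Rn N) - 1) *
        ((y ^ ((N : ℝ) + p * s))⁻¹ * min (y ^ p) (2 ^ p)) := by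
      intro y hy; positivity
    rw [← Set.Ioc_union_Ioi_eq_Ioi zero_le_one]
    refine IntegrableOn.union ?_ ?_
    · have h1 : IntegrableOn (fun y : ℝ => y ^ (p - 1 - p * s)) (Set.Ioc 0 1) volume := by
        rw [← intervalIntegrable_iff_integrableOn_Ioc_of_le zero_le_one]
        refine intervalIntegral.intervalIntegrable_rpow' ?_
        nlinarith
      refine h1.mono' hm.aestronglyMeasurable ?_
      filter_upwards [ae_restrict_mem measurableSet_Ioc] with y hy
      rw [smul_eq_mul, Real.norm_of_nonneg (hnn y hy.1), ← hpow y hy.1]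
      have := hy.1
      gcongr
      exact min_le_left _ _
    · have h1 : IntegrableOn (fun y : ℝ => 2 ^ p * y ^ (0 - 1 - p * s)) (Set.Ioi 1) volume := by
        refine Integrable.const_mul (integrableOn_Ioi_rpow_of_lt ?_ one_pos) _
        nlinarith [mul_pos hp0 hs0]
      refine h1.mono' hm.aestronglyMeasurable ?_
      filter_upwards [ae_restrict_mem measurableSet_Ioi] with y hy
      have hy0 : 0 < y := lt_trans one_pos hy
      rw [smul_eq_mul, Real.norm_of_nonneg (hnn y hy0), ← hpow y hy0, Real.rpow_zero]
      have : min (y ^ p) (2 ^ p) ≤ 2 ^ p := min_le_right _ _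
      calc y ^ (Module.finrank ℝ (Rn N) - 1) *
            ((y ^ ((N : ℝ) + p * s))⁻¹ * min (y ^ p) (2 ^ p))
          ≤ y ^ (Module.finrank ℝ (Rn N) - 1) * ((y ^ ((N : ℝ) + p * s))⁻¹ * 2 ^ p) := by gcongr
        _ = _ := by ring
  exact hint.lintegral_lt_top

/-- After the substitution `x = y + h`, the integral over `y` is at most a multiple of `‖h‖ ^ p` by
the gradient estimate and of `2 ^ p` by the triangle inequality. The smaller of the two bounds is
integrable against the kernel. -/
theorem exists_lintegral_diff_test_le (hN : 0 < N) (hp : 1 < p) (hs0 : 0 < s) (hs1 : s < 1) :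
    ∃ K : NNReal, ∀ (Ω : Set (Rn N)) (φ : Rn N → ℝ), IsTest Ω φ →
      ∫⁻ z, ‖diff φ z‖ₑ ^ p ∂(gagliardo N s p) ≤
        K * ((∫⁻ x, ‖φ x‖ₑ ^ p) + ∫⁻ x, ‖gradient φ x‖ₑ ^ p) := by
  have hp0 : 0 < p := by linarith
  have hK := lintegral_kernel_lt_top hN hp hs0 hs1
  refine ⟨(∫⁻ h : Rn N, ENNReal.ofReal ((‖h‖ ^ ((N : ℝ) + p * s))⁻¹ *
    min (‖h‖ ^ p) (2 ^ p))).toNNReal, fun Ω φ hφ => ?_⟩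
  rw [ENNReal.coe_toNNReal hK.ne]
  have hc := hφ.contDiff.continuous
  have hdm : Measurable (fun z => ‖diff φ z‖ₑ ^ p) :=
    ((hc.comp continuous_fst).sub (hc.comp continuous_snd)).enorm.measurable.pow_const p
  set S := (∫⁻ x, ‖φ x‖ₑ ^ p) + ∫⁻ x, ‖gradient φ x‖ₑ ^ p with hS
  have hinner : ∀ h : Rn N, ∫⁻ y, ‖φ (y + h) - φ y‖ₑ ^ p ≤
      ENNReal.ofReal (min (‖h‖ ^ p) (2 ^ p)) * S := by
    intro h
    rcases min_choice (‖h‖ ^ p) (2 ^ p) with e | e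
    · rw [e, ← ENNReal.ofReal_rpow_of_nonneg (norm_nonneg _) hp0.le, ofReal_norm]
      exact (hφ.lintegral_translate_sub_le hp h).trans (by gcongr; exact le_add_self)
    · rw [e, ← ENNReal.ofReal_rpow_of_nonneg (by norm_num) hp0.le, ENNReal.ofReal_ofNat]
      exact (hφ.lintegral_translate_sub_le' hp h).trans (by gcongr; exact le_self_add)
  rw [lintegral_gagliardo hdm.aemeasurable,
    lintegral_prod_symm (fun z : Rn N × Rn N => ENNReal.ofReal ((‖z.1 - z.2‖ ^ ((N : ℝ) + p * s))⁻¹)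
      * ‖diff φ z‖ₑ ^ p) (measurable_kernel.mul hdm).aemeasurable]
  calc ∫⁻ y : Rn N, ∫⁻ x : Rn N,
        ENNReal.ofReal ((‖x - y‖ ^ ((N : ℝ) + p * s))⁻¹) * ‖diff φ (x, y)‖ₑ ^ p
      = ∫⁻ y : Rn N, ∫⁻ h : Rn N,
        ENNReal.ofReal ((‖h‖ ^ ((N : ℝ) + p * s))⁻¹) * ‖φ (y + h) - φ y‖ₑ ^ p := by
        refine lintegral_congr fun y => ?_
        rw [← lintegral_add_right_eq_self _ y]
        refine lintegral_congr fun h => ?_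
        rw [add_comm h y]
        simp only [diff, add_sub_cancel_left]
    _ = ∫⁻ h : Rn N, ∫⁻ y : Rn N,
        ENNReal.ofReal ((‖h‖ ^ ((N : ℝ) + p * s))⁻¹) * ‖φ (y + h) - φ y‖ₑ ^ p := by
        refine lintegral_lintegral_swap (Measurable.aemeasurable ?_)
        refine Measurable.mul (by fun_prop) (Measurable.pow_const (Measurable.enorm ?_) p)
        exact ((hc.comp (continuous_fst.add continuous_snd)).sub
          (hc.comp continuous_fst)).measurable
    _ ≤ ∫⁻ h : Rn N, ENNReal.ofReal ((‖h‖ ^ ((N : ℝ) + p * s))⁻¹ *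
        min (‖h‖ ^ p) (2 ^ p)) * S := by
        refine lintegral_mono fun h => ?_
        simp only
        rw [lintegral_const_mul' _ _ ENNReal.ofReal_ne_top, ENNReal.ofReal_mul (by positivity),
          mul_assoc]
        gcongr
        exact hinner h
    _ = _ := lintegral_mul_const _ (by fun_prop)

/-- Fatou's lemma carries the bound for test functions to the closure. -/
theorem exists_diff_memLp_energy_le (hN : 0 < N) (hp : 1 < p) (hs0 : 0 < s) (hs1 : s < 1) :
    ∃ K : ℝ, 0 ≤ K ∧ ∀ (Ω : Set (Rn N)) (u : Rn N → ℝ) (G : Rn N → Rn N), HasGradZero p Ω u G →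
      MemLp (diff u) (ENNReal.ofReal p) (gagliardo N s p) ∧
      energy p (gagliardo N s p) (diff u) ≤ K * (energy p volume u + energy p volume G) := by
  have hp0 : 0 < p := by linarith
  obtain ⟨K, hK⟩ := exists_lintegral_diff_test_le hN hp hs0 hs1
  refine ⟨K, K.2, fun Ω u G h => ?_⟩
  obtain ⟨φ', hφ', a1', a2'⟩ := h.approx
  obtain ⟨k, hk, hae⟩ := exists_subseq_tendsto_ae hp (fun n => (hφ' n).memLp _) h.memLp a1'
  have a1 := tendsto_energy hp (fun n => (hφ' (k n)).memLp _) h.memLp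
    (a1'.comp hk.tendsto_atTop)
  have a2 := tendsto_energy hp (fun n => (hφ' (k n)).memLp_gradient _) h.memLp_grad
    (a2'.comp hk.tendsto_atTop)
  have hum : AEStronglyMeasurable (diff u) (gagliardo N s p) :=
    (aestronglyMeasurable_diff h.memLp.1).mono_ac gagliardo_absolutelyContinuous
  have hae2 : ∀ᵐ z ∂(gagliardo N s p),
      Tendsto (fun n => diff (φ' (k n)) z) atTop (𝓝 (diff u z)) := by
    refine gagliardo_absolutelyContinuous.ae_le ?_
    have e1 := Measure.quasiMeasurePreserving_fst (μ := (volume : Measure (Rn N)))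
      (ν := (volume : Measure (Rn N))) |>.ae hae
    have e2 := Measure.quasiMeasurePreserving_snd (μ := (volume : Measure (Rn N)))
      (ν := (volume : Measure (Rn N))) |>.ae hae
    filter_upwards [e1, e2] with z h1 h2 using h1.sub h2
  have hb : ∫⁻ z, ‖diff u z‖ₑ ^ p ∂(gagliardo N s p) ≤
      ENNReal.ofReal (K * (energy p volume u + energy p volume G)) := by
    calc ∫⁻ z, ‖diff u z‖ₑ ^ p ∂(gagliardo N s p)
        = ∫⁻ z, liminf (fun n => ‖diff (φ' (k n)) z‖ₑ ^ p) atTop ∂(gagliardo N s p) := by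
          refine lintegral_congr_ae ?_
          filter_upwards [hae2] with z hz
          exact (((continuous_enorm.tendsto _).comp hz).ennrpow_const p).liminf_eq.symm
      _ ≤ liminf (fun n => ∫⁻ z, ‖diff (φ' (k n)) z‖ₑ ^ p ∂(gagliardo N s p)) atTop :=
          lintegral_liminf_le' fun n => ((aestronglyMeasurable_diff
            ((hφ' (k n)).memLp 1).1).mono_ac gagliardo_absolutelyContinuous).enorm.pow_const p
      _ ≤ liminf (fun n => ENNReal.ofReal (K * (energy p volume (φ' (k n)) +
            energy p volume (gradient (φ' (k n)))))) atTop := by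
          refine liminf_le_liminf (Eventually.of_forall fun n => ?_)
          refine (hK Ω _ (hφ' (k n))).trans (le_of_eq ?_)
          rw [ENNReal.ofReal_mul (NNReal.coe_nonneg K), ENNReal.ofReal_add (energy_nonneg _) (energy_nonneg _),
            ofReal_energy hp ((hφ' (k n)).memLp _), ofReal_energy hp ((hφ' (k n)).memLp_gradient _),
            ENNReal.ofReal_coe_nnreal]
      _ = _ := (ENNReal.tendsto_ofReal ((a1.add a2).const_mul _)).liminf_eq
  have hmem := memLp_of_lintegral_lt_top hp hum (hb.trans_lt ENNReal.ofReal_lt_top)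
  refine ⟨hmem, ?_⟩
  rw [← ofReal_energy hp hmem] at hb
  exact (ENNReal.ofReal_le_ofReal_iff
    (mul_nonneg K.2 (add_nonneg (energy_nonneg _) (energy_nonneg _)))).mp hb

end Gagliardo

/-! ### Compactness of the embedding into `L^p` -/

section Compactness

variable {N : ℕ} {s p : ℝ} {Ω : Set (Rn N)}

/-- The half-open cube of side `h` with lower corner `h k`. -/
def cube (h : ℝ) (k : Fin N → ℤ) : Set (Rn N) := {x | ∀ i, ⌊x i / h⌋ = k i}

theorem mem_cube_iff {h : ℝ} (hh : 0 < h) {k : Fin N → ℤ} {x : Rn N} :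
    x ∈ cube h k ↔ ∀ i, h * k i ≤ x i ∧ x i < h * (k i + 1) := by
  refine forall_congr' fun i => ?_
  rw [Int.floor_eq_iff, le_div_iff₀ hh, div_lt_iff₀ hh, mul_comm h, mul_comm h]

theorem volume_cube {h : ℝ} (hh : 0 < h) (k : Fin N → ℤ) :
    volume (cube h k) = ENNReal.ofReal (h ^ N) := by
  have e : cube h k = (WithLp.ofLp : Rn N → Fin N → ℝ) ⁻¹'
      (Set.univ.pi fun i => Set.Ico (h * k i) (h * (k i + 1))) := by
    ext x
    rw [mem_cube_iff hh]
    simp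
  rw [e, (PiLp.volume_preserving_ofLp (Fin N)).measure_preimage
    (MeasurableSet.univ_pi fun i => measurableSet_Ico).nullMeasurableSet, Real.volume_pi_Ico]
  simp only [mul_add, mul_one, add_sub_cancel_left, Finset.prod_const, Finset.card_univ,
    Fintype.card_fin]
  rw [ENNReal.ofReal_pow hh.le]

theorem measurableSet_cube (h : ℝ) (k : Fin N → ℤ) : MeasurableSet (cube h k) := by
  have : cube h k = ⋂ i, (fun x : Rn N => ⌊x i / h⌋) ⁻¹' {k i} := by
    ext x; simp [cube]
  rw [this]
  refine MeasurableSet.iInter fun i => measurableSet_preimage ?_ (measurableSet_singleton _)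
  fun_prop

theorem norm_sub_le_of_mem_cube {h : ℝ} (hh : 0 < h) {k : Fin N → ℤ} {x y : Rn N}
    (hx : x ∈ cube h k) (hy : y ∈ cube h k) : ‖x - y‖ ≤ h * √N := by
  rw [mem_cube_iff hh] at hx hy
  rw [EuclideanSpace.norm_eq]
  have h1 : ∑ i, ‖(x - y) i‖ ^ 2 ≤ h ^ 2 * N := by
    calc ∑ i, ‖(x - y) i‖ ^ 2 ≤ ∑ _i : Fin N, h ^ 2 := by
          refine Finset.sum_le_sum fun i _ => ?_
          gcongr
          rw [PiLp.sub_apply, Real.norm_eq_abs, abs_le]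
          have := hx i
          have := hy i
          constructor <;> linarith
      _ = h ^ 2 * N := by simp [mul_comm]
  calc √(∑ i, ‖(x - y) i‖ ^ 2) ≤ √(h ^ 2 * N) := Real.sqrt_le_sqrt h1
    _ = h * √N := by rw [Real.sqrt_mul (sq_nonneg h), Real.sqrt_sq hh.le]

/-- A Poincaré inequality on `Q` from the identity `μ(Q) w(x) = ∫_Q (w(x) - w(y)) dy + ∫_Q w`.
Multiplying by `μ(Q)` rather than dividing avoids assuming that it is nonzero. -/
theorem lintegral_rpow_le_of_mean (hp : 1 < p) {α : Type*} [MeasurableSpace α] {μ : Measure α}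
    [SFinite μ] {Q : Set α} (hQ : μ Q ≠ ⊤) {w : α → ℝ} (hw : AEStronglyMeasurable w μ)
    (hwQ : IntegrableOn w Q μ) :
    μ Q ^ p * ∫⁻ x in Q, ‖w x‖ₑ ^ p ∂μ ≤ 2 ^ (p - 1) *
      (μ Q ^ (p - 1) * (∫⁻ x in Q, ∫⁻ y in Q, ‖w x - w y‖ₑ ^ p ∂μ ∂μ) +
        μ Q * ‖∫ y in Q, w y ∂μ‖ₑ ^ p) := by
  have hp0 : 0 < p := by linarith
  have hm : AEMeasurable (fun z : α × α => ‖w z.1 - w z.2‖ₑ ^ p)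
      ((μ.restrict Q).prod (μ.restrict Q)) :=
    (hw.restrict.comp_fst.sub hw.restrict.comp_snd).enorm.pow_const p
  have hpt : ∀ x, μ Q ^ p * ‖w x‖ₑ ^ p ≤ 2 ^ (p - 1) *
      (μ Q ^ (p - 1) * (∫⁻ y in Q, ‖w x - w y‖ₑ ^ p ∂μ) + ‖∫ y in Q, w y ∂μ‖ₑ ^ p) := by
    intro x
    have hc : IntegrableOn (fun _ => w x) Q μ := integrableOn_const hQ
    have e1 : μ.real Q * w x = (∫ y in Q, (w x - w y) ∂μ) + ∫ y in Q, w y ∂μ := by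
      rw [integral_sub hc hwQ]
      simp
    have e2 : μ Q ^ p * ‖w x‖ₑ ^ p = ‖μ.real Q * w x‖ₑ ^ p := by
      rw [enorm_mul, ENNReal.mul_rpow_of_nonneg _ _ hp0.le,
        Real.enorm_of_nonneg measureReal_nonneg, ofReal_measureReal hQ]
    rw [e2, e1]
    refine (ENNReal.rpow_le_rpow (enorm_add_le _ _) hp0.le).trans
      ((ENNReal.rpow_add_le_mul_rpow_add_rpow _ _ hp.le).trans ?_)
    gcongr
    refine (ENNReal.rpow_le_rpow (enorm_integral_le_lintegral_enorm _) hp0.le).trans ?_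
    have hm' : AEStronglyMeasurable (fun y => w x - w y) (μ.restrict Q) :=
      aestronglyMeasurable_const.sub hw.restrict
    refine (lintegral_rpow_le hp hm'.enorm).trans ?_
    rw [Measure.restrict_apply_univ]
  have hQp : μ Q ^ p ≠ ⊤ := ENNReal.rpow_ne_top_of_nonneg hp0.le hQ
  have hQp1 : μ Q ^ (p - 1) ≠ ⊤ := ENNReal.rpow_ne_top_of_nonneg (by linarith) hQ
  calc μ Q ^ p * ∫⁻ x in Q, ‖w x‖ₑ ^ p ∂μ = ∫⁻ x in Q, μ Q ^ p * ‖w x‖ₑ ^ p ∂μ :=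
        (lintegral_const_mul' _ _ hQp).symm
    _ ≤ ∫⁻ x in Q, 2 ^ (p - 1) * (μ Q ^ (p - 1) * (∫⁻ y in Q, ‖w x - w y‖ₑ ^ p ∂μ) +
          ‖∫ y in Q, w y ∂μ‖ₑ ^ p) ∂μ := lintegral_mono hpt
    _ = _ := by
      rw [lintegral_const_mul' _ _ (by simp), lintegral_add_right _ measurable_const,
        lintegral_const_mul' _ _ hQp1, lintegral_const, Measure.restrict_apply_univ,
        mul_comm (μ Q) (‖_‖ₑ ^ p)]

/-- Two points of the cube are at distance at most `h√N`, which bounds the kernel from below; on the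
diagonal the difference vanishes. -/
theorem lintegral_cube_le (hp : 1 < p) (hs0 : 0 < s) {h : ℝ} (hh : 0 < h) (k : Fin N → ℤ)
    {w : Rn N → ℝ} (hw : AEStronglyMeasurable w volume) :
    ∫⁻ x in cube h k, ∫⁻ y in cube h k, ‖w x - w y‖ₑ ^ p ≤
      ENNReal.ofReal ((h * √N) ^ ((N : ℝ) + p * s)) *
        ∫⁻ z in cube h k ×ˢ cube h k, ‖diff w z‖ₑ ^ p ∂(gagliardo N s p) := by
  have hp0 : 0 < p := by linarith
  have hQ := measurableSet_cube h k
  have hdm : AEMeasurable (fun z => ‖diff w z‖ₑ ^ p)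
      ((volume : Measure (Rn N)).prod volume) := (aestronglyMeasurable_diff hw).enorm.pow_const p
  have hdm' : AEMeasurable (fun z => ‖diff w z‖ₑ ^ p)
      ((volume.restrict (cube h k)).prod (volume.restrict (cube h k))) := by
    rw [Measure.prod_restrict]; exact hdm.restrict
  refine (le_of_eq (lintegral_prod (fun z : Rn N × Rn N => ‖diff w z‖ₑ ^ p) hdm').symm).trans ?_
  rw [Measure.prod_restrict, gagliardo, restrict_withDensity (hQ.prod hQ),
    lintegral_withDensity_eq_lintegral_mul₀ measurable_kernel.aemeasurable
      (by exact hdm.restrict), ← lintegral_const_mul' _ _ ENNReal.ofReal_ne_top]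
  refine setLIntegral_mono' (hQ.prod hQ) fun z hz => ?_
  rcases eq_or_ne z.1 z.2 with e | e
  · simp [diff, e, ENNReal.zero_rpow_of_pos hp0]
  · have hpos : 0 < ‖z.1 - z.2‖ := norm_pos_iff.mpr (sub_ne_zero.mpr e)
    rw [Pi.mul_apply, ← mul_assoc, ← ENNReal.ofReal_mul (by positivity)]
    have : (1 : ENNReal) ≤ ENNReal.ofReal ((h * √N) ^ ((N : ℝ) + p * s) *
        (‖z.1 - z.2‖ ^ ((N : ℝ) + p * s))⁻¹) := by
      rw [← ENNReal.ofReal_one]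
      refine ENNReal.ofReal_le_ofReal ?_
      rw [← div_eq_mul_inv, one_le_div (by positivity)]
      exact Real.rpow_le_rpow hpos.le (norm_sub_le_of_mem_cube hh hz.1 hz.2) (by positivity)
    exact le_mul_of_one_le_left' this

theorem exists_cube_finset (hΩ : Bornology.IsBounded Ω) {h : ℝ} (hh : 0 < h) :
    ∃ S : Finset (Fin N → ℤ), ∀ x ∈ Ω, ∃ k ∈ S, x ∈ cube h k := by
  obtain ⟨R, hR⟩ := hΩ.exists_norm_le
  refine ⟨Fintype.piFinset fun _ => Finset.Icc ⌊-R / h⌋ ⌊R / h⌋, fun x hx =>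
    ⟨fun i => ⌊x i / h⌋, ?_, fun i => rfl⟩⟩
  rw [Fintype.mem_piFinset]
  intro i
  have h1 : |x i| ≤ R := by
    have := PiLp.norm_apply_le x i
    rw [Real.norm_eq_abs] at this
    exact this.trans (hR x hx)
  rw [abs_le] at h1
  rw [Finset.mem_Icc]
  exact ⟨Int.floor_le_floor (by gcongr; exact h1.1), Int.floor_le_floor (by gcongr; exact h1.2)⟩

theorem disjoint_cube (h : ℝ) {k l : Fin N → ℤ} (hkl : k ≠ l) : Disjoint (cube h k) (cube h l) := by
  rw [Set.disjoint_left]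
  intro x hx hx'
  exact hkl (funext fun i => (hx i).symm.trans (hx' i))

theorem energy_le_gagliardo_add_means (hp : 1 < p) (hs0 : 0 < s) (hN : 0 < N) {h : ℝ} (hh : 0 < h)
    {S : Finset (Fin N → ℤ)} (hS : ∀ x ∈ Ω, ∃ k ∈ S, x ∈ cube h k)
    {w : Rn N → ℝ} (hw : MemLp w (ENNReal.ofReal p) volume) (hz : ∀ᵐ x, x ∉ Ω → w x = 0)
    (hd : MemLp (diff w) (ENNReal.ofReal p) (gagliardo N s p)) :
    energy p volume w ≤ 2 ^ (p - 1) * ((h ^ N)⁻¹ * (h * √N) ^ ((N : ℝ) + p * s) *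
      energy p (gagliardo N s p) (diff w) +
        (h ^ N) ^ (1 - p) * ∑ k ∈ S, |∫ x in cube h k, w x| ^ p) := by
  have hp0 : 0 < p := by linarith
  set v : ℝ := h ^ N with hv
  have hv0 : 0 < v := by positivity
  set c : ℝ := (h * √N) ^ ((N : ℝ) + p * s) with hc
  have hc0 : 0 ≤ c := by positivity
  have hvol : ∀ k : Fin N → ℤ, volume (cube h k) = ENNReal.ofReal v := volume_cube hh
  have hdisj : (S : Set (Fin N → ℤ)).PairwiseDisjoint (cube h) := fun k _ l _ hkl =>
    disjoint_cube h hkl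
  have hdisj2 : (S : Set (Fin N → ℤ)).PairwiseDisjoint (fun k => cube h k ×ˢ cube h k) :=
    fun k _ l _ hkl => Set.disjoint_prod.mpr (Or.inl (disjoint_cube h hkl))
  have e1 : ∫⁻ x, ‖w x‖ₑ ^ p = ∑ k ∈ S, ∫⁻ x in cube h k, ‖w x‖ₑ ^ p := by
    rw [← lintegral_biUnion_finset hdisj (fun k _ => measurableSet_cube h k),
      ← lintegral_indicator (Finset.measurableSet_biUnion _ fun k _ => measurableSet_cube h k)]
    refine lintegral_congr_ae ?_
    filter_upwards [hz] with x hx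
    by_cases hxS : x ∈ ⋃ k ∈ S, cube h k
    · rw [Set.indicator_of_mem hxS]
    · rw [Set.indicator_of_notMem hxS, hx fun hxΩ => hxS ?_, enorm_zero,
        ENNReal.zero_rpow_of_pos hp0]
      obtain ⟨k, hk, hxk⟩ := hS x hxΩ
      simp only [Set.mem_iUnion]
      exact ⟨k, hk, hxk⟩
  have e2 : ∑ k ∈ S, ∫⁻ z in cube h k ×ˢ cube h k, ‖diff w z‖ₑ ^ p ∂(gagliardo N s p) ≤
      ∫⁻ z, ‖diff w z‖ₑ ^ p ∂(gagliardo N s p) := by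
    rw [← lintegral_biUnion_finset hdisj2
      (fun k _ => (measurableSet_cube h k).prod (measurableSet_cube h k))]
    exact lintegral_mono' Measure.restrict_le_self le_rfl
  have hone : (1 : ENNReal) ≤ ENNReal.ofReal p := (fact_one_le hp).out
  have key : ENNReal.ofReal v ^ p * ∫⁻ x, ‖w x‖ₑ ^ p ≤ 2 ^ (p - 1) *
      (ENNReal.ofReal v ^ (p - 1) * (ENNReal.ofReal c *
        ∫⁻ z, ‖diff w z‖ₑ ^ p ∂(gagliardo N s p)) +
        ENNReal.ofReal v * ∑ k ∈ S, ‖∫ x in cube h k, w x‖ₑ ^ p) := by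
    calc ENNReal.ofReal v ^ p * ∫⁻ x, ‖w x‖ₑ ^ p
        = ∑ k ∈ S, ENNReal.ofReal v ^ p * ∫⁻ x in cube h k, ‖w x‖ₑ ^ p := by
          rw [e1, Finset.mul_sum]
      _ ≤ ∑ k ∈ S, 2 ^ (p - 1) * (ENNReal.ofReal v ^ (p - 1) * (ENNReal.ofReal c *
            ∫⁻ z in cube h k ×ˢ cube h k, ‖diff w z‖ₑ ^ p ∂(gagliardo N s p)) +
            ENNReal.ofReal v * ‖∫ x in cube h k, w x‖ₑ ^ p) := by
          refine Finset.sum_le_sum fun k _ => ?_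
          have hfin : volume (cube h k) ≠ ⊤ := by rw [hvol]; exact ENNReal.ofReal_ne_top
          have : IsFiniteMeasure (volume.restrict (cube h k)) := ⟨by simpa using hfin.lt_top⟩
          have := lintegral_rpow_le_of_mean hp hfin hw.1 ((hw.restrict _).integrable hone)
          rw [hvol] at this
          refine this.trans ?_
          gcongr
          exact lintegral_cube_le hp hs0 hh k hw.1
      _ = 2 ^ (p - 1) * (ENNReal.ofReal v ^ (p - 1) * (ENNReal.ofReal c *
            ∑ k ∈ S, ∫⁻ z in cube h k ×ˢ cube h k, ‖diff w z‖ₑ ^ p ∂(gagliardo N s p)) +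
            ENNReal.ofReal v * ∑ k ∈ S, ‖∫ x in cube h k, w x‖ₑ ^ p) := by
          rw [← Finset.mul_sum, Finset.sum_add_distrib, ← Finset.mul_sum, ← Finset.mul_sum,
            ← Finset.mul_sum]
      _ ≤ _ := by gcongr
  have e3 : ∑ k ∈ S, ‖∫ x in cube h k, w x‖ₑ ^ p =
      ENNReal.ofReal (∑ k ∈ S, |∫ x in cube h k, w x| ^ p) := by
    rw [ENNReal.ofReal_sum_of_nonneg fun k _ => by positivity]
    refine Finset.sum_congr rfl fun k _ => ?_
    rw [← ENNReal.ofReal_rpow_of_nonneg (abs_nonneg _) hp0.le, ← Real.norm_eq_abs, ofReal_norm]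
  have h2p : (2 : ENNReal) ^ (p - 1) = ENNReal.ofReal (2 ^ (p - 1)) := by
    rw [← ENNReal.ofReal_rpow_of_pos (by norm_num), ENNReal.ofReal_ofNat]
  have hEn := energy_nonneg (p := p) (μ := gagliardo N s p) (diff w)
  have hSn : 0 ≤ ∑ k ∈ S, |∫ x in cube h k, w x| ^ p :=
    Finset.sum_nonneg fun k _ => by positivity
  rw [e3, ← ofReal_energy hp hw, ← ofReal_energy hp hd, ENNReal.ofReal_rpow_of_pos hv0,
    ENNReal.ofReal_rpow_of_pos hv0, h2p, ← ENNReal.ofReal_mul (by positivity),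
    ← ENNReal.ofReal_mul hc0, ← ENNReal.ofReal_mul (by positivity),
    ← ENNReal.ofReal_mul (by positivity), ← ENNReal.ofReal_add (by positivity) (by positivity),
    ← ENNReal.ofReal_mul (by positivity), ENNReal.ofReal_le_ofReal_iff (by positivity)] at key
  have h1 := mul_le_mul_of_nonneg_left key (Real.rpow_nonneg hv0.le (-p))
  rw [← mul_assoc, ← Real.rpow_add hv0, neg_add_cancel, Real.rpow_zero, one_mul] at h1
  refine h1.trans (le_of_eq ?_)
  have a1 : v ^ (-p) * v ^ (p - 1) = v⁻¹ := by
    rw [← Real.rpow_add hv0, ← Real.rpow_neg_one]; congr 1; ring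
  have a2 : v ^ (-p) * v = v ^ (1 - p) := by
    rw [← Real.rpow_add_one hv0.ne']; congr 1; ring
  rw [← a1, ← a2]
  ring

/-- The compactness estimate: up to a small multiple of the seminorm, the `L^p` energy is controlled
by finitely many linear functionals. The cube volume contributes `h ^ (-N)` and the kernel `h ^ (N +
ps)`, so the coefficient of the seminorm is of order `h ^ (ps)`, small for a fine mesh. -/
theorem exists_energy_le_means (hp : 1 < p) (hs0 : 0 < s) (hN : 0 < N)
    (hΩ : Bornology.IsBounded Ω) {ε : ℝ} (hε : 0 < ε) :
    ∃ (S : Finset (Fin N → ℤ)) (h : ℝ) (C : ℝ), 0 < h ∧ 0 ≤ C ∧ ∀ w : Rn N → ℝ,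
      MemLp w (ENNReal.ofReal p) volume → (∀ᵐ x, x ∉ Ω → w x = 0) →
      MemLp (diff w) (ENNReal.ofReal p) (gagliardo N s p) →
      energy p volume w ≤ ε * energy p (gagliardo N s p) (diff w) +
        C * ∑ k ∈ S, |∫ x in cube h k, w x| ^ p := by
  have hp0 : 0 < p := by linarith
  have hlim : Tendsto (fun h : ℝ => 2 ^ (p - 1) * √N ^ ((N : ℝ) + p * s) * h ^ (p * s))
      (𝓝[>] 0) (𝓝 0) := by
    have h1 : Tendsto (fun h : ℝ => h ^ (p * s)) (𝓝[>] 0) (𝓝 0) := by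
      have := (Real.continuousAt_rpow_const 0 (p * s) (Or.inr (by positivity))).tendsto
      rw [Real.zero_rpow (by positivity)] at this
      exact this.mono_left nhdsWithin_le_nhds
    simpa using h1.const_mul (2 ^ (p - 1) * √N ^ ((N : ℝ) + p * s))
  obtain ⟨h, hh1, hh⟩ := ((hlim.eventually (ge_mem_nhds hε)).and self_mem_nhdsWithin).exists
  have hh0 : 0 < h := hh
  obtain ⟨S, hS⟩ := exists_cube_finset hΩ hh0
  refine ⟨S, h, 2 ^ (p - 1) * (h ^ N) ^ (1 - p), hh0, by positivity, fun w hw hz hd => ?_⟩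
  refine (energy_le_gagliardo_add_means hp hs0 hN hh0 hS hw hz hd).trans ?_
  have e : 2 ^ (p - 1) * ((h ^ N)⁻¹ * (h * √N) ^ ((N : ℝ) + p * s)) =
      2 ^ (p - 1) * √N ^ ((N : ℝ) + p * s) * h ^ (p * s) := by
    rw [Real.mul_rpow hh0.le (Real.sqrt_nonneg _), Real.rpow_add hh0, Real.rpow_natCast]
    field_simp
  rw [mul_add, ← mul_assoc, e, ← mul_assoc (2 ^ (p - 1))]
  have := energy_nonneg (p := p) (μ := gagliardo N s p) (diff w)
  gcongr

/-- Bounded sequences have subsequences that are Cauchy in `L^p`. -/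
theorem exists_subseq_energy_cauchy (hp : 1 < p) (hpN : p < N) (hs0 : 0 < s) (hs1 : s < 1)
    (hΩ : Bornology.IsBounded Ω) {u : ℕ → Rn N → ℝ} {G : ℕ → Rn N → Rn N}
    (h : ∀ n, HasGradZero p Ω (u n) (G n)) {M : ℝ} (hM : ∀ n, energy p volume (G n) ≤ M) :
    ∃ k : ℕ → ℕ, StrictMono k ∧ Tendsto (fun n : ℕ × ℕ =>
      energy p volume (fun x => u (k n.1) x - u (k n.2) x)) atTop (𝓝 0) := by
  have hp0 : 0 < p := by linarith
  have hN : 0 < N := by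
    have : (0 : ℝ) < N := by linarith
    exact_mod_cast this
  have hvolΩ : volume Ω ≠ ⊤ := hΩ.measure_lt_top.ne
  have hM0 : 0 ≤ M := (energy_nonneg _).trans (hM 0)
  obtain ⟨C₁, hC₁, hpoin⟩ := exists_energy_le_energy_grad (N := N) (p := p) hp hpN hvolΩ
  obtain ⟨K, hK, hgag⟩ := exists_diff_memLp_energy_le (s := s) hN hp hs0 hs1
  have hone : (1 : ENNReal) ≤ ENNReal.ofReal p := (fact_one_le hp).out
  choose S l C hl hC hmeans using fun n : ℕ =>
    exists_energy_le_means (s := s) (p := p) hp hs0 hN hΩ (ε := 1 / ((n : ℝ) + 1)) (by positivity)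
  have hint : ∀ (m : ℕ) (κ : Fin N → ℤ) (w : Rn N → ℝ), MemLp w (ENNReal.ofReal p) volume →
      IntegrableOn w (cube (l m) κ) volume := by
    intro m κ w hw
    have : IsFiniteMeasure (volume.restrict (cube (l m) κ)) := ⟨by
      simpa using (volume_cube (hl m) κ).trans_lt ENNReal.ofReal_lt_top⟩
    exact (hw.restrict _).integrable hone
  have hub : ∀ n, energy p volume (u n) ≤ C₁ * M := fun n =>
    (hpoin _ _ (h n)).trans (by gcongr; exact hM n)
  -- Integrals over all cubes of all mesh sizes at once. Each is bounded in `n`, so compactness of a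
  -- product of intervals yields one subsequence along which all of them converge.
  let a : ℕ → (ℕ × (Fin N → ℤ)) → ℝ := fun n i => ∫ x in cube (l i.1) i.2, u n x
  have ha : ∀ n i, a n i ∈ Set.Icc (-((l i.1) ^ N + C₁ * M)) ((l i.1) ^ N + C₁ * M) := by
    intro n i
    rw [Set.mem_Icc, ← abs_le, ← Real.norm_eq_abs]
    have hfin : volume (cube (l i.1) i.2) ≠ ⊤ := by
      rw [volume_cube (hl _)]; exact ENNReal.ofReal_ne_top
    have hi := integrable_norm_rpow_ofReal hp (h n).memLp
    have hi' : Integrable (fun x => ‖u n x‖ ^ p) (volume.restrict (cube (l i.1) i.2)) :=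
      hi.integrableOn
    have hc : Integrable (fun _ => (1 : ℝ)) (volume.restrict (cube (l i.1) i.2)) :=
      integrableOn_const hfin
    calc ‖a n i‖ ≤ ∫ x in cube (l i.1) i.2, ‖u n x‖ := norm_integral_le_integral_norm _
      _ ≤ ∫ x in cube (l i.1) i.2, (1 + ‖u n x‖ ^ p) := by
          refine integral_mono (hint _ _ _ (h n).memLp).norm
            (hc.add hi') fun x => ?_
          have := rpow_sub_one_mul_le hp zero_le_one (norm_nonneg (u n x))
          simpa using this
      _ = (l i.1) ^ N + ∫ x in cube (l i.1) i.2, ‖u n x‖ ^ p := by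
          rw [integral_add hc hi']
          simp [Measure.real, volume_cube (hl _), ENNReal.toReal_ofReal (pow_nonneg (hl i.1).le N)]
      _ ≤ (l i.1) ^ N + C₁ * M := by
          gcongr
          exact (setIntegral_le_integral hi (Eventually.of_forall fun _ => by positivity)).trans
            (hub n)
  obtain ⟨b, -, k, hk, hb⟩ := (isCompact_univ_pi fun i : ℕ × (Fin N → ℤ) =>
    isCompact_Icc (a := -((l i.1) ^ N + C₁ * M)) (b := (l i.1) ^ N + C₁ * M)).tendsto_subseq
    (x := a) (fun n i _ => ha n i)
  rw [tendsto_pi_nhds] at hb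
  refine ⟨k, hk, ?_⟩
  -- `B` bounds the Gagliardo energy of every difference of two terms, through the embedding
  -- constant `K`, the Poincaré constant `C₁` and the quasi-triangle constant `2 ^ p`.
  set B : ℝ := K * ((C₁ + 1) * (2 ^ p * (M + M))) with hB
  have hB0 : 0 ≤ B := by positivity
  have hbound : ∀ (m : ℕ) (n : ℕ × ℕ), energy p volume (fun x => u (k n.1) x - u (k n.2) x) ≤
      1 / ((m : ℝ) + 1) * B + C m * ∑ κ ∈ S m, |a (k n.1) (m, κ) - a (k n.2) (m, κ)| ^ p := by
    intro m n
    have hw := (h (k n.1)).sub hp (h (k n.2))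
    obtain ⟨hd, hg⟩ := hgag Ω _ _ hw
    refine (hmeans m _ hw.memLp ((hw.ae_eq_zero hp).mono fun x hx hxΩ => (hx hxΩ).1) hd).trans ?_
    refine add_le_add ?_ (le_of_eq ?_)
    · gcongr
      refine hg.trans ?_
      have h1 := hpoin _ _ hw
      have h2 := energy_sub_le hp (h (k n.1)).memLp_grad (h (k n.2)).memLp_grad
      have h3 : (2 : ℝ) ^ p * (energy p volume (G (k n.1)) + energy p volume (G (k n.2))) ≤
          2 ^ p * (M + M) := by gcongr <;> exact hM _
      calc K * (energy p volume (fun x => u (k n.1) x - u (k n.2) x) +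
            energy p volume (fun x => G (k n.1) x - G (k n.2) x))
          ≤ K * ((C₁ + 1) * energy p volume (fun x => G (k n.1) x - G (k n.2) x)) := by
            gcongr; linarith
        _ ≤ B := by
            rw [hB]
            gcongr
            exact h2.trans h3
    · congr 1
      refine Finset.sum_congr rfl fun κ _ => ?_
      simp only [a]
      rw [integral_sub (hint _ _ _ (h _).memLp) (hint _ _ _ (h _).memLp)]
  have hmean : ∀ m, Tendsto (fun n : ℕ × ℕ => C m * ∑ κ ∈ S m,
      |a (k n.1) (m, κ) - a (k n.2) (m, κ)| ^ p) atTop (𝓝 0) := by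
    intro m
    rw [← mul_zero (C m), ← Finset.sum_const_zero (s := S m)]
    refine Tendsto.const_mul _ (tendsto_finsetSum _ fun κ _ => ?_)
    rw [← prod_atTop_atTop_eq]
    have h1 := ((hb (m, κ)).comp (tendsto_fst (f := atTop) (g := (atTop : Filter ℕ)))).sub
      ((hb (m, κ)).comp (tendsto_snd (f := (atTop : Filter ℕ)) (g := atTop)))
    rw [sub_self] at h1
    have h2 := h1.abs.rpow_const (p := p) (Or.inr hp0.le)
    rw [abs_zero, Real.zero_rpow hp0.ne'] at h2
    exact h2
  rw [Metric.tendsto_nhds]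
  intro η hη
  -- The mesh is fixed first, to make the seminorm term small; only then do the finitely many cube
  -- integrals become small. Dividing by `B + 1` covers `B = 0`.
  obtain ⟨m, hm⟩ := exists_nat_one_div_lt (show 0 < η / (2 * (B + 1)) by positivity)
  have hm' : 1 / ((m : ℝ) + 1) * B ≤ η / 2 := by
    calc 1 / ((m : ℝ) + 1) * B ≤ η / (2 * (B + 1)) * (B + 1) := by gcongr; linarith
      _ = η / 2 := by field_simp
  filter_upwards [(hmean m).eventually (gt_mem_nhds (show 0 < η / 2 by positivity))] with n hn
  rw [Real.dist_eq, sub_zero, abs_of_nonneg (energy_nonneg _)]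
  linarith [hbound m n]

end Compactness

/-! ### Existence of a minimizer of the Rayleigh quotient -/

section Minimizer

variable {N : ℕ} {s p q : ℝ} {Ω : Set (Rn N)} {V g : Rn N → ℝ}

/-- The standing assumptions on the exponents, the domain and the weights. -/
structure Setting (s p q : ℝ) (Ω : Set (Rn N)) (V g : Rn N → ℝ) : Prop where
  s_pos : 0 < s
  s_lt_one : s < 1
  one_lt : 1 < p
  lt_dim : p < N
  le_exponent : N / p ≤ q
  isOpen : IsOpen Ω
  isBounded : Bornology.IsBounded Ω
  memLp_potential : MemLp V (ENNReal.ofReal q) (volume.restrict Ω)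
  memLp_weight : MemLp g (ENNReal.ofReal q) (volume.restrict Ω)
  potential_nonneg : ∀ᵐ x ∂(volume.restrict Ω), 0 ≤ V x
  weight_pos : ∀ᵐ x ∂(volume.restrict Ω), 0 < g x

/-- The energy `∫|∇u|^p + [u]_{s,p}^p + ∫ V|u|^p`. -/
noncomputable def totalEnergy (s p : ℝ) (Ω : Set (Rn N)) (V : Rn N → ℝ) (u : Rn N → ℝ)
    (G : Rn N → Rn N) : ℝ :=
  energy p volume G + energy p (gagliardo N s p) (diff u) + energy p (weighted Ω V) u

/-- The first variation of the energy. -/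
noncomputable def totalPairing (s p : ℝ) (Ω : Set (Rn N)) (V : Rn N → ℝ) (u : Rn N → ℝ)
    (G : Rn N → Rn N) (v : Rn N → ℝ) (H : Rn N → Rn N) : ℝ :=
  pairing p volume G H + pairing p (gagliardo N s p) (diff u) (diff v) +
    pairing p (weighted Ω V) u v

theorem diff_add (u v : Rn N → ℝ) :
    diff (fun x => u x + v x) = fun z => diff u z + diff v z := by
  ext z; simp only [diff]; ring

theorem diff_sub (u v : Rn N → ℝ) :
    diff (fun x => u x - v x) = fun z => diff u z - diff v z := by
  ext z; simp only [diff]; ring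

theorem diff_smul (c : ℝ) (u : Rn N → ℝ) :
    diff (fun x => c • u x) = fun z => c • diff u z := by
  ext z; simp only [diff, smul_eq_mul]; ring

namespace Setting

theorem dim_pos (S : Setting s p q Ω V g) : 0 < N := by
  have h1 := S.one_lt
  have h2 := S.lt_dim
  have : (0 : ℝ) < N := by linarith
  exact_mod_cast this

theorem p_pos (S : Setting s p q Ω V g) : 0 < p := by linarith [S.one_lt]

theorem volume_ne_top (S : Setting s p q Ω V g) : volume Ω ≠ ⊤ := S.isBounded.measure_lt_top.ne

variable {u v : Rn N → ℝ} {G H : Rn N → Rn N}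

theorem memLp_diff (S : Setting s p q Ω V g) (h : HasGradZero p Ω u G) :
    MemLp (diff u) (ENNReal.ofReal p) (gagliardo N s p) := by
  obtain ⟨K, -, hK⟩ := exists_diff_memLp_energy_le S.dim_pos S.one_lt S.s_pos S.s_lt_one
  exact (hK _ _ _ h).1

theorem memLp_V (S : Setting s p q Ω V g) (h : HasGradZero p Ω u G) :
    MemLp u (ENNReal.ofReal p) (weighted Ω V) :=
  h.memLp_weighted S.one_lt S.lt_dim S.volume_ne_top S.le_exponent S.memLp_potential

theorem memLp_g (S : Setting s p q Ω V g) (h : HasGradZero p Ω u G) :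
    MemLp u (ENNReal.ofReal p) (weighted Ω g) :=
  h.memLp_weighted S.one_lt S.lt_dim S.volume_ne_top S.le_exponent S.memLp_weight

theorem exists_bound (S : Setting s p q Ω V g) : ∃ C : ℝ, 0 ≤ C ∧
    ∀ (u : Rn N → ℝ) (G : Rn N → Rn N), HasGradZero p Ω u G →
      energy p volume u ≤ C * energy p volume G ∧
      energy p (gagliardo N s p) (diff u) ≤ C * energy p volume G ∧
      energy p (weighted Ω V) u ≤ C * energy p volume G ∧
      energy p (weighted Ω g) u ≤ C * energy p volume G := by
  obtain ⟨K, hK, h1⟩ := exists_diff_memLp_energy_le S.dim_pos S.one_lt S.s_pos S.s_lt_one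
  obtain ⟨C₁, hC₁, h2⟩ := exists_energy_le_energy_grad (Ω := Ω) S.one_lt S.lt_dim S.volume_ne_top
  obtain ⟨C₂, hC₂, h3⟩ := exists_energy_weighted_le S.one_lt S.lt_dim S.volume_ne_top
    S.le_exponent S.memLp_potential
  obtain ⟨C₃, hC₃, h4⟩ := exists_energy_weighted_le S.one_lt S.lt_dim S.volume_ne_top
    S.le_exponent S.memLp_weight
  have hKC : 0 ≤ K * (C₁ + 1) := by positivity
  refine ⟨C₁ + K * (C₁ + 1) + C₂ + C₃, by positivity, fun u G h => ?_⟩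
  have hE := energy_nonneg (p := p) (μ := volume) G
  have a2 := h2 u G h
  have a3 := h3 u G h
  have a4 := h4 u G h
  have a1 : energy p (gagliardo N s p) (diff u) ≤ K * (C₁ + 1) * energy p volume G :=
    calc _ ≤ K * (energy p volume u + energy p volume G) := (h1 Ω u G h).2
      _ ≤ K * (C₁ * energy p volume G + energy p volume G) := by gcongr
      _ = _ := by ring
  have b1 := mul_nonneg hC₁ hE
  have b2 := mul_nonneg hKC hE
  have b3 := mul_nonneg hC₂ hE
  have b4 := mul_nonneg hC₃ hE
  simp only [add_mul]
  refine ⟨?_, ?_, ?_, ?_⟩ <;> linarith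

theorem totalEnergy_nonneg : 0 ≤ totalEnergy s p Ω V u G :=
  add_nonneg (add_nonneg (energy_nonneg _) (energy_nonneg _)) (energy_nonneg _)

theorem totalEnergy_smul (c : ℝ) :
    totalEnergy s p Ω V (fun x => c • u x) (fun x => c • G x) =
      |c| ^ p * totalEnergy s p Ω V u G := by
  simp only [totalEnergy]
  rw [diff_smul, energy_smul, energy_smul, energy_smul]
  ring

/-- The seminorm and the potential term are also midpoint convex, so the convexity defect of the
gradient term is at most that of the whole energy. -/
theorem energy_midpoint_grad_le (S : Setting s p q Ω V g) (h : HasGradZero p Ω u G)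
    (h' : HasGradZero p Ω v H) :
    (energy p volume G + energy p volume H) / 2 -
        energy p volume (fun x => (1 / 2 : ℝ) • (G x + H x)) ≤
      (totalEnergy s p Ω V u G + totalEnergy s p Ω V v H) / 2 -
        totalEnergy s p Ω V (fun x => (1 / 2 : ℝ) • (u x + v x))
          (fun x => (1 / 2 : ℝ) • (G x + H x)) := by
  have h1 := energy_midpoint_le S.one_lt (S.memLp_diff h) (S.memLp_diff h')
  have h2 := energy_midpoint_le S.one_lt (S.memLp_V h) (S.memLp_V h')
  simp only [totalEnergy]
  rw [diff_smul, diff_add]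
  linarith

/-- The direct method with strong convergence. Compactness makes a normalized minimizing sequence
Cauchy for the weight `g`, so midpoints of late terms are almost normalized and have energy almost
at least `m`. Their convexity defect therefore tends to zero, and uniform convexity makes the
gradients Cauchy. -/
theorem exists_minimizer (S : Setting s p q Ω V g) (h : HasGradZero p Ω u G)
    (hβ : energy p (weighted Ω g) u ≠ 0) :
    ∃ w K, HasGradZero p Ω w K ∧ energy p (weighted Ω g) w = 1 ∧
      ∀ v H, HasGradZero p Ω v H →
        totalEnergy s p Ω V w K * energy p (weighted Ω g) v ≤ totalEnergy s p Ω V v H := by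
  have hp := S.one_lt
  have hp0 := S.p_pos
  have hnorm : ∀ v H, HasGradZero p Ω v H → energy p (weighted Ω g) v ≠ 0 →
      ∃ c : ℝ, energy p (weighted Ω g) (fun x => c • v x) = 1 ∧
        |c| ^ p = (energy p (weighted Ω g) v)⁻¹ := by
    intro v H hv hv0
    have hpos : 0 < energy p (weighted Ω g) v := lt_of_le_of_ne (energy_nonneg _) hv0.symm
    have e : |(energy p (weighted Ω g) v) ^ (-p⁻¹)| ^ p = (energy p (weighted Ω g) v)⁻¹ := by
      rw [abs_of_pos (by positivity), ← Real.rpow_mul hpos.le, neg_mul, inv_mul_cancel₀ hp0.ne',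
        Real.rpow_neg_one]
    refine ⟨(energy p (weighted Ω g) v) ^ (-p⁻¹), ?_, e⟩
    rw [energy_smul, e, inv_mul_cancel₀ hv0]
  let A : Set ℝ := {e | ∃ v H, HasGradZero p Ω v H ∧ energy p (weighted Ω g) v = 1 ∧
    totalEnergy s p Ω V v H = e}
  have hAne : A.Nonempty := by
    obtain ⟨c, hc, -⟩ := hnorm u G h hβ
    exact ⟨_, _, _, h.smul c, hc, rfl⟩
  have hAbdd : BddBelow A := ⟨0, by rintro _ ⟨v, H, -, -, rfl⟩; exact totalEnergy_nonneg⟩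
  set m := sInf A with hm
  have hm0 : 0 ≤ m := le_csInf hAne (by rintro _ ⟨v, H, -, -, rfl⟩; exact totalEnergy_nonneg)
  have hmin : ∀ v H, HasGradZero p Ω v H →
      m * energy p (weighted Ω g) v ≤ totalEnergy s p Ω V v H := by
    intro v H hv
    by_cases hv0 : energy p (weighted Ω g) v = 0
    · rw [hv0, mul_zero]; exact totalEnergy_nonneg
    · obtain ⟨c, hc, hc'⟩ := hnorm v H hv hv0
      have h1 : m ≤ totalEnergy s p Ω V (fun x => c • v x) (fun x => c • H x) :=
        csInf_le hAbdd ⟨_, _, hv.smul c, hc, rfl⟩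
      rw [totalEnergy_smul, hc'] at h1
      have hpos : 0 < energy p (weighted Ω g) v := lt_of_le_of_ne (energy_nonneg _) (Ne.symm hv0)
      rwa [inv_mul_eq_div, le_div_iff₀ hpos] at h1
  have hseq : ∀ n : ℕ, ∃ v H, HasGradZero p Ω v H ∧ energy p (weighted Ω g) v = 1 ∧
      totalEnergy s p Ω V v H < m + 1 / ((n : ℝ) + 1) := by
    intro n
    obtain ⟨_, ⟨v, H, h1, h2, rfl⟩, h3⟩ := exists_lt_of_csInf_lt hAne
      (show sInf A < m + 1 / ((n : ℝ) + 1) by rw [← hm]; exact lt_add_of_pos_right _ (by positivity))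
    exact ⟨v, H, h1, h2, h3⟩
  choose w' K' hw' hw1' hwm' using hseq
  have hKbound : ∀ n, energy p volume (K' n) ≤ m + 1 := by
    intro n
    have h1 := (hwm' n).le
    have h2 : 1 / ((n : ℝ) + 1) ≤ 1 := by
      rw [div_le_one (by positivity)]; linarith [Nat.cast_nonneg (α := ℝ) n]
    have h3 := energy_nonneg (p := p) (μ := gagliardo N s p) (diff (w' n))
    have h4 := energy_nonneg (p := p) (μ := weighted Ω V) (w' n)
    simp only [totalEnergy] at h1
    linarith
  obtain ⟨k, hk, hcau⟩ := exists_subseq_energy_cauchy hp S.lt_dim S.s_pos S.s_lt_one S.isBounded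
    hw' hKbound
  set w := fun n => w' (k n)
  set K := fun n => K' (k n)
  have hw : ∀ n, HasGradZero p Ω (w n) (K n) := fun n => hw' (k n)
  have hKb : ∀ n, energy p volume (K n) ≤ m + 1 := fun n => hKbound (k n)
  have hwm : Tendsto (fun n => totalEnergy s p Ω V (w n) (K n)) atTop (𝓝 m) := by
    have h1 : Tendsto (fun n : ℕ => m + 1 / ((n : ℝ) + 1)) atTop (𝓝 (m + 0)) :=
      tendsto_const_nhds.add tendsto_one_div_add_atTop_nhds_zero_nat
    rw [add_zero] at h1
    refine tendsto_of_tendsto_of_tendsto_of_le_of_le tendsto_const_nhds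
      (h1.comp hk.tendsto_atTop) (fun n => ?_) (fun n => (hwm' (k n)).le)
    exact csInf_le hAbdd ⟨_, _, hw n, hw1' (k n), rfl⟩
  -- The unbounded part of `g` costs a small multiple of the gradient energies, which stay bounded;
  -- the bounded part is controlled by the Cauchy property in `L^p`.
  have hβcau : Tendsto (fun n : ℕ × ℕ => energy p (weighted Ω g) (fun x => w n.1 x - w n.2 x))
      atTop (𝓝 0) := by
    rw [Metric.tendsto_nhds]
    intro η hη
    obtain ⟨M, hM, hadd⟩ := exists_energy_weighted_le_add hp S.lt_dim S.volume_ne_top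
      S.le_exponent S.memLp_weight (ε := η / (2 * (2 ^ p * (m + 1 + (m + 1)))))
      (by positivity)
    have h1 := (hcau.const_mul M)
    rw [mul_zero] at h1
    filter_upwards [h1.eventually (gt_mem_nhds (show 0 < η / 2 by positivity))] with n hn
    rw [Real.dist_eq, sub_zero, abs_of_nonneg (energy_nonneg _)]
    have h2 := hadd _ _ ((hw n.1).sub hp (hw n.2))
    have h3 : energy p volume (fun x => K n.1 x - K n.2 x) ≤ 2 ^ p * (m + 1 + (m + 1)) :=
      (energy_sub_le hp (hw n.1).memLp_grad (hw n.2).memLp_grad).trans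
        (by gcongr <;> exact hKb _)
    have h4 : η / (2 * (2 ^ p * (m + 1 + (m + 1)))) *
        energy p volume (fun x => K n.1 x - K n.2 x) ≤ η / 2 := by
      calc _ ≤ η / (2 * (2 ^ p * (m + 1 + (m + 1)))) * (2 ^ p * (m + 1 + (m + 1))) := by gcongr
        _ = η / 2 := by field_simp
    linarith
  obtain ⟨b, hb, hblim⟩ := exists_limit_of_energy_cauchy hp (fun n => S.memLp_g (hw n)) hβcau
  have hb1 : energy p (weighted Ω g) b = 1 := by
    have := tendsto_energy hp (fun n => S.memLp_g (hw n)) hb hblim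
    refine tendsto_nhds_unique this ?_
    simp_rw [show ∀ n, energy p (weighted Ω g) (w n) = 1 from fun n => hw1' (k n)]
    exact tendsto_const_nhds
  have hmidG : ∀ n : ℕ × ℕ, HasGradZero p Ω (fun x => (1 / 2 : ℝ) • (w n.1 x + w n.2 x))
      (fun x => (1 / 2 : ℝ) • (K n.1 x + K n.2 x)) := fun n => ((hw n.1).add hp (hw n.2)).smul _
  have hmid : Tendsto (fun n : ℕ × ℕ => energy p (weighted Ω g)
      (fun x => (1 / 2 : ℝ) • (w n.1 x + w n.2 x))) atTop (𝓝 1) := by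
    rw [show 𝓝 (1 : ℝ) = 𝓝 (energy p (weighted Ω g) b) by rw [hb1]]
    refine tendsto_energy hp (fun n => S.memLp_g (hmidG n)) hb ?_
    have hfst : Tendsto (Prod.fst : ℕ × ℕ → ℕ) atTop atTop := by
      rw [← prod_atTop_atTop_eq]; exact tendsto_fst
    have hsnd : Tendsto (Prod.snd : ℕ × ℕ → ℕ) atTop atTop := by
      rw [← prod_atTop_atTop_eq]; exact tendsto_snd
    have h1 := tendsto_energy_add hp (fun n : ℕ × ℕ => (S.memLp_g (hw n.1)).sub hb)
      (fun n : ℕ × ℕ => (S.memLp_g (hw n.2)).sub hb) (hblim.comp hfst) (hblim.comp hsnd)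
    have h2 := h1.const_mul (|(1 / 2 : ℝ)| ^ p)
    rw [mul_zero] at h2
    refine h2.congr fun n => ?_
    rw [← energy_smul]
    congr 1; ext x
    simp only [Pi.sub_apply, smul_eq_mul]; ring
  have hgcau : Tendsto (fun n : ℕ × ℕ => energy p volume (fun x => K n.1 x - K n.2 x))
      atTop (𝓝 0) := by
    rw [Metric.tendsto_nhds]
    intro η hη
    -- Each gradient energy is at most `m + 1`, so with this parameter the first term of the
    -- convexity estimate is at most `η / 2`.
    obtain ⟨C, hC, huc⟩ := exists_energy_sub_le (α := Rn N) (E := Rn N) (μ := volume) hp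
      (ε := η / (2 * (m + 1 + (m + 1)))) (by positivity)
    have hfst : Tendsto (Prod.fst : ℕ × ℕ → ℕ) atTop atTop := by
      rw [← prod_atTop_atTop_eq]; exact tendsto_fst
    have hsnd : Tendsto (Prod.snd : ℕ × ℕ → ℕ) atTop atTop := by
      rw [← prod_atTop_atTop_eq]; exact tendsto_snd
    have h1 : Tendsto (fun n : ℕ × ℕ => C * ((totalEnergy s p Ω V (w n.1) (K n.1) +
        totalEnergy s p Ω V (w n.2) (K n.2)) / 2 - m * energy p (weighted Ω g)
        (fun x => (1 / 2 : ℝ) • (w n.1 x + w n.2 x)))) atTop (𝓝 0) := by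
      have := ((((hwm.comp hfst).add (hwm.comp hsnd)).div_const 2).sub
        (hmid.const_mul m)).const_mul C
      rwa [show C * ((m + m) / 2 - m * 1) = 0 by ring] at this
    filter_upwards [h1.eventually (gt_mem_nhds (show 0 < η / 2 by positivity))] with n hn
    rw [Real.dist_eq, sub_zero, abs_of_nonneg (energy_nonneg _)]
    have h2 := huc _ _ (hw n.1).memLp_grad (hw n.2).memLp_grad
    have h3 := S.energy_midpoint_grad_le (hw n.1) (hw n.2)
    have h4 := hmin _ _ (hmidG n)
    have h5 : η / (2 * (m + 1 + (m + 1))) * (energy p volume (K n.1) + energy p volume (K n.2)) ≤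
        η / 2 := by
      calc _ ≤ η / (2 * (m + 1 + (m + 1))) * (m + 1 + (m + 1)) := by
            gcongr <;> exact hKb _
        _ = η / 2 := by field_simp
    have h6 := mul_le_mul_of_nonneg_left (h3.trans (sub_le_sub_left h4 _)) hC
    linarith
  obtain ⟨K₀, hK₀, hKlim⟩ := exists_limit_of_energy_cauchy hp (fun n => (hw n).memLp_grad) hgcau
  obtain ⟨w₀, hw₀, hwlim⟩ := exists_limit_of_energy_cauchy hp (fun n => (hw n).memLp) hcau
  have h₀ : HasGradZero p Ω w₀ K₀ := HasGradZero.of_tendsto hp hw hw₀ hK₀ hwlim hKlim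
  -- All the other energies are dominated by the gradient energy, so every term passes to the limit.
  obtain ⟨C, hC, hbd⟩ := S.exists_bound
  have hdom := hKlim.const_mul C
  rw [mul_zero] at hdom
  have hsub := fun n => hbd _ _ ((hw n).sub hp h₀)
  have t1 := tendsto_energy hp (fun n => (hw n).memLp_grad) hK₀ hKlim
  have t2 := tendsto_energy hp (fun n => S.memLp_diff (hw n)) (S.memLp_diff h₀)
    (squeeze_zero (fun n => energy_nonneg _) (fun n => by
      rw [← diff_sub]; exact (hsub n).2.1) hdom)
  have t3 := tendsto_energy hp (fun n => S.memLp_V (hw n)) (S.memLp_V h₀)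
    (squeeze_zero (fun n => energy_nonneg _) (fun n => (hsub n).2.2.1) hdom)
  have t4 := tendsto_energy hp (fun n => S.memLp_g (hw n)) (S.memLp_g h₀)
    (squeeze_zero (fun n => energy_nonneg _) (fun n => (hsub n).2.2.2) hdom)
  have hm' : totalEnergy s p Ω V w₀ K₀ = m := tendsto_nhds_unique ((t1.add t2).add t3) hwm
  refine ⟨w₀, K₀, h₀, ?_, fun v H hv => by rw [hm']; exact hmin v H hv⟩
  refine tendsto_nhds_unique t4 ?_
  simp_rw [show ∀ n, energy p (weighted Ω g) (w n) = 1 from fun n => hw1' (k n)]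
  exact tendsto_const_nhds

/-- The function `t ↦ E(u + tv) - m ∫ g|u + tv|^p` is nonnegative and vanishes at `t = 0`, so its
derivative there is zero. The homogeneous form of the minimality condition makes a Lagrange
multiplier argument unnecessary. -/
theorem euler_lagrange (S : Setting s p q Ω V g) {m : ℝ} (h : HasGradZero p Ω u G)
    (hm : totalEnergy s p Ω V u G = m * energy p (weighted Ω g) u)
    (hmin : ∀ v H, HasGradZero p Ω v H →
      m * energy p (weighted Ω g) v ≤ totalEnergy s p Ω V v H)
    (h' : HasGradZero p Ω v H) :
    totalPairing s p Ω V u G v H - m * pairing p (weighted Ω g) u v = 0 := by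
  have hp := S.one_lt
  have d1 := hasDerivAt_energy hp h.memLp_grad h'.memLp_grad
  have d2 := hasDerivAt_energy hp (S.memLp_diff h) (S.memLp_diff h')
  have d3 := hasDerivAt_energy hp (S.memLp_V h) (S.memLp_V h')
  have d4 := hasDerivAt_energy hp (S.memLp_g h) (S.memLp_g h')
  have d := ((d1.add d2).add d3).sub (d4.const_mul m)
  have hloc : IsLocalMin (fun t : ℝ => totalEnergy s p Ω V (fun x => u x + t • v x)
      (fun x => G x + t • H x) - m * energy p (weighted Ω g) (fun x => u x + t • v x)) 0 := by
    refine Eventually.of_forall fun t => ?_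
    simp only [zero_smul, add_zero]
    rw [hm, sub_self, sub_nonneg]
    exact hmin _ _ (h.add hp (h'.smul t))
  have hd : HasDerivAt (fun t : ℝ => totalEnergy s p Ω V (fun x => u x + t • v x)
      (fun x => G x + t • H x) - m * energy p (weighted Ω g) (fun x => u x + t • v x))
      (p * pairing p volume G H + p * pairing p (gagliardo N s p) (diff u) (diff v) +
        p * pairing p (weighted Ω V) u v - m * (p * pairing p (weighted Ω g) u v)) 0 := by
    refine d.congr_of_eventuallyEq (Eventually.of_forall fun t => ?_)
    simp only [totalEnergy, Pi.add_apply, Pi.sub_apply]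
    rw [diff_add, diff_smul]
  have h0 := hloc.hasDerivAt_eq_zero hd
  have : p * (totalPairing s p Ω V u G v H - m * pairing p (weighted Ω g) u v) = 0 := by
    rw [← h0, totalPairing]; ring
  exact (mul_eq_zero.mp this).resolve_left S.p_pos.ne'

end Setting

end Minimizer

/-! ### Eigenfunctions -/

section Eigenfunctions

variable {N : ℕ} {s p q : ℝ} {Ω : Set (Rn N)} {V g : Rn N → ℝ} {u v : Rn N → ℝ}
  {G H : Rn N → Rn N}

theorem setIntegral_eq_pairing_weighted {W : Rn N → ℝ} (hW : AEMeasurable W (volume.restrict Ω))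
    (hW0 : ∀ᵐ x ∂(volume.restrict Ω), 0 ≤ W x) (u v : Rn N → ℝ) :
    ∫ x in Ω, W x * |u x| ^ (p - 2) * u x * v x = pairing p (weighted Ω W) u v := by
  rw [pairing, weighted, integral_withDensity_eq_integral_toReal_smul₀ hW.ennreal_ofReal
    (Eventually.of_forall fun _ => ENNReal.ofReal_lt_top)]
  refine integral_congr_ae ?_
  filter_upwards [hW0] with x hx
  simp only [ENNReal.toReal_ofReal hx, smul_eq_mul, Real.norm_eq_abs, RCLike.inner_apply,
    conj_trivial]
  ring

theorem mixedForm_eq_pairing (hp : 1 < p) (hΩ : IsOpen Ω) (h : HasGradZero p Ω u G)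
    (h' : HasGradZero p Ω v H) :
    mixedForm s p Ω u v =
      pairing p volume G H + pairing p (gagliardo N s p) (diff u) (diff v) := by
  unfold mixedForm
  congr 1
  · have h0 : ∀ᵐ x, x ∉ Ω → ‖G x‖ ^ (p - 2) * inner ℝ (G x) (H x) = 0 := by
      filter_upwards [h.ae_eq_zero hp] with x hx hxΩ
      rw [(hx hxΩ).2, inner_zero_left, mul_zero]
    rw [pairing, ← setIntegral_eq_integral_of_ae_compl_eq_zero h0]
    refine integral_congr_ae ?_
    filter_upwards [h.weakGradient_ae_eq hp hΩ, h'.weakGradient_ae_eq hp hΩ] with x h1 h2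
    rw [h1, h2]
  · rw [pairing, gagliardo, integral_withDensity_eq_integral_toReal_smul measurable_kernel
      (Eventually.of_forall fun _ => ENNReal.ofReal_lt_top)]
    congr 1
    ext z
    rw [ENNReal.toReal_ofReal (by positivity)]
    simp only [smul_eq_mul, Real.norm_eq_abs, RCLike.inner_apply, conj_trivial, diff]
    ring

namespace Setting

theorem isWeakSolution_iff (S : Setting s p q Ω V g) (h : HasGradZero p Ω u G) (m : ℝ) :
    IsWeakSolution s p Ω V g m u ↔ ∀ v H, HasGradZero p Ω v H →
      totalPairing s p Ω V u G v H - m * pairing p (weighted Ω g) u v = 0 := by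
  have hp := S.one_lt
  have e : ∀ v H, HasGradZero p Ω v H →
      mixedForm s p Ω u v + (∫ x in Ω, V x * |u x| ^ (p - 2) * u x * v x)
        - m * (∫ x in Ω, g x * |u x| ^ (p - 2) * u x * v x) =
      totalPairing s p Ω V u G v H - m * pairing p (weighted Ω g) u v := by
    intro v H hv
    rw [mixedForm_eq_pairing hp S.isOpen h hv,
      setIntegral_eq_pairing_weighted S.memLp_potential.1.aemeasurable S.potential_nonneg,
      setIntegral_eq_pairing_weighted S.memLp_weight.1.aemeasurable
        (S.weight_pos.mono fun _ hx => hx.le), totalPairing]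
  constructor
  · intro hu v H hv
    rw [← e v H hv]
    exact hu.2 v (hv.memX0 hp S.isOpen)
  · intro hu
    refine ⟨h.memX0 hp S.isOpen, fun v hv => ?_⟩
    obtain ⟨H, hH, -⟩ := hv.exists_hasGradZero hp S.isOpen
    rw [e v H hH]
    exact hu v H hH

theorem energy_weight_eq_zero_iff (S : Setting s p q Ω V g) (h : HasGradZero p Ω u G) :
    energy p (weighted Ω g) u = 0 ↔ ∀ᵐ x, u x = 0 := by
  rw [energy_eq_zero_iff S.one_lt (S.memLp_g h)]
  constructor
  · intro h0
    have h1 : ∀ᵐ x ∂(volume.restrict Ω), u x = 0 := by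
      have := (ae_withDensity_iff' S.memLp_weight.1.aemeasurable.ennreal_ofReal).mp h0
      filter_upwards [this, S.weight_pos] with x hx hgx
      exact hx (ENNReal.ofReal_pos.mpr hgx).ne'
    rw [ae_restrict_iff' S.isOpen.measurableSet] at h1
    filter_upwards [h1, h.ae_eq_zero S.one_lt] with x h1 h2
    by_cases hx : x ∈ Ω
    · exact h1 hx
    · exact (h2 hx).1
  · intro h0
    exact (weighted_absolutelyContinuous g).ae_le h0

/-- The variational characterization of the first eigenvalue. -/
theorem mul_energy_le_totalEnergy (S : Setting s p q Ω V g) {m : ℝ}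
    (hm : IsFirstEigenvalue s p Ω V g m) (h : HasGradZero p Ω v H) :
    m * energy p (weighted Ω g) v ≤ totalEnergy s p Ω V v H := by
  have hp := S.one_lt
  obtain ⟨⟨-, u, hu, hu0⟩, hleast⟩ := hm
  obtain ⟨G, hG, -⟩ := hu.1.exists_hasGradZero hp S.isOpen
  obtain ⟨w, K, hw, hw1, hmin⟩ := S.exists_minimizer hG
    (fun h0 => hu0 ((S.energy_weight_eq_zero_iff hG).mp h0))
  -- Zero total energy would give zero gradient energy, hence `∫ g|w|^p = 0`, against the
  -- normalization.
  have hpos : 0 < totalEnergy s p Ω V w K := by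
    refine lt_of_le_of_ne totalEnergy_nonneg fun h0 => ?_
    obtain ⟨C, hC, hbd⟩ := S.exists_bound
    have h1 := (hbd w K hw).2.2.2
    have a1 := energy_nonneg (p := p) (μ := volume) K
    have a2 := energy_nonneg (p := p) (μ := gagliardo N s p) (diff w)
    have a3 := energy_nonneg (p := p) (μ := weighted Ω V) w
    have h2 : energy p volume K = 0 := by
      rw [totalEnergy] at h0
      linarith
    rw [hw1, h2, mul_zero] at h1
    linarith
  have heig : IsEigenvalue s p Ω V g (totalEnergy s p Ω V w K) := by
    refine ⟨w, (S.isWeakSolution_iff hw _).mpr fun v H hv =>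
      S.euler_lagrange hw (by rw [hw1, mul_one]) hmin hv, fun h0 => ?_⟩
    rw [(S.energy_weight_eq_zero_iff hw).mpr h0] at hw1
    exact zero_ne_one hw1
  -- The minimum of the quotient is a positive eigenvalue, so the least such eigenvalue `m` does not
  -- exceed it.
  exact (mul_le_mul_of_nonneg_right (hleast ⟨hpos, heig⟩) (energy_nonneg _)).trans (hmin v H h)

end Setting

/-! ### Eigenfunctions for the first eigenvalue do not change sign -/

theorem tendsto_energy_of_dominated {α E E' : Type*} [MeasurableSpace α]
    [NormedAddCommGroup E] [InnerProductSpace ℝ E] [NormedAddCommGroup E'] [InnerProductSpace ℝ E']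
    {μ : Measure α} (hp : 1 < p) {a : ℕ → α → E} {a' : α → E} {b : α → E'}
    (ha : ∀ n, AEStronglyMeasurable (a n) μ) (hb : MemLp b (ENNReal.ofReal p) μ)
    (h : ∀ n, ∀ᵐ x ∂μ, ‖a n x‖ ≤ ‖b x‖)
    (hlim : ∀ᵐ x ∂μ, Tendsto (fun n => a n x) atTop (𝓝 (a' x))) :
    Tendsto (fun n => energy p μ (a n)) atTop (𝓝 (energy p μ a')) := by
  refine tendsto_integral_of_dominated_convergence (fun x => ‖b x‖ ^ p)
    (fun n => ((ha n).norm.aemeasurable.pow_const _).aestronglyMeasurable)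
    (integrable_norm_rpow_ofReal hp hb) (fun n => ?_) ?_
  · filter_upwards [h n] with x hx
    rw [Real.norm_of_nonneg (by positivity)]
    exact Real.rpow_le_rpow (norm_nonneg _) hx (by linarith)
  · filter_upwards [hlim] with x hx
    exact hx.norm.rpow_const (Or.inr (by linarith))

/-- A smooth approximation of the absolute value. -/
noncomputable def smoothAbs (ε t : ℝ) : ℝ := √(t ^ 2 + ε ^ 2) - ε

theorem smoothAbs_zero {ε : ℝ} (hε : 0 < ε) : smoothAbs ε 0 = 0 := by
  simp [smoothAbs, Real.sqrt_sq hε.le]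

theorem contDiff_smoothAbs {ε : ℝ} (hε : 0 < ε) : ContDiff ℝ ∞ (smoothAbs ε) := by
  refine ContDiff.sub (ContDiff.sqrt (by fun_prop) fun t => ?_) contDiff_const
  positivity

theorem abs_deriv_smoothAbs_le {ε : ℝ} (hε : 0 < ε) (t : ℝ) : |deriv (smoothAbs ε) t| ≤ 1 := by
  have h1 : HasDerivAt (fun t : ℝ => t ^ 2 + ε ^ 2) (2 * t) t := by
    simpa using (hasDerivAt_pow 2 t).add_const (ε ^ 2)
  have h2 := ((h1.sqrt (by positivity)).sub_const ε).deriv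
  have h3 : deriv (smoothAbs ε) t = 2 * t / (2 * √(t ^ 2 + ε ^ 2)) := h2
  rw [h3, mul_div_mul_left _ _ two_ne_zero, abs_div, abs_of_nonneg (Real.sqrt_nonneg _)]
  refine div_le_one_of_le₀ ?_ (Real.sqrt_nonneg _)
  rw [← Real.sqrt_sq_eq_abs]
  exact Real.sqrt_le_sqrt (by nlinarith [sq_nonneg ε])

theorem tendsto_smoothAbs (t : ℝ) :
    Tendsto (fun n : ℕ => smoothAbs (1 / ((n : ℝ) + 1)) t) atTop (𝓝 |t|) := by
  have h1 : Tendsto (fun n : ℕ => (1 : ℝ) / ((n : ℝ) + 1)) atTop (𝓝 0) :=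
    tendsto_one_div_add_atTop_nhds_zero_nat
  have h2 : Continuous (fun ε : ℝ => smoothAbs ε t) := by unfold smoothAbs; fun_prop
  have h3 := (h2.tendsto 0).comp h1
  have h4 : smoothAbs 0 t = |t| := by simp [smoothAbs, Real.sqrt_sq_eq_abs]
  rwa [h4] at h3

/-- Off the diagonal the density is positive. On the diagonal it is the inverse of `0 ^ (N + ps)`,
which is `0` by convention when the exponent is nonzero. -/
theorem ae_gagliardo_iff (he : (N : ℝ) + p * s ≠ 0) {P : Rn N × Rn N → Prop} :
    (∀ᵐ z ∂(gagliardo N s p), P z) ↔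
      ∀ᵐ z ∂((volume : Measure (Rn N)).prod volume), z.1 ≠ z.2 → P z := by
  rw [gagliardo, ae_withDensity_iff measurable_kernel]
  refine eventually_congr (Eventually.of_forall fun z => ?_)
  constructor
  · intro h hz
    have : 0 < ‖z.1 - z.2‖ := norm_pos_iff.mpr (sub_ne_zero.mpr hz)
    exact h (ENNReal.ofReal_pos.mpr (by positivity)).ne'
  · intro h hz
    by_cases hzz : z.1 = z.2
    · exact absurd (by simp [hzz, Real.zero_rpow he]) hz
    · exact h hzz

namespace Setting

theorem exponent_ne_zero (S : Setting s p q Ω V g) : (N : ℝ) + p * s ≠ 0 := by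
  have := mul_pos S.p_pos S.s_pos
  positivity

/-- Smooth approximations of `|u|` are inserted in the variational inequality. They do not increase
the gradient and potential terms, and in the limit they preserve `∫ g|u|^p`; as `u` attains
equality, the seminorm cannot drop. The gradient of `|u|` itself is never needed. -/
theorem energy_diff_le_energy_diff_abs (S : Setting s p q Ω V g) {m : ℝ}
    (hm : IsFirstEigenvalue s p Ω V g m) (h : HasGradZero p Ω u G)
    (hu : totalEnergy s p Ω V u G = m * energy p (weighted Ω g) u) :
    energy p (gagliardo N s p) (diff u) ≤
      energy p (gagliardo N s p) (diff fun x => |u x|) := by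
  have hp := S.one_lt
  have hε : ∀ n : ℕ, (0 : ℝ) < 1 / ((n : ℝ) + 1) := fun n => by positivity
  have hw := fun n => h.comp hp (contDiff_smoothAbs (hε n)) (smoothAbs_zero (hε n))
    (abs_deriv_smoothAbs_le (hε n))
  have hlip : ∀ (n : ℕ) (a b : ℝ), |smoothAbs (1 / ((n : ℝ) + 1)) a -
      smoothAbs (1 / ((n : ℝ) + 1)) b| ≤ |a - b| := fun n a b => by
    simpa using abs_sub_le_of_abs_deriv_le (contDiff_smoothAbs (hε n))
      (abs_deriv_smoothAbs_le (hε n)) a b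
  have hle : ∀ (n : ℕ) (a : ℝ), |smoothAbs (1 / ((n : ℝ) + 1)) a| ≤ |a| := fun n a => by
    simpa only [smoothAbs_zero (hε n), sub_zero] using hlip n a 0
  have t1 := tendsto_energy_of_dominated (a' := fun x => |u x|) hp (fun n => (S.memLp_g (hw n)).1)
    (S.memLp_g h) (fun n => Eventually.of_forall fun x => hle n (u x))
    (Eventually.of_forall fun x => tendsto_smoothAbs (u x))
  have t2 := tendsto_energy_of_dominated (a' := diff fun x => |u x|) hp
    (fun n => (S.memLp_diff (hw n)).1)
    (S.memLp_diff h) (fun n => Eventually.of_forall fun z => hlip n (u z.1) (u z.2))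
    (Eventually.of_forall fun z => (tendsto_smoothAbs (u z.1)).sub (tendsto_smoothAbs (u z.2)))
  have e1 : energy p (weighted Ω g) (fun x => |u x|) = energy p (weighted Ω g) u := by
    simp [energy]
  rw [e1] at t1
  have key := le_of_tendsto_of_tendsto' (t1.const_mul m)
    ((t2.const_add (energy p volume G)).add_const (energy p (weighted Ω V) u)) fun n => by
      refine (S.mul_energy_le_totalEnergy hm (hw n)).trans ?_
      rw [totalEnergy]
      gcongr
      · refine energy_mono hp (hw n).memLp_grad.1 h.memLp_grad (Eventually.of_forall fun x => ?_)
        rw [norm_smul, Real.norm_eq_abs]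
        exact mul_le_of_le_one_left (norm_nonneg _) (abs_deriv_smoothAbs_le (hε n) _)
      · exact energy_mono hp (S.memLp_V (hw n)).1 (S.memLp_V h)
          (Eventually.of_forall fun x => hle n (u x))
  rw [← hu, totalEnergy] at key
  linarith

/-- The pointwise bound `||a| - |b|| ≤ |a - b|` gives the reverse inequality of seminorms, so
equality holds almost everywhere. Squaring it yields `ab = |a||b|`. -/
theorem ae_mul_nonneg (S : Setting s p q Ω V g) {m : ℝ}
    (hm : IsFirstEigenvalue s p Ω V g m) (h : HasGradZero p Ω u G)
    (hu : totalEnergy s p Ω V u G = m * energy p (weighted Ω g) u) :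
    ∀ᵐ z ∂((volume : Measure (Rn N)).prod volume), 0 ≤ u z.1 * u z.2 := by
  have hp := S.one_lt
  have hle : ∀ z, ‖diff (fun x => |u x|) z‖ ≤ ‖diff u z‖ := fun z =>
    abs_abs_sub_abs_le_abs_sub _ _
  have hmem := S.memLp_diff h
  have hmem' : MemLp (diff fun x => |u x|) (ENNReal.ofReal p) (gagliardo N s p) :=
    hmem.mono ((aestronglyMeasurable_diff h.memLp.1.norm).mono_ac gagliardo_absolutelyContinuous)
      (Eventually.of_forall hle)
  have i1 := integrable_norm_rpow_ofReal hp hmem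
  have i2 := integrable_norm_rpow_ofReal hp hmem'
  have hle' : ∀ z, ‖diff (fun x => |u x|) z‖ ^ p ≤ ‖diff u z‖ ^ p := fun z =>
    Real.rpow_le_rpow (norm_nonneg _) (hle z) S.p_pos.le
  have h0 : ∫ z, (‖diff u z‖ ^ p - ‖diff (fun x => |u x|) z‖ ^ p) ∂(gagliardo N s p) = 0 := by
    rw [integral_sub i1 i2]
    refine le_antisymm (sub_nonpos.mpr (S.energy_diff_le_energy_diff_abs hm h hu)) ?_
    exact sub_nonneg.mpr (integral_mono i2 i1 hle')
  rw [integral_eq_zero_iff_of_nonneg (fun z => sub_nonneg.mpr (hle' z)) (i1.sub i2)] at h0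
  have h1 := (ae_gagliardo_iff S.exponent_ne_zero).mp h0
  filter_upwards [h1] with z hz
  by_cases e : z.1 = z.2
  · rw [e]; exact mul_self_nonneg _
  · have h2 : ‖diff u z‖ ^ p = ‖diff (fun x => |u x|) z‖ ^ p := sub_eq_zero.mp (hz e)
    rw [Real.rpow_left_inj (norm_nonneg _) (norm_nonneg _) S.p_pos.ne'] at h2
    simp only [diff, Real.norm_eq_abs] at h2
    have h3 := congrArg (· ^ 2) h2
    simp only [sq_abs] at h3
    have h4 : u z.1 * u z.2 = |u z.1| * |u z.2| := by
      nlinarith [sq_abs (u z.1), sq_abs (u z.2)]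
    rw [h4]; positivity

theorem ae_nonneg_or_nonpos (S : Setting s p q Ω V g) {m : ℝ}
    (hm : IsFirstEigenvalue s p Ω V g m) (h : HasGradZero p Ω u G)
    (hu : totalEnergy s p Ω V u G = m * energy p (weighted Ω g) u) :
    (∀ᵐ x, 0 ≤ u x) ∨ ∀ᵐ x, u x ≤ 0 := by
  have h0 : ((volume : Measure (Rn N)).prod volume) ({x | u x < 0} ×ˢ {x | 0 < u x}) = 0 := by
    refine measure_mono_null ?_ (S.ae_mul_nonneg hm h hu)
    rintro z ⟨h1, h2⟩ h3
    have h4 : 0 ≤ u z.1 * u z.2 := h3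
    exact (mul_neg_of_neg_of_pos (show u z.1 < 0 from h1) (show 0 < u z.2 from h2)).not_ge h4
  rw [Measure.prod_prod, mul_eq_zero] at h0
  refine h0.imp (fun h => ?_) (fun h => ?_)
  · simpa [ae_iff] using h
  · simpa [ae_iff] using h

end Setting

end Eigenfunctions

/-! ### Strict positivity -/

section Positivity

variable {N : ℕ} {s p q : ℝ} {Ω : Set (Rn N)} {V g : Rn N → ℝ} {u v : Rn N → ℝ}
  {G H : Rn N → Rn N}

/-- Smooth functions decreasing on `[0, ∞)` to the indicator of `0`. -/
noncomputable def bell (n : ℕ) (t : ℝ) : ℝ := (1 + ((n : ℝ) + 1) * t ^ 2)⁻¹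

theorem bell_nonneg (n : ℕ) (t : ℝ) : 0 ≤ bell n t := by unfold bell; positivity

theorem bell_le_one (n : ℕ) (t : ℝ) : bell n t ≤ 1 := by
  unfold bell
  refine inv_le_one_of_one_le₀ ?_
  have : 0 ≤ ((n : ℝ) + 1) * t ^ 2 := by positivity
  linarith

theorem contDiff_bell (n : ℕ) : ContDiff ℝ ∞ (bell n) := by
  refine ContDiff.inv (by fun_prop) fun t => ?_
  positivity

theorem bell_antitone (n : ℕ) {a b : ℝ} (ha : 0 ≤ a) (hab : a ≤ b) : bell n b ≤ bell n a := by
  unfold bell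
  gcongr

theorem deriv_bell (n : ℕ) (t : ℝ) :
    deriv (bell n) t = -(((n : ℝ) + 1) * (2 * t)) / (1 + ((n : ℝ) + 1) * t ^ 2) ^ 2 := by
  have h1 : HasDerivAt (fun t : ℝ => 1 + ((n : ℝ) + 1) * t ^ 2) (((n : ℝ) + 1) * (2 * t)) t := by
    simpa using ((hasDerivAt_pow 2 t).const_mul ((n : ℝ) + 1)).const_add 1
  exact (h1.inv (by positivity)).deriv

theorem abs_deriv_bell_le (n : ℕ) (t : ℝ) : |deriv (bell n) t| ≤ (n : ℝ) + 1 := by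
  rw [deriv_bell, abs_div, abs_neg, abs_mul, abs_of_pos (by positivity : (0 : ℝ) < (n : ℝ) + 1),
    abs_of_pos (by positivity : (0 : ℝ) < (1 + ((n : ℝ) + 1) * t ^ 2) ^ 2), div_le_iff₀ (by positivity)]
  have hn : (0 : ℝ) ≤ n := Nat.cast_nonneg n
  gcongr
  rw [abs_mul, abs_two]
  have h1 : 2 * |t| ≤ 1 + t ^ 2 := by nlinarith [sq_nonneg (|t| - 1), sq_abs t]
  have h2 : 1 + t ^ 2 ≤ 1 + ((n : ℝ) + 1) * t ^ 2 := by nlinarith [sq_nonneg t]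
  nlinarith [mul_nonneg (by positivity : (0 : ℝ) ≤ (n : ℝ) + 1) (sq_nonneg t)]

theorem deriv_bell_nonpos (n : ℕ) {t : ℝ} (ht : 0 ≤ t) : deriv (bell n) t ≤ 0 := by
  rw [deriv_bell, neg_div]
  exact neg_nonpos.mpr (by positivity)

theorem bell_zero (n : ℕ) : bell n 0 = 1 := by simp [bell]

theorem tendsto_bell {t : ℝ} (ht : t ≠ 0) : Tendsto (fun n => bell n t) atTop (𝓝 0) := by
  unfold bell
  refine tendsto_inv_atTop_zero.comp (tendsto_atTop_add_const_left _ _ ?_)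
  exact (tendsto_atTop_add_const_right _ _ tendsto_natCast_atTop_atTop).atTop_mul_const
    (by positivity)

theorem tendsto_bell_ite (t : ℝ) :
    Tendsto (fun n => bell n t) atTop (𝓝 (if t = 0 then 1 else 0)) := by
  split_ifs with h
  · simp [h, bell_zero]
  · exact tendsto_bell h

theorem tendsto_pairing_of_dominated {α E : Type*} [MeasurableSpace α]
    [NormedAddCommGroup E] [InnerProductSpace ℝ E] {μ : Measure α} (hp : 1 < p) {a b : α → E}
    (ha : MemLp a (ENNReal.ofReal p) μ) (hb : MemLp b (ENNReal.ofReal p) μ) {c : ℕ → α → ℝ}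
    (hcm : ∀ n, AEStronglyMeasurable (c n) μ)
    (hc : ∀ n x, |c n x| ≤ 1) (hlim : ∀ᵐ x ∂μ, a x = 0 ∨ Tendsto (fun n => c n x) atTop (𝓝 0)) :
    Tendsto (fun n => pairing p μ a (fun x => c n x • b x)) atTop (𝓝 0) := by
  have h0 : (0 : ℝ) = ∫ _, 0 ∂μ := by simp
  rw [h0]
  have i := (integrable_pairing hp ha hb)
  have e : ∀ n x, ‖a x‖ ^ (p - 2) * inner ℝ (a x) (c n x • b x) =
      c n x * (‖a x‖ ^ (p - 2) * inner ℝ (a x) (b x)) := fun n x => by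
    rw [inner_smul_right]; ring
  refine tendsto_integral_of_dominated_convergence _
    (fun n => aestronglyMeasurable_pairing ha.1 ((hcm n).smul hb.1)) i.norm
    (fun n => Eventually.of_forall fun x => ?_) ?_
  · simp only [e, norm_mul]
    exact mul_le_of_le_one_left (by positivity) (hc n x)
  · filter_upwards [hlim] with x hx
    rcases hx with hx | hx
    · simp [hx]
    · simp_rw [e]
      simpa using hx.mul_const (‖a x‖ ^ (p - 2) * inner ℝ (a x) (b x))

namespace Setting

/-- The strong maximum principle, by testing with `φ * bell n (u)`. The local terms cannot
compensate a negative nonlocal limit, so the interaction between `{u = 0, φ ≠ 0}` and `{u > 0}` is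
zero; since `{u > 0}` has positive measure, the first set is null. -/
theorem test_measure_zero (S : Setting s p q Ω V g) {m : ℝ} (hm : 0 ≤ m) (h : HasGradZero p Ω u G)
    (hu0 : ∀ᵐ x, 0 ≤ u x) (hne : ¬ ∀ᵐ x, u x = 0)
    (hweak : ∀ v H, HasGradZero p Ω v H →
      totalPairing s p Ω V u G v H - m * pairing p (weighted Ω g) u v = 0)
    {φ : Rn N → ℝ} (hφ : IsTest Ω φ) (hφ0 : ∀ x, 0 ≤ φ x) :
    volume {x | u x = 0 ∧ φ x ≠ 0} = 0 := by
  have hp := S.one_lt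
  have hv := fun n => h.test_mul_comp hp hφ (contDiff_bell n) (abs_deriv_bell_le n)
  have hφG := hφ.hasGradZero (p := p) hp
  set v : ℕ → Rn N → ℝ := fun n x => φ x * bell n (u x) with hvdef
  have hbm : ∀ n, AEStronglyMeasurable (fun x => bell n (u x)) volume := fun n =>
    (contDiff_bell n).continuous.comp_aestronglyMeasurable h.memLp.1
  have hb1 : ∀ n x, |bell n (u x)| ≤ 1 := fun n x => by
    rw [abs_of_nonneg (bell_nonneg _ _)]; exact bell_le_one _ _
  have ha : Tendsto (fun n => pairing p volume G (fun x => bell n (u x) • gradient φ x))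
      atTop (𝓝 0) := by
    refine tendsto_pairing_of_dominated hp h.memLp_grad hφG.memLp_grad hbm hb1 ?_
    filter_upwards [h.grad_eq_zero_of_eq_zero hp] with x hx
    by_cases hux : u x = 0
    · exact Or.inl (hx hux)
    · exact Or.inr (tendsto_bell hux)
  have hc : Tendsto (fun n => pairing p (weighted Ω V) u (v n)) atTop (𝓝 0) := by
    have := tendsto_pairing_of_dominated hp (S.memLp_V h) (S.memLp_V hφG)
      (fun n => (hbm n).mono_ac (weighted_absolutelyContinuous V)) hb1
      (Eventually.of_forall fun x => ?_)
    · simpa only [hvdef, smul_eq_mul, mul_comm] using this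
    · by_cases hux : u x = 0
      · exact Or.inl hux
      · exact Or.inr (tendsto_bell hux)
  -- The term in which the derivative falls on `bell n` equals `φ b_n'(u) ‖G‖ ^ p ≤ 0`; it can be
  -- dropped, so no control of `b_n'` as `n` grows is needed.
  have hgrad : ∀ n, pairing p volume G
      (fun x => (φ x * deriv (bell n) (u x)) • G x + bell n (u x) • gradient φ x) ≤
      pairing p volume G (fun x => bell n (u x) • gradient φ x) := by
    intro n
    refine integral_mono_ae (integrable_pairing hp h.memLp_grad (hv n).memLp_grad)
      (integrable_pairing hp h.memLp_grad
        (memLp_smul_of_bdd (hbm n) (hb1 n) hφG.memLp_grad)) ?_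
    filter_upwards [hu0] with x hx
    rw [inner_add_right, mul_add, inner_smul_right, real_inner_self_eq_norm_sq]
    have h1 : φ x * deriv (bell n) (u x) ≤ 0 :=
      mul_nonpos_of_nonneg_of_nonpos (hφ0 x) (deriv_bell_nonpos n hx)
    have h2 : ‖G x‖ ^ (p - 2) * (φ x * deriv (bell n) (u x) * ‖G x‖ ^ 2) ≤ 0 :=
      mul_nonpos_of_nonneg_of_nonpos (by positivity)
        (mul_nonpos_of_nonpos_of_nonneg h1 (sq_nonneg _))
    linarith
  have hgpos : ∀ n, 0 ≤ pairing p (weighted Ω g) u (v n) := by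
    intro n
    refine integral_nonneg_of_ae ?_
    filter_upwards [(weighted_absolutelyContinuous g).ae_le hu0] with x hx
    simp only [Pi.zero_apply, RCLike.inner_apply, conj_trivial, hvdef]
    have := bell_nonneg n (u x)
    have := hφ0 x
    positivity
  set P : ℕ → ℝ := fun n => pairing p (gagliardo N s p) (diff u) (diff (v n)) with hP
  -- The right side of the equation is nonnegative, so the nonlocal term is bounded below by minus
  -- quantities that tend to zero.
  have hPlow : ∀ n, -(pairing p volume G (fun x => bell n (u x) • gradient φ x) +
      pairing p (weighted Ω V) u (v n)) ≤ P n := by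
    intro n
    have h1 := hweak _ _ (hv n)
    have h2 := mul_nonneg hm (hgpos n)
    have h3 := hgrad n
    simp only [totalPairing] at h1
    simp only [hP]
    linarith
  -- `J * diff (v n)` is the nonlocal integrand, `M` an integrable upper bound for it uniform in
  -- `n`, and `D₀` its pointwise limit.
  let J : Rn N × Rn N → ℝ := fun z => ‖diff u z‖ ^ (p - 2) * diff u z
  let M : Rn N × Rn N → ℝ := fun z => |J z * diff φ z|
  let D₀ : Rn N × Rn N → ℝ := fun z =>
    J z * (φ z.1 * (if u z.1 = 0 then 1 else 0) - φ z.2 * (if u z.2 = 0 then 1 else 0))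
  have hJ : ∀ (w : Rn N → ℝ) z, ‖diff u z‖ ^ (p - 2) * inner ℝ (diff u z) (diff w z) =
      J z * diff w z := fun w z => by
    simp only [J, RCLike.inner_apply, conj_trivial]; ring
  have hMi : Integrable M (gagliardo N s p) := by
    have := (integrable_pairing hp (S.memLp_diff h) (S.memLp_diff hφG)).abs
    simpa only [hJ] using this
  have hDi : ∀ n, Integrable (fun z => J z * diff (v n) z) (gagliardo N s p) := fun n => by
    have := integrable_pairing hp (S.memLp_diff h) (S.memLp_diff (hv n))
    simpa only [hJ] using this
  have hPe : ∀ n, P n = ∫ z, J z * diff (v n) z ∂(gagliardo N s p) := fun n => by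
    simp only [hP, pairing, hJ]
  have hu2 : ∀ᵐ z ∂(gagliardo N s p), 0 ≤ u z.1 ∧ 0 ≤ u z.2 := by
    refine gagliardo_absolutelyContinuous.ae_le ?_
    filter_upwards [Measure.quasiMeasurePreserving_fst (μ := (volume : Measure (Rn N)))
      (ν := (volume : Measure (Rn N))) |>.ae hu0,
      Measure.quasiMeasurePreserving_snd (μ := (volume : Measure (Rn N)))
      (ν := (volume : Measure (Rn N))) |>.ae hu0] with z h1 h2 using ⟨h1, h2⟩
  have hDM : ∀ n, ∀ᵐ z ∂(gagliardo N s p), J z * diff (v n) z ≤ M z := by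
    intro n
    filter_upwards [hu2] with z ⟨h1, h2⟩
    -- The discrete product rule. The second summand is nonpositive because `bell n` is decreasing
    -- on `[0, ∞)`; only an upper bound is available, which is what the reverse Fatou argument
    -- requires.
    have e : J z * diff (v n) z = bell n (u z.1) * (J z * diff φ z) +
        φ z.2 * (‖diff u z‖ ^ (p - 2) * (diff u z * (bell n (u z.1) - bell n (u z.2)))) := by
      simp only [J, diff, hvdef]; ring
    have hneg : diff u z * (bell n (u z.1) - bell n (u z.2)) ≤ 0 := by
      simp only [diff]
      rcases le_total (u z.1) (u z.2) with hle | hle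
      · exact mul_nonpos_of_nonpos_of_nonneg (sub_nonpos.mpr hle)
          (sub_nonneg.mpr (bell_antitone n h1 hle))
      · exact mul_nonpos_of_nonneg_of_nonpos (sub_nonneg.mpr hle)
          (sub_nonpos.mpr (bell_antitone n h2 hle))
    have hneg2 : φ z.2 * (‖diff u z‖ ^ (p - 2) *
        (diff u z * (bell n (u z.1) - bell n (u z.2)))) ≤ 0 :=
      mul_nonpos_of_nonneg_of_nonpos (hφ0 _)
        (mul_nonpos_of_nonneg_of_nonpos (by positivity) hneg)
    have hb : bell n (u z.1) * (J z * diff φ z) ≤ M z :=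
      calc bell n (u z.1) * (J z * diff φ z) ≤ bell n (u z.1) * M z := by
            gcongr
            · exact bell_nonneg _ _
            · exact le_abs_self _
        _ ≤ M z := mul_le_of_le_one_left (abs_nonneg _) (bell_le_one _ _)
    rw [e]
    linarith
  have hlim : ∀ z, Tendsto (fun n => J z * diff (v n) z) atTop (𝓝 (D₀ z)) := fun z =>
    Tendsto.const_mul _ (((tendsto_bell_ite (u z.1)).const_mul _).sub
      ((tendsto_bell_ite (u z.2)).const_mul _))
  have hD₀ : ∀ᵐ z ∂(gagliardo N s p), D₀ z ≤ 0 := by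
    filter_upwards [hu2] with z ⟨h1, h2⟩
    simp only [D₀, J, diff]
    have hr : 0 ≤ ‖u z.1 - u z.2‖ ^ (p - 2) := by positivity
    by_cases e1 : u z.1 = 0 <;> by_cases e2 : u z.2 = 0
    · simp [e1, e2]
    · simp only [e1, e2, if_true, if_false, mul_one, mul_zero, sub_zero, zero_sub] at hr ⊢
      nlinarith [mul_nonneg hr (mul_nonneg h2 (hφ0 z.1))]
    · simp only [e1, e2, if_true, if_false, mul_one, mul_zero, sub_zero, zero_sub] at hr ⊢
      nlinarith [mul_nonneg hr (mul_nonneg h1 (hφ0 z.2))]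
    · simp [e1, e2]
  have hD₀m : AEMeasurable D₀ (gagliardo N s p) :=
    aemeasurable_of_tendsto_metrizable_ae atTop (fun n => (hDi n).1.aemeasurable)
      (Eventually.of_forall hlim)
  -- Fatou's lemma for the nonnegative functions `M - J * diff (v n)`, combined with the lower bound
  -- on their nonlocal integrals. As `D₀ ≤ 0`, the result forces `D₀ = 0` almost everywhere.
  have hfatou : ∫⁻ z, ENNReal.ofReal (M z - D₀ z) ∂(gagliardo N s p) ≤
      ∫⁻ z, ENNReal.ofReal (M z) ∂(gagliardo N s p) := by
    calc ∫⁻ z, ENNReal.ofReal (M z - D₀ z) ∂(gagliardo N s p)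
        = ∫⁻ z, liminf (fun n => ENNReal.ofReal (M z - J z * diff (v n) z)) atTop
            ∂(gagliardo N s p) := by
          refine lintegral_congr fun z => ?_
          exact (ENNReal.tendsto_ofReal (tendsto_const_nhds.sub (hlim z))).liminf_eq.symm
      _ ≤ liminf (fun n => ∫⁻ z, ENNReal.ofReal (M z - J z * diff (v n) z)
            ∂(gagliardo N s p)) atTop :=
          lintegral_liminf_le' fun n => (hMi.sub (hDi n)).1.aemeasurable.ennreal_ofReal
      _ ≤ liminf (fun n => ENNReal.ofReal ((∫ z, M z ∂(gagliardo N s p)) +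
            (pairing p volume G (fun x => bell n (u x) • gradient φ x) +
              pairing p (weighted Ω V) u (v n)))) atTop := by
          refine liminf_le_liminf (Eventually.of_forall fun n => ?_)
          rw [← ofReal_integral_eq_lintegral_ofReal (f := fun z => M z - J z * diff (v n) z)
            (hMi.sub (hDi n)) ((hDM n).mono fun z hz => sub_nonneg.mpr hz)]
          refine ENNReal.ofReal_le_ofReal ?_
          rw [integral_sub hMi (hDi n), ← hPe]
          linarith [hPlow n]
      _ = ENNReal.ofReal (∫ z, M z ∂(gagliardo N s p)) := by
          have := (ha.add hc).const_add (∫ z, M z ∂(gagliardo N s p))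
          rw [add_zero, add_zero] at this
          exact (ENNReal.tendsto_ofReal this).liminf_eq
      _ = _ := ofReal_integral_eq_lintegral_ofReal hMi
          (Eventually.of_forall fun z => abs_nonneg _)
  have heq : (fun z => ENNReal.ofReal (M z)) =ᵐ[gagliardo N s p]
      fun z => ENNReal.ofReal (M z - D₀ z) := by
    refine ae_eq_of_ae_le_of_lintegral_le ?_ hMi.lintegral_lt_top.ne
      (hMi.1.aemeasurable.sub hD₀m).ennreal_ofReal hfatou
    filter_upwards [hD₀] with z hz
    exact ENNReal.ofReal_le_ofReal (by linarith)
  have hzero : ∀ᵐ z ∂(gagliardo N s p), D₀ z = 0 := by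
    filter_upwards [heq, hD₀] with z h1 h2
    have h3 : 0 ≤ M z := abs_nonneg _
    rw [ENNReal.ofReal_eq_ofReal_iff h3 (by linarith)] at h1
    linarith
  -- At a point with `u z.1 = 0 < u z.2` the limit `D₀` is `-(u z.2) ^ (p - 1) * φ z.1`, which is
  -- nonzero when `φ z.1 ≠ 0`.
  have hprod : ((volume : Measure (Rn N)).prod volume)
      ({x | u x = 0 ∧ φ x ≠ 0} ×ˢ {x | 0 < u x}) = 0 := by
    refine measure_mono_null ?_ ((ae_gagliardo_iff S.exponent_ne_zero).mp hzero)
    rintro z ⟨⟨h1, h2⟩, h3⟩ h4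
    have h3' : 0 < u z.2 := h3
    have hz : z.1 ≠ z.2 := fun e => by rw [e] at h1; exact h3'.ne' h1
    have h5 := h4 hz
    have h6 : u z.1 - u z.2 ≠ 0 := by rw [h1]; simpa using h3'.ne'
    simp only [D₀, J, diff, h1, h3'.ne', if_true, if_false, mul_one, mul_zero, sub_zero,
      zero_sub] at h5
    rw [norm_neg, mul_eq_zero, mul_eq_zero] at h5
    rcases h5 with (h5 | h5) | h5
    · exact (Real.rpow_pos_of_pos (norm_pos_iff.mpr h3'.ne') _).ne' h5
    · exact h3'.ne' (neg_eq_zero.mp h5)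
    · exact h2 h5
  rw [Measure.prod_prod, mul_eq_zero] at hprod
  refine hprod.resolve_right fun h0 => hne ?_
  have h1 : ∀ᵐ x, ¬ 0 < u x := by simpa [ae_iff] using h0
  filter_upwards [h1, hu0] with x h1 h2
  exact le_antisymm (not_lt.mp h1) h2

theorem ae_pos (S : Setting s p q Ω V g) {m : ℝ} (hm : 0 ≤ m) (h : HasGradZero p Ω u G)
    (hu0 : ∀ᵐ x, 0 ≤ u x) (hne : ¬ ∀ᵐ x, u x = 0)
    (hweak : ∀ v H, HasGradZero p Ω v H →
      totalPairing s p Ω V u G v H - m * pairing p (weighted Ω g) u v = 0) :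
    ∀ᵐ x ∂(volume.restrict Ω), 0 < u x := by
  have hnull : volume {x | x ∈ Ω ∧ u x = 0} = 0 := by
    -- Around each point of `Ω` a nonnegative test function is nonzero on a neighbourhood, so the
    -- zero set is locally null.
    refine measure_null_of_locally_null _ fun x hx => ?_
    obtain ⟨φ, h1, h2, h3, h4, h5⟩ :=
      exists_contDiff_tsupport_subset (n := ⊤) (S.isOpen.mem_nhds hx.1)
    have hφ : IsTest Ω φ := ⟨h3, h2, h1⟩
    refine ⟨{x | u x = 0 ∧ φ x ≠ 0}, ?_, S.test_measure_zero hm h hu0 hne hweak hφ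
      fun x => (h4 ⟨x, rfl⟩).1⟩
    have h6 : ∀ᶠ y in 𝓝 x, φ y ≠ 0 :=
      h3.continuous.continuousAt.eventually_ne (by rw [h5]; exact one_ne_zero)
    filter_upwards [mem_nhdsWithin_of_mem_nhds h6, self_mem_nhdsWithin] with y hy hy'
    exact ⟨hy'.2, hy⟩
  rw [ae_restrict_iff' S.isOpen.measurableSet]
  have h1 : ∀ᵐ x, ¬ (x ∈ Ω ∧ u x = 0) := by simpa [ae_iff] using hnull
  filter_upwards [h1, hu0] with x h1 h2 hx
  exact lt_of_le_of_ne h2 fun e => h1 ⟨hx, e.symm⟩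

end Setting

theorem pairing_neg_left {α E : Type*} [MeasurableSpace α] [NormedAddCommGroup E]
    [InnerProductSpace ℝ E] (μ : Measure α) (a b : α → E) :
    pairing p μ (fun x => -a x) b = -pairing p μ a b := by
  simp only [pairing, norm_neg, inner_neg_left, mul_neg, integral_neg]

theorem totalPairing_neg_left (u v : Rn N → ℝ) (G H : Rn N → Rn N) :
    totalPairing s p Ω V (fun x => -u x) (fun x => -G x) v H = -totalPairing s p Ω V u G v H := by
  have e : diff (fun x => -u x) = fun z => -diff u z := by
    ext z; simp only [diff]; ring
  simp only [totalPairing, e, pairing_neg_left]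
  ring

end Positivity

end MixedEigenvalue

/-! ### Conclusion: constant sign and strict positivity of first eigenfunctions -/

theorem mainTheorem6 (N : ℕ) (hN : 2 ≤ N) (s p q : ℝ) (hs0 : 0 < s) (hs1 : s < 1)
    (hp1 : 1 < p) (hpN : p < N) (hq : N / (s * p) < q)
    (Ω : Set (MixedEigenvalue.Rn N)) (hΩo : IsOpen Ω) (hΩb : Bornology.IsBounded Ω)
    (hΩL : MixedEigenvalue.HasLipschitzBoundary Ω)
    (V g : MixedEigenvalue.Rn N → ℝ)
    (hVq : MemLp V (ENNReal.ofReal q) (volume.restrict Ω))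
    (hgq : MemLp g (ENNReal.ofReal q) (volume.restrict Ω))
    (hV : ∀ᵐ x ∂(volume.restrict Ω), 0 ≤ V x)
    (hg : ∀ᵐ x ∂(volume.restrict Ω), 0 < g x)
    (lam₁ : ℝ) (hlam₁ : MixedEigenvalue.IsFirstEigenvalue s p Ω V g lam₁)
    (u : MixedEigenvalue.Rn N → ℝ)
    (hu : MixedEigenvalue.IsEigenfunction s p Ω V g lam₁ u) :
    (∀ᵐ x ∂(volume.restrict Ω), 0 < u x) ∨ (∀ᵐ x ∂(volume.restrict Ω), u x < 0) := by
  have hNp : N / p ≤ q := by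
    refine le_trans ?_ hq.le
    have : s * p ≤ p := mul_le_of_le_one_left (by linarith) hs1.le
    gcongr
  have S : MixedEigenvalue.Setting s p q Ω V g :=
    ⟨hs0, hs1, hp1, hpN, hNp, hΩo, hΩb, hVq, hgq, hV, hg⟩
  obtain ⟨G, h, -⟩ := hu.1.1.exists_hasGradZero hp1 hΩo
  have hweak := (S.isWeakSolution_iff h lam₁).mp hu.1
  have hpos : 0 ≤ lam₁ := hlam₁.1.1.le
  have henergy : MixedEigenvalue.totalEnergy s p Ω V u G =
      lam₁ * MixedEigenvalue.energy p (MixedEigenvalue.weighted Ω g) u := by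
    -- Testing the equation with the eigenfunction itself shows that it attains equality in the
    -- variational inequality.
    have := hweak u G h
    simp only [MixedEigenvalue.totalPairing, MixedEigenvalue.pairing_self hp1] at this
    exact sub_eq_zero.mp this
  rcases S.ae_nonneg_or_nonpos hlam₁ h henergy with h0 | h0
  · exact Or.inl (S.ae_pos hpos h h0 hu.2 hweak)
  · right
    -- The equation is odd in `u`, so `-u` is a nonnegative solution.
    have h' : MixedEigenvalue.HasGradZero p Ω (fun x => -u x) (fun x => -G x) := by
      simpa using h.smul (-1)
    have hres := S.ae_pos hpos h' (h0.mono fun x hx => neg_nonneg.mpr hx)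
      (fun hz => hu.2 (hz.mono fun x hx => neg_eq_zero.mp hx))
      fun v H hv => by
        rw [MixedEigenvalue.totalPairing_neg_left, MixedEigenvalue.pairing_neg_left]
        linarith [hweak v H hv]
    exact hres.mono fun x hx => neg_pos.mp hx
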